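/- **Setting.** Let $X$ be a $C^k$ Riemannian manifold ($1\le k\le\infty$) of dimension $d$ with volume measure $m_X$, let $\mu$ be a probability measure on $X$ with a continuous density with respect to $m_X$, and let $T:X\to X$ be measurable and preserve $\mu$. Let $x^*\in X$ be a point at which the density of $\mu$ is positive, and let $B_r(x^*)$ be the open ball of radius $r$ around $x^*$ in the Riemannian distance. For measurable $A\subset X$ let $\varphi_A(x)=\min\{j\ge 1 : T^j(x)\in A\}$ (with $\min\emptyset=\infty$) and, if $\mu(A)>0$, $\mu_A(B)=\mu(A\cap B)/\mu(A)$. The norms $\|\cdot\|_{C^s}$ are Hölder norms computed in a fixed countable family of charts and compact pieces of their domains, the pieces being locally finite and their interiors covering $X$. Consider the following conditions. * **(MEM)** There are constants $0<s\le k$, $C>1$ and $\gamma>0$ such that $$\left|\int_X\prod_{j=0}^{n-1} f_j\circ T^{k_j}\,d\mu-\prod_{j=0}^{n-1}\int_X f_j\,d\mu\right|\le C\,e^{-\gamma\min_{0\le i<j\le n-1}|k_i-k_j|}\prod_{j=0}^{n-1}\|f_j\|_{C^s}$$ for all $n\ge 1$, all $f_0,\dots,f_{n-1}\in C^s$ and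 all integers $0\le k_0\le\dots\le k_{n-1}$. * **(LR$(x^*)$)** There is $c>0$ such that, for all sufficiently small $r>0$, $\varphi_{B_r(x^*)}(x)\ge c|\log r|$ for $\mu$-a.e. $x\in B_r(x^*)$. * **(NSR$(x^*)$)** There is $\xi:(0,\infty)\to(0,\infty)$ with $|\log r|=o(\xi(r))$ as $r\to0$ such that $\mu_{B_r(x^*)}\big(\varphi_{B_r(x^*)}\le\xi(r)\big)\to0$ as $r\to 0$. For a sequence $\alpha=(\alpha^{(n)})_{n\ge1}$ of positive integers put $\tilde\alpha^{(j)}=\sum_{i=1}^j\alpha^{(i)}$. Let $N^{(0)}=0$, let $N^{(n+1)}(x)=\min\{j>N^{(n)}(x): T^{\tilde\alpha^{(j)}}(x)\in A\}$ (with $\min\emptyset=\infty$), and let $\Phi_{A,\alpha}=(N^{(1)},\,N^{(2)}-N^{(1)},\,N^{(3)}-N^{(2)},\dots)$ be the sequence of consecutive delayed return times to $A$ (an entry is $\infty$ if the visit that ends it does not occur). **Theorem.** Suppose $T$ satisfies (MEM), (LR$(x^*)$) and (NSR$(x^*)$). Then $T$ satisfies the delayed PLT at $x^*$: for every sequence $\alpha$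 of positive integers, $$\mu(B_r(x^*))\,\Phi_{B_r(x^*),\alpha}\;\Longrightarrow\;\Phi_{Exp}\qquad\text{as } r\to0$$ in distribution under $\mu$, as random elements of $[0,\infty]^{\mathbb N}$ with the product topology, where $\Phi_{Exp}$ is a sequence of i.i.d. standard exponential random variables. In particular this holds if (LR$(x^*)$) is replaced by the stronger condition (SLR$(x^*)$): there is $\psi:(0,\infty)\to(0,\infty)$ with $|\log r|=o(\psi(r))$ as $r\to0$ such that $\varphi_{B_r(x^*)}\ge\psi(r)$ $\mu$-a.e. on $B_r(x^*)$ for all $r>0$. -/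

import Mathlib

open MeasureTheory ProbabilityTheory Filter Topology Asymptotics
open scoped Manifold ENNReal NNReal Bundle

noncomputable section

namespace DelayedPoisson

/-! ### Hölder norms on a manifold -/

/-- Data with respect to which `C^s` norms on a `C^k` manifold `X` (without boundary, of dimension
`d`) are computed: a countable family of charts of the maximal `C^k` atlas, with a compact piece
inside the domain of each of them; the pieces are locally finite and their interiors cover `X`.
Pieces may be empty, so finite families are included. If `X` is compact, any two choices
give equivalent norms. -/
structure ChartCover (d : ℕ) (k : ℕ∞) (X : Type*) [TopologicalSpace X]
    [ChartedSpace (EuclideanSpace ℝ (Fin d)) X] where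
  chart : ℕ → OpenPartialHomeomorph X (EuclideanSpace ℝ (Fin d))
  piece : ℕ → Set X
  chart_mem : ∀ i, chart i ∈ IsManifold.maximalAtlas (𝓡 d) k X
  isCompact_piece : ∀ i, IsCompact (piece i)
  piece_subset : ∀ i, piece i ⊆ (chart i).source
  locallyFinite_piece : LocallyFinite piece
  iUnion_interior_piece : ⋃ i, interior (piece i) = Set.univ

section Norm

variable {d : ℕ} {k : ℕ∞} {X : Type*} [TopologicalSpace X]
  [ChartedSpace (EuclideanSpace ℝ (Fin d)) X]

/-- The `j`-th derivative of `f`, read in the `i`-th chart, at the point `x`. -/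
def ChartCover.deriv (𝒜 : ChartCover d k X) (f : X → ℝ) (i j : ℕ) (x : X) :
    ContinuousMultilinearMap ℝ (fun _ : Fin j => EuclideanSpace ℝ (Fin d)) ℝ :=
  iteratedFDeriv ℝ j (f ∘ (𝒜.chart i).symm) (𝒜.chart i x)

/-- The `C^s` norm, for a real number `s ≥ 0`: the sum of the sup norms of the derivatives of order
at most `⌊s⌋` and, if `s` is not an integer, of the Hölder seminorm of exponent `s - ⌊s⌋`
of the derivatives of order `⌊s⌋`. -/
def ChartCover.crNorm (𝒜 : ChartCover d k X) (s : ℝ) (f : X → ℝ) : ℝ≥0∞ :=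
  (∑ j ∈ Finset.range (⌊s⌋₊ + 1), ⨆ i, ⨆ x ∈ 𝒜.piece i, ‖𝒜.deriv f i j x‖ₑ) +
    if Int.fract s = 0 then 0 else
      ⨆ i, ⨆ x ∈ 𝒜.piece i, ⨆ y ∈ 𝒜.piece i,
        ‖𝒜.deriv f i ⌊s⌋₊ x - 𝒜.deriv f i ⌊s⌋₊ y‖ₑ /
          edist (𝒜.chart i x) (𝒜.chart i y) ^ Int.fract s

/-- Functions of class `C^s` with finite `C^s` norm. -/
def ChartCover.IsCr (𝒜 : ChartCover d k X) (s : ℝ) (f : X → ℝ) : Prop :=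
  ContMDiff (𝓡 d) 𝓘(ℝ) ⌊s⌋₊ f ∧ 𝒜.crNorm s f ≠ ⊤

/-- Exponential mixing of all orders. The condition on `t` and `p` says that `t` is nondecreasing
and that `p` is at most the minimal gap of `t`, so the bound amounts to the one with `p` equal to
the minimal gap (which is `∞` if `n = 1`). -/
def ExpMixingAllOrders (𝒜 : ChartCover d k X) [MeasurableSpace X] (μ : Measure X) (T : X → X) :
    Prop :=
  ∃ s : ℝ, 0 < s ∧ (⌈s⌉₊ : ℕ∞) ≤ k ∧ ∃ C : ℝ, 1 < C ∧ ∃ γ : ℝ, 0 < γ ∧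
    ∀ n : ℕ, 1 ≤ n → ∀ f : Fin n → X → ℝ, (∀ j, 𝒜.IsCr s (f j)) →
      ∀ (t : Fin n → ℕ) (p : ℕ), (∀ i j, i < j → t i + p ≤ t j) →
        |(∫ x, ∏ j, f j (T^[t j] x) ∂μ) - ∏ j, ∫ x, f j x ∂μ| ≤
          C * Real.exp (-γ * p) * ∏ j, (𝒜.crNorm s (f j)).toReal

end Norm

/-! ### Return times and recurrence conditions -/

/-- The first return (or hitting) time `min {j ≥ 1 | T^j x ∈ A}`, with `min ∅ = ∞`. -/
def returnTime {X : Type*} (T : X → X) (A : Set X) (x : X) : ℝ≥0∞ :=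
  ⨅ (j : ℕ) (_ : 1 ≤ j ∧ T^[j] x ∈ A), (j : ℝ≥0∞)

/-- Returns to small balls around `c` are at least logarithmically large. -/
def LogRecurrent {X : Type*} [EMetricSpace X] [MeasurableSpace X] (μ : Measure X) (T : X → X)
    (c : X) : Prop :=
  ∃ a : ℝ, 0 < a ∧ ∀ᶠ r : ℝ in 𝓝[>] 0, ∀ᵐ x ∂μ, x ∈ Metric.eball c (ENNReal.ofReal r) →
    ENNReal.ofReal (a * |Real.log r|) ≤ returnTime T (Metric.eball c (ENNReal.ofReal r)) x

/-- Short returns to small balls around `c` are rare. -/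
def NoShortReturns {X : Type*} [EMetricSpace X] [MeasurableSpace X] (μ : Measure X) (T : X → X)
    (c : X) : Prop :=
  ∃ ξ : ℝ → ℝ, (∀ r, 0 < r → 0 < ξ r) ∧
    (fun r : ℝ => |Real.log r|) =o[𝓝[>] 0] ξ ∧
    Tendsto (fun r : ℝ => (ProbabilityTheory.cond μ (Metric.eball c (ENNReal.ofReal r)))
        {x | returnTime T (Metric.eball c (ENNReal.ofReal r)) x ≤ ENNReal.ofReal (ξ r)})
      (𝓝[>] 0) (𝓝 0)

/-! ### Delayed return times -/

/-- The delayed times: the sum of the first `j` delays (the first delay is `α 0`). -/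
def delayedTime (α : ℕ → ℕ) (j : ℕ) : ℕ := ∑ i ∈ Finset.range j, α i

/-- The index `j ≥ 1` of the `n`-th visit to `A` along the delayed orbit
`j ↦ T^(delayedTime α j) x`, for `n ≥ 1`; it is `∞` if there are fewer than `n` visits. -/
def delayedHit {X : Type*} (T : X → X) (α : ℕ → ℕ) (A : Set X) (x : X) : ℕ → ℝ≥0∞
  | 0 => 0
  | n + 1 => ⨅ (j : ℕ) (_ : delayedHit T α A x n < j ∧ T^[delayedTime α j] x ∈ A), (j : ℝ≥0∞)

open Classical in
/-- The sequence of consecutive delayed return times: its first term (`n = 0`) is the index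
of the first visit, the others are the differences of the indices of successive visits; a term
is `∞` if the visit that ends it does not take place. -/
def delayedReturn {X : Type*} (T : X → X) (α : ℕ → ℕ) (A : Set X) (x : X) (n : ℕ) : ℝ≥0∞ :=
  if delayedHit T α A x (n + 1) = ⊤ then ⊤
  else delayedHit T α A x (n + 1) - delayedHit T α A x n

/-! ### The delayed Poisson limit theorem -/

instance isProbabilityMeasure_exp_one : IsProbabilityMeasure (expMeasure 1) :=
  isProbabilityMeasure_expMeasure one_pos

/-- The delayed PLT along `α` at `c`: as `r → 0`, the sequence of consecutive delayed return times
to the ball of radius `r`, multiplied by the measure of the ball and viewed as a random element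
of `[0, ∞]^ℕ` (product topology) under `μ`, converges in distribution to an i.i.d. sequence of
standard exponential random variables. -/
def DelayedPLTAlong {X : Type*} [EMetricSpace X] [MeasurableSpace X] (μ : Measure X)
    [IsProbabilityMeasure μ] (T : X → X) (α : ℕ → ℕ) (c : X) : Prop :=
  TendstoInDistribution
    (fun (r : ℝ) (x : X) (n : ℕ) => μ (Metric.eball c (ENNReal.ofReal r)) *
      delayedReturn T α (Metric.eball c (ENNReal.ofReal r)) x n)
    (𝓝[>] 0)
    (fun (ω : ℕ → ℝ) (n : ℕ) => ENNReal.ofReal (ω n))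
    (fun _ => μ)
    (Measure.infinitePi fun _ : ℕ => expMeasure 1)

/-- The delayed PLT at `c`: it holds along every sequence of positive integers. -/
def DelayedPLT {X : Type*} [EMetricSpace X] [MeasurableSpace X] (μ : Measure X)
    [IsProbabilityMeasure μ] (T : X → X) (c : X) : Prop :=
  ∀ α : ℕ → ℕ, (∀ i, 1 ≤ α i) → DelayedPLTAlong μ T α c

end DelayedPoisson

end

/-! Write p for the measure of the ball of radius r. During about τ / p delayed times the visits to
the ball should look like independent trials with success probability p. The waiting times of such
trials are geometric and, multiplied by p, become exponential as p → 0. The delays enter only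
through the strict monotonicity of their partial sums: two indices are at least as far apart in time
as they are as integers.

Independence at logarithmic gaps. In a linearly normalized chart the metric near the centre is
almost Euclidean, so the indicator of the ball is squeezed between smooth bumps with integrals
within a factor 1 ± ε of p and Hölder norms bounded by powers of 1 / r
(`exists_smooth_approximations`). Over gaps K |log r| the mixing error is of order r ^ (γ K), which
for large K beats these powers and p ^ n. Hence n visits at such gaps have joint probability p ^ n
(1 + o(1)) (`logMixing_of_approximations`).

Clusters. If short returns are rare, then p ξ(r) stays bounded by a disjointness argument, so p |log
r| → 0 and the index sets containing a close pair have negligible Bernoulli weight. Points with a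
visit followed by a return within ξ(r) have mass at most τ times the conditional probability of a
short return; they are discarded, and on the remaining set `lateReturns` no two visits in the window
are closer than K |log r|. Discarding could still disturb the sums of joint probabilities, since
these integrate an unbounded number of visits. Here the logarithmic recurrence is used: visits are a
|log r| apart, so a fixed fraction of them is K |log r|-separated, and mixing bounds the moments of
their number (`sum_measureReal_compl_inter_le`). The outcome is `tendsto_sum_abs_hitMass_sub`.

From joint probabilities to the law. The Bonferroni inequalities convert this into closeness, summed
over all patterns with n visits, of the probabilities of exact visit patterns to Bernoulli weights
(`sum_abs_patternMass_sub_le`). The event that the first n returns lie in given intervals is a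
disjoint union of such patterns (`abs_measureReal_delayedReturn_sub_le`). The resulting convergence
on boxes gives weak convergence, because boxes form a π-system containing small neighbourhoods of
almost every point for the limit law (`tendsto_probabilityMeasure_of_ae_nhds`). -/

namespace DelayedPoisson

/-! ### Almost isometric charts of a Riemannian manifold -/

section Charts

open Set Manifold

variable {d : ℕ} {X : Type*} [EMetricSpace X]
    [ChartedSpace (EuclideanSpace ℝ (Fin d)) X] [IsManifold (𝓡 d) 1 X]
    [Bundle.RiemannianBundle (fun x : X => TangentSpace (𝓡 d) x)]

/-- A linear change of coordinates in the chart at `c` that makes the Riemannian metric at `c`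
the Euclidean one; near `c` the metric then is almost Euclidean. -/
theorem exists_normalizing_equiv [IsContinuousRiemannianBundle (EuclideanSpace ℝ (Fin d))
      (fun x : X => TangentSpace (𝓡 d) x)] (c : X) :
    ∃ A : EuclideanSpace ℝ (Fin d) ≃L[ℝ] EuclideanSpace ℝ (Fin d), ∀ r : ℝ, 1 < r →
      ∀ᶠ y in 𝓝 c, (∀ w, ‖(trivializationAt (EuclideanSpace ℝ (Fin d))
          (TangentSpace (𝓡 d)) c).symmL ℝ y w‖ ≤ r * ‖A w‖) ∧
        ∀ v : TangentSpace (𝓡 d) y, ‖A ((trivializationAt (EuclideanSpace ℝ (Fin d))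
          (TangentSpace (𝓡 d)) c).continuousLinearMapAt ℝ y v)‖ ≤ r * ‖v‖ := by
  set τ := trivializationAt (EuclideanSpace ℝ (Fin d)) (TangentSpace (𝓡 d)) c with hτ
  have hc : c ∈ τ.baseSet := FiberBundle.mem_baseSet_trivializationAt' c
  let G : TangentSpace (𝓡 d) c ≃L[ℝ] EuclideanSpace ℝ (Fin d) :=
    τ.continuousLinearEquivAt ℝ c hc
  have hG : ∀ v, G v = τ.continuousLinearMapAt ℝ c v := fun v => by
    simp [G, Bundle.Trivialization.coe_continuousLinearEquivAt_eq _ hc]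
  have hG' : ∀ w, G.symm w = τ.symmL ℝ c w := fun w => by
    rw [τ.symmL_apply hc]; simp [G]
  have : FiniteDimensional ℝ (TangentSpace (𝓡 d) c) :=
    LinearEquiv.finiteDimensional G.symm.toLinearEquiv
  have hd : Module.finrank ℝ (TangentSpace (𝓡 d) c) = d := by
    rw [LinearEquiv.finrank_eq G.toLinearEquiv]; simp
  let S : TangentSpace (𝓡 d) c ≃ₗᵢ[ℝ] EuclideanSpace ℝ (Fin d) :=
    ((stdOrthonormalBasis ℝ (TangentSpace (𝓡 d) c)).reindex (finCongr hd)).repr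
  -- With this choice ‖A w‖ is the Riemannian norm at `c` of the tangent vector with coordinates w;
  -- continuity of the metric then compares it with the norms at nearby points.
  let A : EuclideanSpace ℝ (Fin d) ≃L[ℝ] EuclideanSpace ℝ (Fin d) :=
    (G.symm.toLinearEquiv.trans S.toLinearEquiv).toContinuousLinearEquiv
  have hA : ∀ w, ‖A w‖ = ‖τ.symmL ℝ c w‖ := fun w => by
    rw [← hG']; exact S.norm_map (G.symm w)
  refine ⟨A, fun r hr => ?_⟩
  filter_upwards [eventually_norm_symmL_trivializationAt_comp_self_lt
      (EuclideanSpace ℝ (Fin d)) (fun x : X => TangentSpace (𝓡 d) x) c hr,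
    eventually_norm_symmL_trivializationAt_self_comp_lt
      (EuclideanSpace ℝ (Fin d)) (fun x : X => TangentSpace (𝓡 d) x) c hr] with y h1 h2
  refine ⟨fun w => ?_, fun v => ?_⟩
  · have h3 := ContinuousLinearMap.le_of_opNorm_le _ h1.le (τ.symmL ℝ c w)
    rw [hA]
    refine le_trans (le_of_eq ?_) h3
    simp only [ContinuousLinearMap.comp_apply]
    congr 2
    rw [← hG', ← hG, G.apply_symm_apply]
  · have h3 := ContinuousLinearMap.le_of_opNorm_le _ h2.le v
    rw [hA]
    exact h3

/-- The derivative of the inverse chart is the inverse of the tangent bundle trivialization, so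
speeds of curves drawn in the chart can be read off from the trivialization. -/
theorem norm_mfderivWithin_extChartAt_symm (c : X) {z : EuclideanSpace ℝ (Fin d)}
    (hz : z ∈ (extChartAt (𝓡 d) c).target) (w : EuclideanSpace ℝ (Fin d)) :
    ‖mfderivWithin 𝓘(ℝ, EuclideanSpace ℝ (Fin d)) (𝓡 d) (extChartAt (𝓡 d) c).symm
      (range (𝓡 d)) z w‖ = ‖(trivializationAt (EuclideanSpace ℝ (Fin d))
          (TangentSpace (𝓡 d)) c).symmL ℝ ((extChartAt (𝓡 d) c).symm z) w‖ := by
  have hx : (extChartAt (𝓡 d) c).symm z ∈ (chartAt (EuclideanSpace ℝ (Fin d)) c).source := by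
    rw [← extChartAt_source (𝓡 d)]
    exact (extChartAt (𝓡 d) c).map_target hz
  rw [TangentBundle.symmL_trivializationAt hx]
  have h1 := (extChartAt (𝓡 d) c).right_inv hz
  -- The norm belongs to the tangent space over the image of z, so the point of differentiation is
  -- decoupled from z before the equality is substituted.
  have aux : ∀ z' z : EuclideanSpace ℝ (Fin d), z' = z →
      ‖mfderivWithin 𝓘(ℝ, EuclideanSpace ℝ (Fin d)) (𝓡 d) (extChartAt (𝓡 d) c).symm
      (range (𝓡 d)) z w‖ = @norm (TangentSpace (𝓡 d) ((extChartAt (𝓡 d) c).symm z)) _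
        (mfderivWithin 𝓘(ℝ, EuclideanSpace ℝ (Fin d)) (𝓡 d) (extChartAt (𝓡 d) c).symm
      (range (𝓡 d)) z' w) := by
    rintro _ _ rfl; rfl
  exact aux _ _ h1

variable [IsRiemannianManifold (𝓡 d) X]

/-- The straight segment between two points in the chart, carried back to the manifold, is a
competitor for the Riemannian distance. A ball in the chart is convex, so the segment stays where
the derivative bound holds. -/
theorem eventually_edist_le_of_symmL_le (c : X)
    (A : EuclideanSpace ℝ (Fin d) ≃L[ℝ] EuclideanSpace ℝ (Fin d)) (r : ℝ) (hr : 0 ≤ r)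
    (h : ∀ᶠ y in 𝓝 c, ∀ w, ‖(trivializationAt (EuclideanSpace ℝ (Fin d))
          (TangentSpace (𝓡 d)) c).symmL ℝ y w‖ ≤ r * ‖A w‖) :
    ∃ U ∈ 𝓝 c, ∀ x ∈ U, ∀ y ∈ U, edist x y ≤ ENNReal.ofReal r *
      edist (A (extChartAt (𝓡 d) c x)) (A (extChartAt (𝓡 d) c y)) := by
  set e := extChartAt (𝓡 d) c with he
  have h1 : ∀ᶠ z in 𝓝 (e c), z ∈ e.target ∧ ∀ w, ‖(trivializationAt (EuclideanSpace ℝ (Fin d))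
          (TangentSpace (𝓡 d)) c).symmL ℝ (e.symm z) w‖ ≤ r * ‖A w‖ := by
    have h2 : e.target ∈ 𝓝 (e c) := extChartAt_target_mem_nhds c
    have h3 : Tendsto e.symm (𝓝 (e c)) (𝓝 c) := by
      have := continuousAt_extChartAt_symm (I := 𝓡 d) c
      rw [ContinuousAt, extChartAt_to_inv] at this
      exact this
    exact (eventually_mem_set.2 h2).and (h3.eventually h)
  obtain ⟨δ, hδ, hb⟩ := Metric.eventually_nhds_iff_ball.1 h1
  refine ⟨e.source ∩ e ⁻¹' Metric.ball (e c) δ, inter_mem (extChartAt_source_mem_nhds c)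
    ((continuousAt_extChartAt c).preimage_mem_nhds (Metric.ball_mem_nhds _ hδ)), ?_⟩
  rintro x ⟨hxs, hx⟩ y ⟨hys, hy⟩
  let η := ContinuousAffineMap.lineMap (R := ℝ) (e x) (e y)
  have hη : ∀ t ∈ Icc (0 : ℝ) 1, η t ∈ Metric.ball (e c) δ := by
    intro t ht
    apply (convex_ball (e c) δ).segment_subset hx hy
    rw [segment_eq_image_lineMap]
    exact ⟨t, ht, rfl⟩
  have η_smooth : ContMDiff 𝓘(ℝ, ℝ) 𝓘(ℝ, EuclideanSpace ℝ (Fin d)) 1 η := by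
    rw [contMDiff_iff_contDiff]
    exact ContinuousAffineMap.contDiff _
  have hmaps : MapsTo η (Icc (0 : ℝ) 1) e.target := fun t ht => (hb _ (hη t ht)).1
  have hfd : ∀ t ∈ Icc (0 : ℝ) 1, fderivWithin ℝ η (Icc 0 1) t 1 = e y - e x := by
    intro t ht
    rw [fderivWithin_eq_fderiv (uniqueDiffOn_Icc zero_lt_one _ ht)
      (ContinuousAffineMap.differentiableAt _)]
    simp [η]
  rw [IsRiemannianManifold.out (I := 𝓡 d) x y]
  have h4 : riemannianEDist (𝓡 d) x y ≤ pathELength (𝓡 d) (e.symm ∘ η) 0 1 := by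
    apply riemannianEDist_le_pathELength _ _ _ zero_le_one
    · exact (contMDiffOn_extChartAt_symm c).comp η_smooth.contMDiffOn hmaps
    · simp only [Function.comp_apply, η, ContinuousAffineMap.coe_lineMap_eq,
        AffineMap.lineMap_apply_zero]
      exact e.left_inv hxs
    · simp only [Function.comp_apply, η, ContinuousAffineMap.coe_lineMap_eq,
        AffineMap.lineMap_apply_one]
      exact e.left_inv hys
  refine h4.trans ?_
  rw [pathELength_eq_lintegral_mfderivWithin_Icc]
  have h5 : ∀ t ∈ Icc (0 : ℝ) 1, ‖mfderivWithin 𝓘(ℝ, ℝ) (𝓡 d) (e.symm ∘ η) (Icc 0 1) t 1‖ₑ ≤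
      ENNReal.ofReal r * edist (A (e x)) (A (e y)) := by
    intro t ht
    have h6 : mfderivWithin 𝓘(ℝ, ℝ) (𝓡 d) (e.symm ∘ η) (Icc 0 1) t =
        (mfderivWithin 𝓘(ℝ, EuclideanSpace ℝ (Fin d)) (𝓡 d) e.symm (range (𝓡 d)) (η t)) ∘L
          (mfderivWithin 𝓘(ℝ, ℝ) 𝓘(ℝ, EuclideanSpace ℝ (Fin d)) η (Icc 0 1) t) := by
      apply mfderivWithin_comp
      · exact mdifferentiableWithinAt_extChartAt_symm (hmaps ht)
      · exact η_smooth.contMDiffOn.mdifferentiableOn one_ne_zero t ht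
      · exact fun t ht => extChartAt_target_subset_range c (hmaps ht)
      · rw [uniqueMDiffWithinAt_iff_uniqueDiffWithinAt]
        exact uniqueDiffOn_Icc zero_lt_one t ht
    have h7 : mfderivWithin 𝓘(ℝ, ℝ) 𝓘(ℝ, EuclideanSpace ℝ (Fin d)) η (Icc 0 1) t 1 =
        e y - e x := by
      rw [mfderivWithin_eq_fderivWithin]
      exact hfd t ht
    have h8 : mfderivWithin 𝓘(ℝ, ℝ) (𝓡 d) (e.symm ∘ η) (Icc 0 1) t 1 =
        mfderivWithin 𝓘(ℝ, EuclideanSpace ℝ (Fin d)) (𝓡 d) e.symm (range (𝓡 d)) (η t)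
          (e y - e x) := by
      rw [← h7]; exact congr($h6 1)
    rw [edist_comm, edist_eq_enorm_sub, ← map_sub, ← ofReal_norm, ← ofReal_norm,
      ← ENNReal.ofReal_mul hr]
    apply ENNReal.ofReal_le_ofReal
    rw [h8]
    exact (norm_mfderivWithin_extChartAt_symm c (hmaps ht) (e y - e x)).trans_le
      ((hb _ (hη t ht)).2 _)
  refine (setLIntegral_mono' measurableSet_Icc h5).trans ?_
  simp

/-- An almost shortest curve between nearby points stays near `c`. Its image in the chart is at most
`r` times as long, and is at least as long as the segment joining its ends. -/
theorem eventually_le_edist_of_continuousLinearMapAt_le (c : X)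
    (A : EuclideanSpace ℝ (Fin d) ≃L[ℝ] EuclideanSpace ℝ (Fin d)) (r : ℝ) (hr : 0 < r)
    (h : ∀ᶠ y in 𝓝 c, ∀ v : TangentSpace (𝓡 d) y,
      ‖A ((trivializationAt (EuclideanSpace ℝ (Fin d))
          (TangentSpace (𝓡 d)) c).continuousLinearMapAt ℝ y v)‖ ≤ r * ‖v‖) :
    ∃ U ∈ 𝓝 c, ∀ x ∈ U, ∀ y ∈ U,
      edist (A (extChartAt (𝓡 d) c x)) (A (extChartAt (𝓡 d) c y)) ≤
        ENNReal.ofReal r * edist x y := by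
  set e := extChartAt (𝓡 d) c with he
  obtain ⟨ε, hε, hb⟩ := EMetric.mem_nhds_iff.1
    (inter_mem h (chart_source_mem_nhds (EuclideanSpace ℝ (Fin d)) c))
  -- Points of this smaller ball are less than ε / 2 apart, and a curve shorter than ε / 2 that
  -- starts in it does not leave the ball of radius ε.
  have hε4 : 0 < ε / 4 := ENNReal.div_pos hε.ne' (by simp)
  refine ⟨Metric.eball c (ε / 4), Metric.eball_mem_nhds _ hε4, ?_⟩
  intro x hx y hy
  have hxy : edist x y < ε / 2 := by
    have h1 : edist x y ≤ edist x c + edist y c := edist_triangle_right x y c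
    refine h1.trans_lt ((ENNReal.add_lt_add hx hy).trans_le (le_of_eq ?_))
    rw [← two_mul, show (4 : ℝ≥0∞) = 2 * 2 by norm_num, div_eq_mul_inv, div_eq_mul_inv,
      ENNReal.mul_inv (by simp) (by simp), ← mul_assoc, mul_comm 2 ε, mul_assoc, ← mul_assoc 2,
      ENNReal.mul_inv_cancel (by simp) (by simp), one_mul]
  -- The infimum defining the distance need not be attained, so the bound is shown for each larger
  -- `l`, which decreases to the distance at the end.
  have key : ∀ l, edist x y < l → edist (A (e x)) (A (e y)) ≤ ENNReal.ofReal r * l := by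
    intro l hl
    have h2 : riemannianEDist (𝓡 d) x y < min l (ε / 2) := by
      rw [← IsRiemannianManifold.out (I := 𝓡 d) x y]; exact lt_min hl hxy
    obtain ⟨γ, hγ0, hγ1, hγ, hlen⟩ := exists_lt_of_riemannianEDist_lt h2
    have hmem : ∀ t ∈ Icc (0 : ℝ) 1, γ t ∈ Metric.eball c ε := by
      intro t ht
      have h3 : edist x (γ t) ≤ pathELength (𝓡 d) γ 0 1 := by
        rw [IsRiemannianManifold.out (I := 𝓡 d) x (γ t)]
        exact (riemannianEDist_le_pathELength (hγ.mono (Icc_subset_Icc_right ht.2)) hγ0 rfl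
          ht.1).trans (pathELength_mono le_rfl ht.2)
      have h4 : edist x (γ t) < ε / 2 := h3.trans_lt (hlen.trans_le (min_le_right _ _))
      rw [Metric.mem_eball]
      calc edist (γ t) c ≤ edist x (γ t) + edist x c := edist_triangle_left _ _ _
        _ < ε / 2 + ε / 4 := ENNReal.add_lt_add h4 hx
        _ ≤ ε / 2 + ε / 2 := by gcongr; norm_num
        _ = ε := ENNReal.add_halves ε
    have hsrc : MapsTo γ (Icc (0 : ℝ) 1) (chartAt (EuclideanSpace ℝ (Fin d)) c).source :=
      fun t ht => (hb (hmem t ht)).2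
    have he1 : ContMDiffOn 𝓘(ℝ, ℝ) 𝓘(ℝ, EuclideanSpace ℝ (Fin d)) 1 (e ∘ γ) (Icc 0 1) :=
      contMDiffOn_extChartAt.comp hγ hsrc
    have he2 : ContDiffOn ℝ 1 (e ∘ γ) (Icc 0 1) := contMDiffOn_iff_contDiffOn.1 he1
    have he3 : ContDiffOn ℝ 1 (A ∘ e ∘ γ) (Icc 0 1) := A.contDiff.comp_contDiffOn he2
    have h5 : edist (A (e x)) (A (e y)) ≤
        ∫⁻ t in Icc (0 : ℝ) 1, ‖derivWithin (A ∘ e ∘ γ) (Icc 0 1) t‖ₑ := by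
      have := enorm_sub_le_lintegral_derivWithin_Icc_of_contDiffOn_Icc he3 zero_le_one
      rw [edist_comm, edist_eq_enorm_sub]
      simpa [hγ0, hγ1] using this
    have h6 : ∀ t ∈ Icc (0 : ℝ) 1, ‖derivWithin (A ∘ e ∘ γ) (Icc 0 1) t‖ₑ ≤
        ENNReal.ofReal r * ‖mfderivWithin 𝓘(ℝ, ℝ) (𝓡 d) γ (Icc 0 1) t 1‖ₑ := by
      intro t ht
      have hu := uniqueDiffOn_Icc (zero_lt_one' ℝ) t ht
      have h7 : derivWithin (A ∘ e ∘ γ) (Icc 0 1) t =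
          A (fderivWithin ℝ (e ∘ γ) (Icc 0 1) t 1) := by
        rw [← fderivWithin_derivWithin, A.comp_fderivWithin hu]
        rfl
      have h8 : mfderivWithin 𝓘(ℝ, ℝ) 𝓘(ℝ, EuclideanSpace ℝ (Fin d)) (e ∘ γ) (Icc 0 1) t =
          (mfderiv (𝓡 d) 𝓘(ℝ, EuclideanSpace ℝ (Fin d)) e (γ t)) ∘L
            (mfderivWithin 𝓘(ℝ, ℝ) (𝓡 d) γ (Icc 0 1) t) := by
        apply mfderiv_comp_mfderivWithin
        · exact mdifferentiableAt_extChartAt (hsrc ht)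
        · exact hγ.mdifferentiableOn one_ne_zero t ht
        · rw [uniqueMDiffWithinAt_iff_uniqueDiffWithinAt]
          exact hu
      have h9 : fderivWithin ℝ (e ∘ γ) (Icc 0 1) t 1 =
          (trivializationAt (EuclideanSpace ℝ (Fin d)) (TangentSpace (𝓡 d)) c).continuousLinearMapAt
            ℝ (γ t) (mfderivWithin 𝓘(ℝ, ℝ) (𝓡 d) γ (Icc 0 1) t 1) := by
        rw [TangentBundle.continuousLinearMapAt_trivializationAt (hsrc ht),
          ← mfderivWithin_eq_fderivWithin]
        exact congr($h8 1)
      rw [h7, h9, ← ofReal_norm, ← ofReal_norm, ← ENNReal.ofReal_mul hr.le]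
      exact ENNReal.ofReal_le_ofReal ((hb (hmem t ht)).1 _)
    calc edist (A (e x)) (A (e y))
        ≤ ∫⁻ t in Icc (0 : ℝ) 1, ENNReal.ofReal r *
          ‖mfderivWithin 𝓘(ℝ, ℝ) (𝓡 d) γ (Icc 0 1) t 1‖ₑ :=
        h5.trans (setLIntegral_mono' measurableSet_Icc h6)
      _ = ENNReal.ofReal r * pathELength (𝓡 d) γ 0 1 := by
        rw [lintegral_const_mul' _ _ ENNReal.ofReal_ne_top,
          pathELength_eq_lintegral_mfderivWithin_Icc]
      _ ≤ ENNReal.ofReal r * l := by gcongr; exact (hlen.trans_le (min_le_left _ _)).le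
  have hr0 : ENNReal.ofReal r ≠ 0 := by simpa using hr
  have h10 : edist (A (e x)) (A (e y)) / ENNReal.ofReal r ≤ edist x y :=
    le_of_forall_gt_imp_ge_of_dense fun l hl => ENNReal.div_le_of_le_mul' (key l hl)
  rwa [ENNReal.div_le_iff_le_mul (Or.inl hr0) (Or.inl ENNReal.ofReal_ne_top), mul_comm] at h10

/-- Up to a linear change of coordinates, the chart at a point is bi-Lipschitz near the point, with
constants arbitrarily close to one. -/
theorem exists_almost_isometric_chart [IsContinuousRiemannianBundle (EuclideanSpace ℝ (Fin d))
      (fun x : X => TangentSpace (𝓡 d) x)] (c : X) :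
    ∃ A : EuclideanSpace ℝ (Fin d) ≃L[ℝ] EuclideanSpace ℝ (Fin d), ∀ r : ℝ, 1 < r →
      ∃ U ∈ 𝓝 c, ∀ x ∈ U, ∀ y ∈ U,
        edist x y ≤ ENNReal.ofReal r *
          edist (A (chartAt (EuclideanSpace ℝ (Fin d)) c x))
            (A (chartAt (EuclideanSpace ℝ (Fin d)) c y)) ∧
        edist (A (chartAt (EuclideanSpace ℝ (Fin d)) c x))
            (A (chartAt (EuclideanSpace ℝ (Fin d)) c y)) ≤ ENNReal.ofReal r * edist x y := by
  obtain ⟨A, hA⟩ := exists_normalizing_equiv (d := d) c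
  refine ⟨A, fun r hr => ?_⟩
  obtain ⟨U, hU, h1⟩ := eventually_edist_le_of_symmL_le c A r (by linarith)
    ((hA r hr).mono fun y hy => hy.1)
  obtain ⟨U', hU', h2⟩ := eventually_le_edist_of_continuousLinearMapAt_le c A r (by linarith)
    ((hA r hr).mono fun y hy => hy.2)
  simp only [extChartAt, OpenPartialHomeomorph.extend, PartialEquiv.coe_trans,
    ModelWithCorners.toPartialEquiv_coe, OpenPartialHomeomorph.toFun_eq_coe,
    modelWithCornersSelf_coe, Function.comp_apply, id_eq] at h1 h2
  exact ⟨U ∩ U', inter_mem hU hU', fun x hx y hy =>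
    ⟨h1 x hx.1 y hy.1, h2 x hx.2 y hy.2⟩⟩

end Charts

/-! ### Measures of small chart balls -/

section Volume

open Set

variable {d : ℕ} {X : Type*} [EMetricSpace X] [ChartedSpace (EuclideanSpace ℝ (Fin d)) X]

/-- The preimage of a Euclidean ball under the chart at `c`, followed by the linear map `A`. -/
def chartBall (c : X) (A : EuclideanSpace ℝ (Fin d) ≃L[ℝ] EuclideanSpace ℝ (Fin d)) (s : ℝ) :
    Set X :=
  {x | x ∈ (chartAt (EuclideanSpace ℝ (Fin d)) c).source ∧
    ‖A (chartAt (EuclideanSpace ℝ (Fin d)) c x - chartAt (EuclideanSpace ℝ (Fin d)) c c)‖ < s}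

theorem isOpen_chartBall (c : X) (A : EuclideanSpace ℝ (Fin d) ≃L[ℝ] EuclideanSpace ℝ (Fin d))
    (s : ℝ) : IsOpen (chartBall c A s) := by
  have h : chartBall c A s = (chartAt (EuclideanSpace ℝ (Fin d)) c).source ∩
      (chartAt (EuclideanSpace ℝ (Fin d)) c) ⁻¹'
        {z | ‖A (z - chartAt (EuclideanSpace ℝ (Fin d)) c c)‖ < s} := rfl
  rw [h]
  apply OpenPartialHomeomorph.isOpen_inter_preimage
  exact isOpen_lt (by fun_prop) continuous_const

theorem eventually_chart_symm_mem (c : X)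
    (A : EuclideanSpace ℝ (Fin d) ≃L[ℝ] EuclideanSpace ℝ (Fin d)) {U : Set X} (hU : U ∈ 𝓝 c) :
    ∀ᶠ w in 𝓝 (0 : EuclideanSpace ℝ (Fin d)),
      chartAt (EuclideanSpace ℝ (Fin d)) c c + A.symm w ∈
        (chartAt (EuclideanSpace ℝ (Fin d)) c).target ∧
      (chartAt (EuclideanSpace ℝ (Fin d)) c).symm
        (chartAt (EuclideanSpace ℝ (Fin d)) c c + A.symm w) ∈ U := by
  set ψ := chartAt (EuclideanSpace ℝ (Fin d)) c
  have h1 : Tendsto (fun w => ψ c + A.symm w) (𝓝 0) (𝓝 (ψ c)) := by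
    have : Continuous (fun w => ψ c + A.symm w) := by fun_prop
    simpa using this.tendsto 0
  have hcs : c ∈ ψ.source := mem_chart_source _ c
  have h2 : ψ.target ∈ 𝓝 (ψ c) := ψ.open_target.mem_nhds (ψ.map_source hcs)
  have h3 : Tendsto ψ.symm (𝓝 (ψ c)) (𝓝 c) := ψ.tendsto_symm hcs
  exact (h1.eventually h2).and (h1.eventually (h3.eventually hU))

theorem eventually_chartBall_subset (c : X)
    (A : EuclideanSpace ℝ (Fin d) ≃L[ℝ] EuclideanSpace ℝ (Fin d)) {U : Set X} (hU : U ∈ 𝓝 c) :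
    ∃ s₀ > 0, ∀ s ≤ s₀, chartBall c A s ⊆ U := by
  obtain ⟨δ, hδ, hb⟩ := Metric.eventually_nhds_iff_ball.1 (eventually_chart_symm_mem c A hU)
  refine ⟨δ, hδ, fun s hs x hx => ?_⟩
  have h1 := (hb _ (by simpa using hx.2.trans_le hs)).2
  simpa [(chartAt (EuclideanSpace ℝ (Fin d)) c).left_inv hx.1] using h1

/-- The normalized chart and its inverse are both `r`-Lipschitz between the chart ball and the
Euclidean ball, so either changes `d`-dimensional Hausdorff measure by at most the factor r ^ d. -/
theorem hausdorffMeasure_chartBall_bounds [MeasurableSpace X] [BorelSpace X] (c : X)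
    (A : EuclideanSpace ℝ (Fin d) ≃L[ℝ] EuclideanSpace ℝ (Fin d)) (r : ℝ≥0) {U : Set X}
    (hU : U ∈ 𝓝 c)
    (h : ∀ x ∈ U, ∀ y ∈ U,
        edist x y ≤ r *
          edist (A (chartAt (EuclideanSpace ℝ (Fin d)) c x))
            (A (chartAt (EuclideanSpace ℝ (Fin d)) c y)) ∧
        edist (A (chartAt (EuclideanSpace ℝ (Fin d)) c x))
            (A (chartAt (EuclideanSpace ℝ (Fin d)) c y)) ≤ r * edist x y) :
    ∃ s₀ > 0, ∀ s ≤ s₀,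
      volume (Metric.ball (0 : EuclideanSpace ℝ (Fin d)) s) ≤
        (r : ℝ≥0∞) ^ d * Measure.euclideanHausdorffMeasure d (chartBall c A s) ∧
      Measure.euclideanHausdorffMeasure d (chartBall c A s) ≤
        (r : ℝ≥0∞) ^ d * volume (Metric.ball (0 : EuclideanSpace ℝ (Fin d)) s) := by
  set ψ := chartAt (EuclideanSpace ℝ (Fin d)) c with hψ
  obtain ⟨δ, hδ, hb⟩ := Metric.eventually_nhds_iff_ball.1 (eventually_chart_symm_mem c A hU)
  refine ⟨δ, hδ, fun s hs => ?_⟩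
  have hb' : ∀ w ∈ Metric.ball (0 : EuclideanSpace ℝ (Fin d)) s,
      ψ c + A.symm w ∈ ψ.target ∧ ψ.symm (ψ c + A.symm w) ∈ U :=
    fun w hw => hb w (Metric.ball_subset_ball hs hw)
  have huv : ∀ w ∈ Metric.ball (0 : EuclideanSpace ℝ (Fin d)) s,
      A (ψ (ψ.symm (ψ c + A.symm w)) - ψ c) = w := fun w hw => by
    rw [ψ.right_inv (hb' w hw).1]; simp
  have himg : (fun w => ψ.symm (ψ c + A.symm w)) '' Metric.ball 0 s = chartBall c A s := by
    ext x
    constructor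
    · rintro ⟨w, hw, rfl⟩
      refine ⟨ψ.map_target (hb' w hw).1, ?_⟩
      rw [← hψ, huv w hw]
      simpa using hw
    · intro hx
      refine ⟨A (ψ x - ψ c), by simpa using hx.2, ?_⟩
      simp only [ContinuousLinearEquiv.symm_apply_apply, add_sub_cancel]
      exact ψ.left_inv hx.1
  have himg' : (fun x => A (ψ x - ψ c)) '' chartBall c A s = Metric.ball 0 s := by
    rw [← himg, image_image]
    exact (image_congr huv).trans (image_id' _)
  have hsub : chartBall c A s ⊆ U := by
    rw [← himg]
    rintro _ ⟨w, hw, rfl⟩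
    exact (hb' w hw).2
  have hL1 : LipschitzOnWith r (fun x => A (ψ x - ψ c)) (chartBall c A s) := by
    intro x hx y hy
    refine le_trans (le_of_eq ?_) (h x (hsub hx) y (hsub hy)).2
    simp only [map_sub, edist_sub_right]
  have hL2 : LipschitzOnWith r (fun w => ψ.symm (ψ c + A.symm w)) (Metric.ball 0 s) := by
    intro x hx y hy
    refine (h _ (hb' x hx).2 _ (hb' y hy).2).1.trans (le_of_eq ?_)
    rw [ψ.right_inv (hb' x hx).1, ψ.right_inv (hb' y hy).1]
    simp
  have m1 := hL1.hausdorffMeasure_image_le (d := (d : ℝ)) (by positivity)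
  have m2 := hL2.hausdorffMeasure_image_le (d := (d : ℝ)) (by positivity)
  rw [himg'] at m1
  rw [himg] at m2
  rw [ENNReal.rpow_natCast] at m1 m2
  rw [← EuclideanSpace.euclideanHausdorffMeasure_eq_volume d]
  simp only [Measure.euclideanHausdorffMeasure_def, Measure.smul_apply, ENNReal.smul_def,
    smul_eq_mul]
  rw [mul_left_comm, mul_left_comm ((r : ℝ≥0∞) ^ d)]
  exact ⟨by gcongr, by gcongr⟩

theorem measure_withDensity_bounds {Y : Type*} [MeasurableSpace Y] (ν : Measure Y) (ρ : Y → ℝ≥0)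
    (m M : ℝ≥0) {s : Set Y} (hs : MeasurableSet s) (hm : ∀ x ∈ s, m ≤ ρ x) (hM : ∀ x ∈ s, ρ x ≤ M) :
    m * ν s ≤ ν.withDensity (fun x => (ρ x : ℝ≥0∞)) s ∧
      ν.withDensity (fun x => (ρ x : ℝ≥0∞)) s ≤ M * ν s := by
  rw [withDensity_apply _ hs]
  constructor
  · rw [← setLIntegral_const]
    exact setLIntegral_mono' hs fun x hx => by exact_mod_cast hm x hx
  · rw [← setLIntegral_const]
    exact setLIntegral_mono' hs fun x hx => by exact_mod_cast hM x hx

/-- Near a point of positive density, the balls of the normalized chart and the Riemannian balls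
are comparable with constants close to one, and their measures grow like `s ^ d`. -/
theorem exists_chartBall_measure_bounds [MeasurableSpace X] [BorelSpace X]
    [IsManifold (𝓡 d) 1 X] [Bundle.RiemannianBundle (fun x : X => TangentSpace (𝓡 d) x)]
    [IsContinuousRiemannianBundle (EuclideanSpace ℝ (Fin d))
      (fun x : X => TangentSpace (𝓡 d) x)]
    [IsRiemannianManifold (𝓡 d) X]
    (μ : Measure X) [IsProbabilityMeasure μ] (ρ : X → ℝ≥0) (hρ : Continuous ρ)
    (hμ : μ = (Measure.euclideanHausdorffMeasure d : Measure X).withDensity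
      (fun x => (ρ x : ℝ≥0∞))) (c : X) (hc : 0 < ρ c) :
    ∃ A : EuclideanSpace ℝ (Fin d) ≃L[ℝ] EuclideanSpace ℝ (Fin d), ∃ κ : ℝ, 0 < κ ∧
      ∀ r : ℝ, 1 < r → ∃ s₀ > 0, ∀ s, 0 < s → s ≤ s₀ →
        κ * s ^ d ≤ r ^ (d + 1) * μ.real (chartBall c A s) ∧
        μ.real (chartBall c A s) ≤ r ^ (d + 1) * (κ * s ^ d) ∧
        Metric.eball c (ENNReal.ofReal s) ⊆ chartBall c A (r * s) ∧
        chartBall c A s ⊆ Metric.eball c (ENNReal.ofReal (r * s)) := by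
  obtain ⟨A, hA⟩ := exists_almost_isometric_chart (d := d) c
  have hω : 0 < volume.real (Metric.ball (0 : EuclideanSpace ℝ (Fin d)) 1) := by
    rw [measureReal_def]
    exact ENNReal.toReal_pos (Metric.measure_ball_pos _ _ one_pos).ne' measure_ball_lt_top.ne
  -- κ is the density at `c` times the volume of the Euclidean unit ball.
  refine ⟨A, ρ c * volume.real (Metric.ball (0 : EuclideanSpace ℝ (Fin d)) 1), by positivity,
    fun r hr => ?_⟩
  obtain ⟨U, hU, hUb⟩ := hA r hr
  lift r to ℝ≥0 using by linarith
  have hr1 : 1 < r := by exact_mod_cast hr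
  have hr0 : 0 < r := by linarith
  simp only [ENNReal.ofReal_coe_nnreal] at hUb
  obtain ⟨s₁, hs₁, h1⟩ := hausdorffMeasure_chartBall_bounds c A r hU hUb
  -- The density varies by at most a factor `r` near `c`; with the factor r ^ d from the Lipschitz
  -- maps this makes r ^ (d + 1).
  have hρU : {x | ρ c / r ≤ ρ x ∧ ρ x ≤ r * ρ c} ∈ 𝓝 c := by
    have h2 : ρ c / r < ρ c := div_lt_self hc hr1
    have h3 : ρ c < r * ρ c := lt_mul_of_one_lt_left hc hr1
    filter_upwards [hρ.continuousAt.eventually (lt_mem_nhds h2),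
      hρ.continuousAt.eventually (gt_mem_nhds h3)] with x hx hx'
    exact ⟨hx.le, hx'.le⟩
  obtain ⟨s₂, hs₂, h2⟩ := eventually_chartBall_subset c A (inter_mem hρU hU)
  have hUs : U ∩ (chartAt (EuclideanSpace ℝ (Fin d)) c).source ∈ 𝓝 c :=
    inter_mem hU (chart_source_mem_nhds _ c)
  obtain ⟨ε, hε, h3⟩ := EMetric.mem_nhds_iff.1 hUs
  obtain ⟨s₃, hs₃, h3'⟩ : ∃ s₃ : ℝ, 0 < s₃ ∧ ENNReal.ofReal s₃ ≤ ε := by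
    obtain ⟨s₃, h4, h5⟩ := ENNReal.lt_iff_exists_nnreal_btwn.1 hε
    exact ⟨s₃, by exact_mod_cast h4, by simpa using h5.le⟩
  have hcU : c ∈ U := mem_of_mem_nhds hU
  refine ⟨min s₁ (min s₂ s₃), by positivity, fun s hs hs' => ?_⟩
  have hsa := hs'.trans (min_le_left _ _)
  have hsb := (hs'.trans (min_le_right _ _)).trans (min_le_left _ _)
  have hsc := (hs'.trans (min_le_right _ _)).trans (min_le_right _ _)
  obtain ⟨h4, h5⟩ := h1 s hsa
  have hsub := h2 s hsb
  obtain ⟨h6, h7⟩ := measure_withDensity_bounds (Measure.euclideanHausdorffMeasure d) ρ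
    (ρ c / r) (r * ρ c) (isOpen_chartBall c A s).measurableSet
    (fun x hx => (hsub hx).1.1) (fun x hx => (hsub hx).1.2)
  rw [← hμ] at h6 h7
  have hvol : volume.real (Metric.ball (0 : EuclideanSpace ℝ (Fin d)) s) =
      s ^ d * volume.real (Metric.ball (0 : EuclideanSpace ℝ (Fin d)) 1) := by
    rw [measureReal_def, Measure.addHaar_ball_of_pos _ _ hs, ENNReal.toReal_mul,
      ENNReal.toReal_ofReal (by positivity)]
    simp [measureReal_def]
  have hfin : Measure.euclideanHausdorffMeasure d (chartBall c A s) ≠ ⊤ :=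
    (h5.trans_lt (ENNReal.mul_lt_top (by simp) measure_ball_lt_top)).ne
  have h4' : volume.real (Metric.ball (0 : EuclideanSpace ℝ (Fin d)) s) ≤
      r ^ d * (Measure.euclideanHausdorffMeasure d).real (chartBall c A s) := by
    simpa [measureReal_def] using
      ENNReal.toReal_mono (ENNReal.mul_ne_top (by simp) hfin) h4
  have h5' : (Measure.euclideanHausdorffMeasure d).real (chartBall c A s) ≤
      r ^ d * volume.real (Metric.ball (0 : EuclideanSpace ℝ (Fin d)) s) := by
    simpa [measureReal_def] using
      ENNReal.toReal_mono (ENNReal.mul_ne_top (by simp) measure_ball_lt_top.ne) h5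
  have h6' : ρ c / r * (Measure.euclideanHausdorffMeasure d).real (chartBall c A s) ≤
      μ.real (chartBall c A s) := by
    simpa [measureReal_def] using ENNReal.toReal_mono (measure_ne_top _ _) h6
  have h7' : μ.real (chartBall c A s) ≤
      r * ρ c * (Measure.euclideanHausdorffMeasure d).real (chartBall c A s) := by
    simpa [measureReal_def] using
      ENNReal.toReal_mono (ENNReal.mul_ne_top ENNReal.coe_ne_top hfin) h7
  rw [hvol] at h4' h5'
  have hr0' : (0 : ℝ) < r := by exact_mod_cast hr0
  refine ⟨?_, ?_, ?_, ?_⟩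
  · calc (ρ c : ℝ) * volume.real (Metric.ball (0 : EuclideanSpace ℝ (Fin d)) 1) * s ^ d
        = ρ c * (s ^ d * volume.real (Metric.ball (0 : EuclideanSpace ℝ (Fin d)) 1)) := by ring
      _ ≤ ρ c * (r ^ d * (Measure.euclideanHausdorffMeasure d).real (chartBall c A s)) := by
        gcongr
      _ = r ^ (d + 1) *
          (ρ c / r * (Measure.euclideanHausdorffMeasure d).real (chartBall c A s)) := by
        field_simp
        ring
      _ ≤ _ := by gcongr
  · calc μ.real (chartBall c A s)
        ≤ r * ρ c * (r ^ d *
          (s ^ d * volume.real (Metric.ball (0 : EuclideanSpace ℝ (Fin d)) 1))) := by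
          refine h7'.trans ?_
          gcongr
      _ = _ := by ring
  · intro x hx
    have hx1 : edist x c < ENNReal.ofReal s := hx
    have hxU := h3 (show x ∈ Metric.eball c ε from
      hx1.trans_le ((ENNReal.ofReal_le_ofReal hsc).trans h3'))
    refine ⟨hxU.2, ?_⟩
    have h8 := (hUb x hxU.1 c hcU).2
    rw [edist_eq_enorm_sub, ← map_sub, ← ofReal_norm] at h8
    have h9 : (r : ℝ≥0∞) * edist x c < ENNReal.ofReal (r * s) := by
      rw [ENNReal.ofReal_mul hr0'.le, ENNReal.ofReal_coe_nnreal]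
      exact ENNReal.mul_lt_mul_right (by simpa using hr0.ne') (by simp) hx1
    exact (ENNReal.ofReal_lt_ofReal_iff (by positivity)).1 (h8.trans_lt h9)
  · intro x hx
    have h8 := (hUb x (hsub hx).2 c hcU).1
    rw [edist_eq_enorm_sub, ← map_sub, ← ofReal_norm] at h8
    refine h8.trans_lt ?_
    rw [ENNReal.ofReal_mul hr0'.le, ENNReal.ofReal_coe_nnreal]
    exact ENNReal.mul_lt_mul_right (by simpa using hr0.ne') (by simp)
      ((ENNReal.ofReal_lt_ofReal_iff hs).2 hx.2)

end Volume

/-! ### Derivatives of rescaled functions -/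

section Scaling

open Set

variable {E F : Type*} [NormedAddCommGroup E] [NormedSpace ℝ E] [NormedAddCommGroup F]
  [NormedSpace ℝ F]

theorem exists_bound_iteratedFDeriv_of_hasCompactSupport {G : Type*} [NormedAddCommGroup G]
    [NormedSpace ℝ G] {b : E → G} (m : ℕ)
    (hb : ContDiff ℝ m b) (hs : HasCompactSupport b) :
    ∃ M : ℝ, 0 ≤ M ∧ ∀ j ≤ m, ∀ w, ‖iteratedFDeriv ℝ j b w‖ ≤ M := by
  have h : ∀ j : ℕ, ∃ M : ℝ, 0 ≤ M ∧ (j ≤ m → ∀ w, ‖iteratedFDeriv ℝ j b w‖ ≤ M) := by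
    intro j
    by_cases hj : j ≤ m
    · obtain ⟨M, hM⟩ := (hb.continuous_iteratedFDeriv (m := j)
        (by exact_mod_cast hj)).bounded_above_of_compact_support (hs.iteratedFDeriv (𝕜 := ℝ) j)
      exact ⟨max M 0, le_max_right _ _, fun _ w => (hM w).trans (le_max_left _ _)⟩
    · exact ⟨0, le_rfl, fun h => absurd h hj⟩
  choose M hM0 hM using h
  refine ⟨∑ j ∈ Finset.range (m + 1), M j, Finset.sum_nonneg fun j _ => hM0 j, fun j hj w => ?_⟩
  exact (hM j hj w).trans (Finset.single_le_sum (f := M) (fun i _ => hM0 i)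
    (Finset.mem_range.2 (by omega)))

theorem exists_bound_iteratedFDeriv_of_isCompact {G : Type*} [NormedAddCommGroup G]
    [NormedSpace ℝ G] {θ : E → G} {O Y : Set E} (m : ℕ) (hO : IsOpen O)
    (hθ : ContDiffOn ℝ m θ O) (hY : IsCompact Y) (hYO : Y ⊆ O) :
    ∃ D : ℝ, 1 ≤ D ∧ ∀ j ≤ m, ∀ w ∈ Y, ‖iteratedFDerivWithin ℝ j θ O w‖ ≤ D := by
  have h : ∀ j : ℕ, ∃ M : ℝ, 0 ≤ M ∧
      (j ≤ m → ∀ w ∈ Y, ‖iteratedFDerivWithin ℝ j θ O w‖ ≤ M) := by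
    intro j
    by_cases hj : j ≤ m
    · obtain ⟨M, hM⟩ := hY.exists_bound_of_continuousOn
        ((hθ.continuousOn_iteratedFDerivWithin (m := j)
          (by exact_mod_cast hj) hO.uniqueDiffOn).mono hYO)
      exact ⟨max M 0, le_max_right _ _, fun _ w hw => (hM w hw).trans (le_max_left _ _)⟩
    · exact ⟨0, le_rfl, fun h => absurd h hj⟩
  choose M hM0 hM using h
  have h0 : 0 ≤ ∑ j ∈ Finset.range (m + 1), M j := Finset.sum_nonneg fun j _ => hM0 j
  -- The summand 1 makes the bound at least 1, so that it is dominated by its own positive powers.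
  refine ⟨1 + ∑ j ∈ Finset.range (m + 1), M j, by linarith, fun j hj w hw => ?_⟩
  have := (hM j hj w hw).trans (Finset.single_le_sum (f := M) (fun i _ => hM0 i)
    (Finset.mem_range.2 (show j < m + 1 by omega)))
  linarith

/-- Derivatives of `b (θ / s)` of order at most `m` are `O (s ^ (-m))`. -/
theorem exists_bound_iteratedFDeriv_scaled {θ : E → F} {b : F → ℝ} {O Y : Set E} (m : ℕ)
    (hO : IsOpen O) (hθ : ContDiffOn ℝ m θ O) (hY : IsCompact Y) (hYO : Y ⊆ O)
    (hb : ContDiff ℝ m b) (hs : HasCompactSupport b) :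
    ∃ C : ℝ, 0 ≤ C ∧ ∀ s : ℝ, 0 < s → s ≤ 1 → ∀ j ≤ m, ∀ y ∈ Y,
      ‖iteratedFDeriv ℝ j (fun z => b (s⁻¹ • θ z)) y‖ ≤ C * s⁻¹ ^ m := by
  obtain ⟨M, hM0, hM⟩ := exists_bound_iteratedFDeriv_of_hasCompactSupport m hb hs
  obtain ⟨D, hD1, hD⟩ := exists_bound_iteratedFDeriv_of_isCompact m hO hθ hY hYO
  refine ⟨m.factorial * M * D ^ m, by positivity, fun s hs0 hs1 j hj y hy => ?_⟩
  have hs1' : 1 ≤ s⁻¹ := (one_le_inv₀ hs0).2 hs1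
  have hjm : ((j : ℕ) : WithTop ℕ∞) ≤ (m : ℕ) := by exact_mod_cast hj
  have h1 : ‖iteratedFDerivWithin ℝ j (b ∘ (s⁻¹ • θ)) O y‖ ≤
      j.factorial * M * (s⁻¹ * D) ^ j := by
    -- The estimate for compositions asks for inner derivatives of order i bounded by an i-th power.
    -- A single bound s⁻¹ D suffices, since s⁻¹ D ≥ 1.
    refine norm_iteratedFDerivWithin_comp_le (t := univ) (N := m) hb.contDiffOn
      (hθ.const_smul s⁻¹) hjm uniqueDiffOn_univ
      hO.uniqueDiffOn (mapsTo_univ _ _) (hYO hy) (fun i hi => ?_) (fun i hi1 hi => ?_)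
    · rw [iteratedFDerivWithin_univ]
      exact hM i (hi.trans hj) _
    · have him : ((i : ℕ) : WithTop ℕ∞) ≤ (m : ℕ) := by exact_mod_cast hi.trans hj
      change ‖iteratedFDerivWithin ℝ i (s⁻¹ • θ) O y‖ ≤ _
      rw [iteratedFDerivWithin_const_smul_apply ((hθ y (hYO hy)).of_le him) hO.uniqueDiffOn
        (hYO hy), norm_smul, Real.norm_of_nonneg (by positivity)]
      calc s⁻¹ * ‖iteratedFDerivWithin ℝ i θ O y‖ ≤ s⁻¹ * D := by
            gcongr; exact hD i (hi.trans hj) y hy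
        _ ≤ (s⁻¹ * D) ^ i := le_self_pow₀ (one_le_mul_of_one_le_of_one_le hs1' hD1) (by omega)
  have h2 : iteratedFDerivWithin ℝ j (b ∘ (s⁻¹ • θ)) O y =
      iteratedFDeriv ℝ j (fun z => b (s⁻¹ • θ z)) y :=
    iteratedFDerivWithin_of_isOpen j hO (hYO hy)
  rw [← h2]
  refine h1.trans ?_
  rw [mul_assoc (_ * M), ← mul_pow, mul_comm D]
  have h3 : (j.factorial : ℝ) ≤ m.factorial := by exact_mod_cast Nat.factorial_le hj
  have h4 : (s⁻¹ * D) ^ j ≤ (s⁻¹ * D) ^ m :=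
    pow_le_pow_right₀ (one_le_mul_of_one_le_of_one_le hs1' hD1) hj
  gcongr

/-- A Hölder bound for the derivative of order `l` from bounds for the next derivative on a
neighbourhood. -/
theorem enorm_iteratedFDeriv_sub_div_le {f : E → ℝ} {K : Set E} {δ B t : ℝ} (l : ℕ) (hδ : 0 < δ)
    (hδ1 : δ ≤ 1) (ht0 : 0 < t) (ht1 : t ≤ 1)
    (hf : ∀ y ∈ K, ∀ z ∈ Metric.closedBall y δ, ContDiffAt ℝ (l + 1 : ℕ) f z)
    (hB : ∀ j ≤ l + 1, ∀ y ∈ K, ∀ z ∈ Metric.closedBall y δ, ‖iteratedFDeriv ℝ j f z‖ ≤ B)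
    {x y : E} (hx : x ∈ K) (hy : y ∈ K) :
    ‖iteratedFDeriv ℝ l f x - iteratedFDeriv ℝ l f y‖ₑ / edist x y ^ t ≤
      ENNReal.ofReal (2 * B / δ) := by
  have hself : ∀ y : E, y ∈ Metric.closedBall y δ := fun y => Metric.mem_closedBall_self hδ.le
  have hB0 : 0 ≤ B := (norm_nonneg _).trans (hB l (by omega) x hx x (hself x))
  apply ENNReal.div_le_of_le_mul
  rw [edist_dist, ENNReal.ofReal_rpow_of_nonneg dist_nonneg ht0.le, ← ofReal_norm,
    ← ENNReal.ofReal_mul (by positivity)]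
  apply ENNReal.ofReal_le_ofReal
  -- The set need not be convex. Points within δ are compared by the mean value inequality on a
  -- ball; for points farther apart the trivial bound 2 B suffices, because the distance is bounded
  -- below.
  rcases le_total (dist x y) δ with h | h
  · have h1 : ‖iteratedFDeriv ℝ l f x - iteratedFDeriv ℝ l f y‖ ≤ B * ‖x - y‖ := by
      refine Convex.norm_image_sub_le_of_norm_fderiv_le (𝕜 := ℝ) (s := Metric.closedBall y δ)
        (fun z hz => ?_) (fun z hz => ?_) (convex_closedBall y δ) (hself y) h
      · exact (hf y hy z hz).differentiableAt_iteratedFDeriv (by exact_mod_cast Nat.lt_succ_self l)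
      · rw [norm_fderiv_iteratedFDeriv]
        exact hB (l + 1) le_rfl y hy z hz
    have h2 : dist x y ≤ dist x y ^ t := by
      simpa using Real.rpow_le_rpow_of_exponent_ge' (dist_nonneg (x := x) (y := y))
        (h.trans hδ1) ht0.le ht1
    have h3 : B ≤ 2 * B / δ := by
      rw [le_div_iff₀ hδ]; nlinarith
    calc _ ≤ B * dist x y := by rw [dist_eq_norm]; exact h1
      _ ≤ _ := by gcongr
  · have h1 : ‖iteratedFDeriv ℝ l f x - iteratedFDeriv ℝ l f y‖ ≤ 2 * B := by
      refine (norm_sub_le _ _).trans ?_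
      have := hB l (by omega) x hx x (hself x)
      have := hB l (by omega) y hy y (hself y)
      linarith
    have h2 : δ ≤ dist x y ^ t := by
      calc δ ≤ δ ^ t := by
            simpa using Real.rpow_le_rpow_of_exponent_ge' hδ.le hδ1 ht0.le ht1
        _ ≤ _ := Real.rpow_le_rpow hδ.le h ht0.le
    calc _ ≤ 2 * B := h1
      _ = 2 * B / δ * δ := by field_simp
      _ ≤ _ := by gcongr

end Scaling

/-! ### Hölder norms of small bump functions -/

section Bump

open Set

variable {d : ℕ} {k : ℕ∞} {X : Type*} [EMetricSpace X] [ChartedSpace (EuclideanSpace ℝ (Fin d)) X]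

/-- The function `b (A (ψ x - ψ c) / s)`, where `ψ` is the chart at `c`, extended by zero. -/
noncomputable def chartBump (c : X)
    (A : EuclideanSpace ℝ (Fin d) ≃L[ℝ] EuclideanSpace ℝ (Fin d))
    (b : EuclideanSpace ℝ (Fin d) → ℝ) (s : ℝ) : X → ℝ :=
  (chartAt (EuclideanSpace ℝ (Fin d)) c).source.indicator fun x =>
    b (s⁻¹ • A (chartAt (EuclideanSpace ℝ (Fin d)) c x - chartAt (EuclideanSpace ℝ (Fin d)) c c))

variable {c : X} {A : EuclideanSpace ℝ (Fin d) ≃L[ℝ] EuclideanSpace ℝ (Fin d)}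
  {b : EuclideanSpace ℝ (Fin d) → ℝ}

theorem chartBump_eq_zero {s R : ℝ} (hs : 0 < s) (hR : ∀ w, R ≤ ‖w‖ → b w = 0) {x : X}
    (hx : x ∉ chartBall c A (R * s)) : chartBump c A b s x = 0 := by
  by_cases h : x ∈ (chartAt (EuclideanSpace ℝ (Fin d)) c).source
  · rw [chartBump, indicator_of_mem h]
    apply hR
    rw [norm_smul, Real.norm_of_nonneg (by positivity), inv_mul_eq_div, le_div_iff₀ hs]
    by_contra! h2
    exact hx ⟨h, h2⟩
  · rw [chartBump, indicator_of_notMem h]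

/-- This is the function that gets divided by `s` when a scaled bump around `c` is read in an
arbitrary chart `χ`. -/
theorem contDiffOn_transition [IsManifold (𝓡 d) k X]
    {χ : OpenPartialHomeomorph X (EuclideanSpace ℝ (Fin d))}
    (hχ : χ ∈ IsManifold.maximalAtlas (𝓡 d) k X)
    (A : EuclideanSpace ℝ (Fin d) ≃L[ℝ] EuclideanSpace ℝ (Fin d)) :
    ContDiffOn ℝ k (fun z => A (chartAt (EuclideanSpace ℝ (Fin d)) c (χ.symm z) -
      chartAt (EuclideanSpace ℝ (Fin d)) c c))
      (χ.target ∩ χ.symm ⁻¹' (chartAt (EuclideanSpace ℝ (Fin d)) c).source) := by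
  have h1 := contMDiffOn_of_mem_maximalAtlas (n := (k : WithTop ℕ∞)) (I := 𝓡 d)
    (IsManifold.chart_mem_maximalAtlas (I := 𝓡 d) (n := (k : WithTop ℕ∞)) c)
  have h2 := (h1.comp' (contMDiffOn_symm_of_mem_maximalAtlas hχ))
  have h3 := contMDiffOn_iff_contDiffOn.1 h2
  exact A.contDiff.comp_contDiffOn (h3.sub contDiffOn_const)

/-- The derivative bounds of a scaled bump function in one chart. -/
theorem exists_chart_bounds [IsManifold (𝓡 d) k X] (m : ℕ) (hm : (m : ℕ∞) ≤ k)
    (hb : ContDiff ℝ m b) (hbs : HasCompactSupport b) {Q : Set X} (hQ : IsCompact Q)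
    (hQs : Q ⊆ (chartAt (EuclideanSpace ℝ (Fin d)) c).source) {s₀ : ℝ}
    (hsupp : ∀ s, 0 < s → s ≤ s₀ → ∀ x ∉ Q, chartBump c A b s x = 0)
    {χ : OpenPartialHomeomorph X (EuclideanSpace ℝ (Fin d))}
    (hχ : χ ∈ IsManifold.maximalAtlas (𝓡 d) k X) {Z : Set (EuclideanSpace ℝ (Fin d))}
    (hZ : IsCompact Z) (hZt : Z ⊆ χ.target) :
    ∃ C : ℝ, 0 ≤ C ∧ ∀ s, 0 < s → s ≤ s₀ → s ≤ 1 → ∀ z ∈ Z,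
      ContDiffAt ℝ m (chartBump c A b s ∘ χ.symm) z ∧ ∀ j ≤ m,
        ‖iteratedFDeriv ℝ j (chartBump c A b s ∘ χ.symm) z‖ ≤ C * s⁻¹ ^ m ∧
        (χ.symm z ∉ Q → iteratedFDeriv ℝ j (chartBump c A b s ∘ χ.symm) z = 0) := by
  set ψ := chartAt (EuclideanSpace ℝ (Fin d)) c with hψ
  have hO : IsOpen (χ.target ∩ χ.symm ⁻¹' ψ.source) :=
    χ.symm.isOpen_inter_preimage ψ.open_source
  have hmk : ((m : ℕ) : WithTop ℕ∞) ≤ (k : WithTop ℕ∞) := by exact_mod_cast hm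
  have hθ := (contDiffOn_transition (c := c) hχ A).of_le hmk
  have hY : IsCompact (Z ∩ χ.symm ⁻¹' Q) :=
    hZ.of_isClosed_subset ((χ.continuousOn_symm.mono hZt).preimage_isClosed_of_isClosed
      hZ.isClosed hQ.isClosed) inter_subset_left
  obtain ⟨C, hC0, hC⟩ := exists_bound_iteratedFDeriv_scaled m hO hθ hY
    (fun z hz => ⟨hZt hz.1, hQs hz.2⟩) hb hbs
  refine ⟨C, hC0, fun s hs hs0 hs1 z hz => ?_⟩
  -- Over `Q` the bump is given by its formula near `z`; off the closed set `Q` it vanishes near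
  -- `z`, together with all derivatives.
  by_cases hzQ : χ.symm z ∈ Q
  · have hzO : z ∈ χ.target ∩ χ.symm ⁻¹' ψ.source := ⟨hZt hz, hQs hzQ⟩
    have heq : chartBump c A b s ∘ χ.symm =ᶠ[𝓝 z]
        fun z => b (s⁻¹ • A (ψ (χ.symm z) - ψ c)) := by
      filter_upwards [hO.mem_nhds hzO] with w hw
      have hw2 : χ.symm w ∈ (chartAt (EuclideanSpace ℝ (Fin d)) c).source := hw.2
      rw [Function.comp_apply, chartBump, indicator_of_mem hw2]
    refine ⟨?_, fun j hj => ⟨?_, fun h => absurd hzQ h⟩⟩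
    · refine ContDiffAt.congr_of_eventuallyEq ?_ heq
      exact hb.contDiffAt.comp z ((hθ.contDiffAt (hO.mem_nhds hzO)).const_smul s⁻¹)
    · rw [(heq.iteratedFDeriv ℝ j).eq_of_nhds]
      exact hC s hs hs1 j hj z ⟨hz, hzQ⟩
  · have heq : chartBump c A b s ∘ χ.symm =ᶠ[𝓝 z] fun _ => 0 := by
      have h1 : ∀ᶠ w in 𝓝 z, χ.symm w ∈ Qᶜ :=
        (χ.continuousAt_symm (hZt hz)).eventually (hQ.isClosed.isOpen_compl.mem_nhds hzQ)
      filter_upwards [h1] with w hw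
      exact hsupp s hs hs0 _ hw
    have h0 : ∀ j, iteratedFDeriv ℝ j (chartBump c A b s ∘ χ.symm) z = 0 := fun j => by
      rw [(heq.iteratedFDeriv ℝ j).eq_of_nhds, iteratedFDeriv_fun_zero]; rfl
    refine ⟨contDiffAt_const.congr_of_eventuallyEq heq, fun j hj => ⟨?_, fun _ => h0 j⟩⟩
    rw [h0, norm_zero]
    positivity

theorem contMDiff_chartBump [IsManifold (𝓡 d) k X] (m : ℕ) (hm : (m : ℕ∞) ≤ k)
    (hb : ContDiff ℝ m b) {Q : Set X} (hQ : IsCompact Q)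
    (hQs : Q ⊆ (chartAt (EuclideanSpace ℝ (Fin d)) c).source) {s : ℝ}
    (hsupp : ∀ x ∉ Q, chartBump c A b s x = 0) :
    ContMDiff (𝓡 d) 𝓘(ℝ) m (chartBump c A b s) := by
  have hmk : ((m : ℕ) : WithTop ℕ∞) ≤ (k : WithTop ℕ∞) := by exact_mod_cast hm
  intro x
  by_cases hx : x ∈ Q
  · have hxs := hQs hx
    have h1 : ContMDiffAt (𝓡 d) (𝓡 d) m (chartAt (EuclideanSpace ℝ (Fin d)) c) x :=
      (contMDiffAt_of_mem_maximalAtlas (n := (k : WithTop ℕ∞))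
        (IsManifold.chart_mem_maximalAtlas c) hxs).of_le hmk
    have h2 : ContDiff ℝ m fun z => b (s⁻¹ • A (z - chartAt (EuclideanSpace ℝ (Fin d)) c c)) :=
      hb.comp ((A.contDiff.comp (contDiff_id.sub contDiff_const)).const_smul s⁻¹)
    have h3 := h2.contMDiff.contMDiffAt.comp x h1
    refine h3.congr_of_eventuallyEq ?_
    filter_upwards [(chartAt (EuclideanSpace ℝ (Fin d)) c).open_source.mem_nhds hxs] with w hw
    exact indicator_of_mem hw _
  · have h1 : chartBump c A b s =ᶠ[𝓝 x] fun _ => 0 := by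
      filter_upwards [hQ.isClosed.isOpen_compl.mem_nhds hx] with w hw using hsupp w hw
    exact contMDiffAt_const.congr_of_eventuallyEq h1

/-- The `C^σ` norm of a bump function of size `s` grows at most like a power of `1 / s`. -/
theorem exists_crNorm_chartBump_le [IsManifold (𝓡 d) k X] (𝒜 : ChartCover d k X) {σ : ℝ}
    (hσ : 0 < σ) (hσk : (⌈σ⌉₊ : ℕ∞) ≤ k) (hb : ContDiff ℝ ⌈σ⌉₊ b) {R : ℝ} (hR0 : 0 < R)
    (hR : ∀ w, R ≤ ‖w‖ → b w = 0) :
    ∃ C : ℝ, 0 ≤ C ∧ ∃ s₀ > 0, ∀ s, 0 < s → s ≤ s₀ → 𝒜.IsCr σ (chartBump c A b s) ∧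
      𝒜.crNorm σ (chartBump c A b s) ≤ ENNReal.ofReal (C * s⁻¹ ^ ⌈σ⌉₊) := by
  set m := ⌈σ⌉₊ with hm
  have hlm : ⌊σ⌋₊ ≤ m := Nat.floor_le_ceil σ
  have : LocallyCompactSpace X :=
    ChartedSpace.locallyCompactSpace (EuclideanSpace ℝ (Fin d)) X
  have hbs : HasCompactSupport b := by
    apply HasCompactSupport.of_support_subset_isCompact
      (isCompact_closedBall (0 : EuclideanSpace ℝ (Fin d)) R)
    intro w hw
    rw [mem_closedBall_zero_iff]
    by_contra! h
    exact hw (hR w h.le)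
  -- One compact set carries the bumps of all small sizes. Only the pieces that meet it contribute
  -- to the norm.
  obtain ⟨Q, hQ, hcQ, hQs⟩ := exists_compact_subset
    (chartAt (EuclideanSpace ℝ (Fin d)) c).open_source (mem_chart_source _ c)
  obtain ⟨s₁, hs₁, h1⟩ := eventually_chartBall_subset c A (mem_interior_iff_mem_nhds.1 hcQ)
  have hsupp : ∀ s, 0 < s → s ≤ s₁ / R → ∀ x ∉ Q, chartBump c A b s x = 0 := by
    intro s hs hs' x hx
    refine chartBump_eq_zero hs hR fun h => hx (h1 (R * s) ?_ h)
    rw [le_div_iff₀ hR0] at hs'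
    linarith
  have hpiece : ∀ i, ∃ C : ℝ, 0 ≤ C ∧ ∀ s, 0 < s → s ≤ s₁ / R → s ≤ 1 →
      (∀ j ≤ m, ∀ x ∈ 𝒜.piece i,
        ‖𝒜.deriv (chartBump c A b s) i j x‖ ≤ C * s⁻¹ ^ m ∧
        (x ∉ Q → 𝒜.deriv (chartBump c A b s) i j x = 0)) ∧
      (Int.fract σ ≠ 0 → ∀ x ∈ 𝒜.piece i, ∀ y ∈ 𝒜.piece i,
        ‖𝒜.deriv (chartBump c A b s) i ⌊σ⌋₊ x - 𝒜.deriv (chartBump c A b s) i ⌊σ⌋₊ y‖ₑ /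
          edist (𝒜.chart i x) (𝒜.chart i y) ^ Int.fract σ ≤ ENNReal.ofReal (C * s⁻¹ ^ m)) := by
    intro i
    have hK : IsCompact (𝒜.chart i '' 𝒜.piece i) :=
      (𝒜.isCompact_piece i).image_of_continuousOn
        ((𝒜.chart i).continuousOn.mono (𝒜.piece_subset i))
    have hKt : 𝒜.chart i '' 𝒜.piece i ⊆ (𝒜.chart i).target := by
      rintro _ ⟨x, hx, rfl⟩
      exact (𝒜.chart i).map_source (𝒜.piece_subset i hx)
    -- The Hölder seminorm is estimated from derivatives on balls around points of the piece, so the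
    -- bounds are needed on a neighbourhood inside the chart.
    obtain ⟨δ', hδ', h2⟩ := hK.exists_cthickening_subset_open (𝒜.chart i).open_target hKt
    set δ := min δ' 1
    have hδ : 0 < δ := lt_min hδ' one_pos
    have hδ1 : δ ≤ 1 := min_le_right _ _
    have h3 : Metric.cthickening δ (𝒜.chart i '' 𝒜.piece i) ⊆ (𝒜.chart i).target :=
      (Metric.cthickening_mono (min_le_left _ _) _).trans h2
    obtain ⟨C, hC0, hC⟩ := exists_chart_bounds m hσk hb hbs hQ hQs hsupp (𝒜.chart_mem i)
      hK.cthickening h3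
    have hball : ∀ z ∈ 𝒜.chart i '' 𝒜.piece i, ∀ w ∈ Metric.closedBall z δ,
        w ∈ Metric.cthickening δ (𝒜.chart i '' 𝒜.piece i) :=
      fun z hz w hw => Metric.closedBall_subset_cthickening hz δ hw
    have h2δ : 1 ≤ 2 / δ := by rw [le_div_iff₀ hδ]; linarith
    refine ⟨2 / δ * C, by positivity, fun s hs hs1 hs1' => ⟨fun j hj x hx => ?_,
      fun hfr x hx y hy => ?_⟩⟩
    · have hx' : 𝒜.chart i x ∈ Metric.cthickening δ (𝒜.chart i '' 𝒜.piece i) :=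
        Metric.self_subset_cthickening _ (mem_image_of_mem _ hx)
      obtain ⟨h4, h5⟩ := (hC s hs hs1 hs1' _ hx').2 j hj
      refine ⟨h4.trans ?_, fun hxQ => h5 ?_⟩
      · gcongr
        exact le_mul_of_one_le_left hC0 h2δ
      · rwa [(𝒜.chart i).left_inv (𝒜.piece_subset i hx)]
    -- For non-integral σ the smoothness ⌈σ⌉ supplies exactly the one further derivative used in the
    -- Hölder estimate.
    · have hfl : ⌊σ⌋₊ + 1 = m := by
        refine le_antisymm ?_ (Nat.ceil_le_floor_add_one σ)
        rw [Nat.succ_le_iff, hm, Nat.lt_ceil]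
        refine lt_of_le_of_ne (Nat.floor_le hσ.le) fun h => hfr ?_
        rw [← h]; exact Int.fract_natCast _
      have h6 := enorm_iteratedFDeriv_sub_div_le (f := chartBump c A b s ∘ (𝒜.chart i).symm)
        (K := 𝒜.chart i '' 𝒜.piece i) (δ := δ) (B := C * s⁻¹ ^ m) (t := Int.fract σ) ⌊σ⌋₊ hδ hδ1
        (lt_of_le_of_ne (Int.fract_nonneg σ) (Ne.symm hfr)) (Int.fract_lt_one σ).le
        (fun z hz w hw => by
          rw [hfl]; exact (hC s hs hs1 hs1' w (hball z hz w hw)).1)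
        (fun j hj z hz w hw =>
          ((hC s hs hs1 hs1' w (hball z hz w hw)).2 j (hj.trans hfl.le)).1)
        (mem_image_of_mem _ hx) (mem_image_of_mem _ hy)
      refine h6.trans (le_of_eq ?_)
      congr 1
      ring
  choose C hC0 hC using hpiece
  -- Local finiteness turns the supremum over all charts into one over finitely many, uniformly in
  -- `s`.
  have hfin : {i | (𝒜.piece i ∩ Q).Nonempty}.Finite :=
    𝒜.locallyFinite_piece.finite_nonempty_inter_compact hQ
  set D := ∑ i ∈ hfin.toFinset, C i with hD
  have hD0 : 0 ≤ D := Finset.sum_nonneg fun i _ => hC0 i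
  have hCD : ∀ i, (𝒜.piece i ∩ Q).Nonempty → C i ≤ D := fun i hi =>
    Finset.single_le_sum (f := C) (fun i _ => hC0 i) (hfin.mem_toFinset.2 hi)
  have hmain : ∀ s, 0 < s → s ≤ min (s₁ / R) 1 →
      𝒜.crNorm σ (chartBump c A b s) ≤ ENNReal.ofReal ((⌊σ⌋₊ + 1 + 1) * D * s⁻¹ ^ m) := by
    intro s hs hs'
    have hsa := hs'.trans (min_le_left _ _)
    have hsb := hs'.trans (min_le_right _ _)
    have h7 : ∀ j ∈ Finset.range (⌊σ⌋₊ + 1),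
        ⨆ i, ⨆ x ∈ 𝒜.piece i, ‖𝒜.deriv (chartBump c A b s) i j x‖ₑ ≤
          ENNReal.ofReal (D * s⁻¹ ^ m) := by
      intro j hj
      have hjm : j ≤ m := (Nat.lt_succ_iff.1 (Finset.mem_range.1 hj)).trans hlm
      refine iSup_le fun i => iSup₂_le fun x hx => ?_
      obtain ⟨h8, h9⟩ := (hC i s hs hsa hsb).1 j hjm x hx
      by_cases hxQ : x ∈ Q
      · rw [← ofReal_norm]
        refine ENNReal.ofReal_le_ofReal (h8.trans ?_)
        gcongr
        exact hCD i ⟨x, hx, hxQ⟩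
      · rw [← ofReal_norm, h9 hxQ, norm_zero, ENNReal.ofReal_zero]; exact zero_le
    have h10 : (if Int.fract σ = 0 then 0 else
      ⨆ i, ⨆ x ∈ 𝒜.piece i, ⨆ y ∈ 𝒜.piece i,
        ‖𝒜.deriv (chartBump c A b s) i ⌊σ⌋₊ x - 𝒜.deriv (chartBump c A b s) i ⌊σ⌋₊ y‖ₑ /
          edist (𝒜.chart i x) (𝒜.chart i y) ^ Int.fract σ) ≤ ENNReal.ofReal (D * s⁻¹ ^ m) := by
      split_ifs with hfr
      · exact zero_le
      refine iSup_le fun i => iSup₂_le fun x hx => iSup₂_le fun y hy => ?_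
      by_cases hi : (𝒜.piece i ∩ Q).Nonempty
      · refine ((hC i s hs hsa hsb).2 hfr x hx y hy).trans (ENNReal.ofReal_le_ofReal ?_)
        gcongr
        exact hCD i hi
      · have h11 : ∀ z ∈ 𝒜.piece i, 𝒜.deriv (chartBump c A b s) i ⌊σ⌋₊ z = 0 := fun z hz =>
          ((hC i s hs hsa hsb).1 _ hlm z hz).2 fun hzQ => hi ⟨z, hz, hzQ⟩
        rw [← ofReal_norm, h11 x hx, h11 y hy, sub_zero, norm_zero, ENNReal.ofReal_zero,
          ENNReal.zero_div]
        exact zero_le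
    refine (add_le_add (Finset.sum_le_sum h7) h10).trans (le_of_eq ?_)
    rw [Finset.sum_const, Finset.card_range, nsmul_eq_mul, ← ENNReal.ofReal_natCast,
      ← ENNReal.ofReal_mul (by positivity), ← ENNReal.ofReal_add (by positivity) (by positivity)]
    congr 1
    push_cast
    ring
  refine ⟨(⌊σ⌋₊ + 1 + 1) * D, by positivity, min (s₁ / R) 1, by positivity,
    fun s hs hs' => ⟨⟨?_, ?_⟩, hmain s hs hs'⟩⟩
  · have hle : ((⌊σ⌋₊ : ℕ) : WithTop ℕ∞) ≤ (m : ℕ) := by exact_mod_cast hlm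
    have hle' : ((⌊σ⌋₊ : ℕ) : ℕ∞) ≤ k := le_trans (by exact_mod_cast hlm) hσk
    exact contMDiff_chartBump ⌊σ⌋₊ hle' (hb.of_le hle) hQ hQs
      (hsupp s hs (hs'.trans (min_le_left _ _)))
  · exact ((hmain s hs hs').trans_lt ENNReal.ofReal_lt_top).ne

end Bump

/-! ### Smooth approximation of indicators of balls -/

section Approximation

open Set

/-- One spare power of `r` absorbs any constant, which lets the later bounds be pure powers. -/
theorem eventually_const_mul_le_inv (C : ℝ) : ∀ᶠ r : ℝ in 𝓝[>] 0, C * r ≤ 1 := by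
  have h : Tendsto (fun r : ℝ => C * r) (𝓝[>] 0) (𝓝 (C * 0)) :=
    ((continuous_const.mul continuous_id).tendsto 0).mono_left nhdsWithin_le_nhds
  rw [mul_zero] at h
  exact h.eventually_le_const one_pos

theorem exists_one_lt_pow_le (N : ℕ) {ε : ℝ} (hε : 0 < ε) : ∃ q : ℝ, 1 < q ∧ q ^ N ≤ 1 + ε := by
  have h : Tendsto (fun q : ℝ => q ^ N) (𝓝[>] 1) (𝓝 (1 ^ N)) :=
    ((continuous_pow N).tendsto 1).mono_left nhdsWithin_le_nhds
  rw [one_pow] at h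
  obtain ⟨q, hq, hq1⟩ := ((h.eventually_le_const (show (1 : ℝ) < 1 + ε by linarith)).and
    self_mem_nhdsWithin).exists
  exact ⟨q, hq1, hq⟩

variable {d : ℕ} {k : ℕ∞} {X : Type*} [EMetricSpace X]
    [ChartedSpace (EuclideanSpace ℝ (Fin d)) X] [IsManifold (𝓡 d) k X]

/-- Smooth functions between the indicators of two concentric chart balls whose radii differ by
the factor `q`, with polynomially bounded norms. -/
theorem exists_smooth_between_chartBalls (𝒜 : ChartCover d k X) {σ : ℝ}
    (hσ : 0 < σ) (hσk : (⌈σ⌉₊ : ℕ∞) ≤ k) (c : X)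
    (A : EuclideanSpace ℝ (Fin d) ≃L[ℝ] EuclideanSpace ℝ (Fin d)) {q : ℝ} (hq : 1 < q) :
    ∃ C : ℝ, 0 ≤ C ∧ ∃ s₀ > 0, ∀ s, 0 < s → s ≤ s₀ → ∃ f : X → ℝ, 𝒜.IsCr σ f ∧
      𝒜.crNorm σ f ≤ ENNReal.ofReal (C * s⁻¹ ^ ⌈σ⌉₊) ∧ (∀ x, 0 ≤ f x) ∧ (∀ x, f x ≤ 1) ∧
      (∀ x ∈ chartBall c A s, f x = 1) ∧ ∀ x ∉ chartBall c A (q * s), f x = 0 := by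
  let b : ContDiffBump (0 : EuclideanSpace ℝ (Fin d)) := ⟨1, q, one_pos, hq⟩
  have hb0 : ∀ w, q ≤ ‖w‖ → b w = 0 := fun w hw => b.zero_of_le_dist (by simpa using hw)
  obtain ⟨C, hC0, s₀, hs₀, hC⟩ := exists_crNorm_chartBump_le (c := c) (A := A) 𝒜 hσ hσk
    (b.contDiff (n := ⌈σ⌉₊)) (by linarith : 0 < q) hb0
  refine ⟨C, hC0, s₀, hs₀, fun s hs hs' => ⟨chartBump c A b s, (hC s hs hs').1, (hC s hs hs').2,
    fun x => ?_, fun x => ?_, fun x hx => ?_, fun x hx => chartBump_eq_zero hs hb0 hx⟩⟩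
  · exact indicator_nonneg (fun _ _ => b.nonneg) x
  · exact indicator_le' (fun _ _ => b.le_one) (fun _ _ => zero_le_one) x
  · rw [chartBump, indicator_of_mem hx.1]
    apply b.one_of_mem_closedBall
    rw [mem_closedBall_zero_iff, norm_smul, Real.norm_of_nonneg (by positivity), inv_mul_eq_div,
      div_le_iff₀ hs]
    simpa [b] using hx.2.le

variable [MeasurableSpace X] [BorelSpace X] [IsManifold (𝓡 d) 1 X]
    [Bundle.RiemannianBundle (fun x : X => TangentSpace (𝓡 d) x)]
    [IsContinuousRiemannianBundle (EuclideanSpace ℝ (Fin d))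
      (fun x : X => TangentSpace (𝓡 d) x)]
    [IsRiemannianManifold (𝓡 d) X]

/-- The indicators of small balls are approximated in `L¹`, from above and from below and with a
small relative error, by functions whose `C^σ` norms are polynomially bounded; the measures of the
balls are polynomially bounded from below. -/
theorem exists_smooth_approximations (𝒜 : ChartCover d k X)
    (μ : Measure X) [IsProbabilityMeasure μ]
    (ρ : X → ℝ≥0) (hρ : Continuous ρ)
    (hμ : μ = (Measure.euclideanHausdorffMeasure d : Measure X).withDensity
      (fun x => (ρ x : ℝ≥0∞))) (c : X) (hc : 0 < ρ c) {σ : ℝ}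
    (hσ : 0 < σ) (hσk : (⌈σ⌉₊ : ℕ∞) ≤ k) :
    ∃ Q D : ℕ, (∀ᶠ r : ℝ in 𝓝[>] 0, r ^ D ≤ μ.real (Metric.eball c (ENNReal.ofReal r))) ∧
      ∀ ε > 0, ∀ᶠ r : ℝ in 𝓝[>] 0, ∃ f g : X → ℝ, 𝒜.IsCr σ f ∧ 𝒜.IsCr σ g ∧
        (𝒜.crNorm σ f).toReal ≤ r⁻¹ ^ Q ∧ (𝒜.crNorm σ g).toReal ≤ r⁻¹ ^ Q ∧
        (∀ x, 0 ≤ f x) ∧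
        (∀ x, f x ≤ (Metric.eball c (ENNReal.ofReal r)).indicator 1 x) ∧
        (∀ x, (Metric.eball c (ENNReal.ofReal r)).indicator 1 x ≤ g x) ∧ (∀ x, g x ≤ 1) ∧
        (1 - ε) * μ.real (Metric.eball c (ENNReal.ofReal r)) ≤ ∫ x, f x ∂μ ∧
        ∫ x, g x ∂μ ≤ (1 + ε) * μ.real (Metric.eball c (ENNReal.ofReal r)) := by
  obtain ⟨A, κ, hκ, hA⟩ := exists_chartBall_measure_bounds μ ρ hρ hμ c hc
  -- Both exponents exceed the natural ones by one, to absorb constants for small `r`.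
  refine ⟨⌈σ⌉₊ + 1, d + 1, ?_, fun ε hε => ?_⟩
  · obtain ⟨s₀, hs₀, h⟩ := hA 2 one_lt_two
    filter_upwards [self_mem_nhdsWithin, Ioo_mem_nhdsGT hs₀,
      eventually_const_mul_le_inv (κ⁻¹ * 2 ^ (d + 1) * 2 ^ d)] with r (hr0 : 0 < r) hr1 hr2
    obtain ⟨h1, -, -, h2⟩ := h (r / 2) (by positivity) (by linarith [hr1.2])
    rw [mul_div_cancel₀ r two_ne_zero] at h2
    have h3 : μ.real (chartBall c A (r / 2)) ≤ μ.real (Metric.eball c (ENNReal.ofReal r)) :=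
      measureReal_mono h2
    have h4 : κ * r ^ d ≤ 2 ^ (d + 1) * 2 ^ d * μ.real (Metric.eball c (ENNReal.ofReal r)) := by
      calc κ * r ^ d = 2 ^ d * (κ * (r / 2) ^ d) := by rw [div_pow]; field_simp
        _ ≤ 2 ^ d * (2 ^ (d + 1) * μ.real (Metric.eball c (ENNReal.ofReal r))) := by
          exact mul_le_mul_of_nonneg_left (h1.trans (by gcongr)) (by positivity)
        _ = _ := by ring
    calc r ^ (d + 1) = κ⁻¹ * r * (κ * r ^ d) := by field_simp; ring
      _ ≤ κ⁻¹ * r * (2 ^ (d + 1) * 2 ^ d * μ.real (Metric.eball c (ENNReal.ofReal r))) := by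
        gcongr
      _ = κ⁻¹ * 2 ^ (d + 1) * 2 ^ d * r * μ.real (Metric.eball c (ENNReal.ofReal r)) := by ring
      _ ≤ _ := mul_le_of_le_one_left measureReal_nonneg hr2
  -- The radii to be compared differ by the factor q³, which costs q ^ (3 d); the two measure
  -- comparisons cost q ^ (d + 1) each.
  · obtain ⟨q, hq1, hqε⟩ := exists_one_lt_pow_le (5 * d + 2) hε
    have hq0 : 0 < q := by linarith
    obtain ⟨s₀, hs₀, h⟩ := hA q hq1
    obtain ⟨C, hC0, s₁, hs₁, hC⟩ := exists_smooth_between_chartBalls 𝒜 hσ hσk c A hq1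
    filter_upwards [self_mem_nhdsWithin, Ioo_mem_nhdsGT (show 0 < min s₀ s₁ / q ^ 2 by positivity),
      eventually_const_mul_le_inv (C * (q ^ 2) ^ ⌈σ⌉₊)] with r (hr0 : 0 < r) hr1 hr2
    have hr3 : q ^ 2 * r ≤ min s₀ s₁ := by
      have := hr1.2
      rw [lt_div_iff₀ (by positivity)] at this
      linarith
    have e1 : r / q ^ 2 ≤ r := div_le_self hr0.le (by nlinarith)
    have e2 : r / q ≤ r := div_le_self hr0.le hq1.le
    have e3 : r ≤ q * r := by nlinarith
    have e4 : q * r ≤ q ^ 2 * r := by nlinarith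
    have hsmall : ∀ s ≤ q ^ 2 * r, s ≤ s₀ ∧ s ≤ s₁ := fun s hs =>
      ⟨(hs.trans hr3).trans (min_le_left _ _), (hs.trans hr3).trans (min_le_right _ _)⟩
    -- `f` passes from 1 to 0 between the chart balls of radii r / q² and r / q, the latter inside
    -- the metric ball; `g` does so between q r and q² r, the former containing the metric ball.
    obtain ⟨f, hf, hfn, hf0, hf1, hfe, hfz⟩ := hC (r / q ^ 2) (by positivity)
      (hsmall _ (by linarith)).2
    obtain ⟨g, hg, hgn, hg0, hg1, hge, hgz⟩ := hC (q * r) (by positivity)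
      (hsmall _ (by linarith)).2
    have hnorm : ∀ s, r / q ^ 2 ≤ s → ∀ F : X → ℝ,
        𝒜.crNorm σ F ≤ ENNReal.ofReal (C * s⁻¹ ^ ⌈σ⌉₊) →
        (𝒜.crNorm σ F).toReal ≤ r⁻¹ ^ (⌈σ⌉₊ + 1) := by
      intro s hs F hF
      have hs0 : 0 < s := lt_of_lt_of_le (by positivity) hs
      have h1 : s⁻¹ ≤ q ^ 2 * r⁻¹ := by
        rw [inv_le_comm₀ hs0 (by positivity), mul_inv, inv_inv, mul_comm, ← div_eq_mul_inv]
        exact hs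
      refine (ENNReal.toReal_mono ENNReal.ofReal_ne_top hF).trans ?_
      rw [ENNReal.toReal_ofReal (by positivity)]
      calc C * s⁻¹ ^ ⌈σ⌉₊ ≤ C * (q ^ 2 * r⁻¹) ^ ⌈σ⌉₊ := by gcongr
        _ = C * (q ^ 2) ^ ⌈σ⌉₊ * r * r⁻¹ ^ (⌈σ⌉₊ + 1) := by
          have h2 : r * r⁻¹ ^ (⌈σ⌉₊ + 1) = r⁻¹ ^ ⌈σ⌉₊ := by
            rw [pow_succ', ← mul_assoc, mul_inv_cancel₀ hr0.ne', one_mul]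
          rw [mul_pow, mul_assoc _ r, h2, mul_assoc]
        _ ≤ _ := mul_le_of_le_one_left (by positivity) hr2
    have hint : ∀ F : X → ℝ, 𝒜.IsCr σ F → (∀ x, 0 ≤ F x) → (∀ x, F x ≤ 1) →
        Integrable F μ := fun F hF h0 h1 =>
      Integrable.of_bound hF.1.continuous.measurable.aestronglyMeasurable 1
        (ae_of_all _ fun x => by rw [Real.norm_of_nonneg (h0 x)]; exact h1 x)
    obtain ⟨a1, -, -, -⟩ := h (r / q ^ 2) (by positivity) (hsmall _ (by linarith)).1
    obtain ⟨b1, -, -, b4⟩ := h (r / q) (by positivity) (hsmall _ (by linarith)).1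
    rw [mul_div_cancel₀ r hq0.ne'] at b4
    obtain ⟨-, -, c3, -⟩ := h r hr0 (hsmall _ (by linarith)).1
    obtain ⟨-, d2, -, -⟩ := h (q * r) (by positivity) (hsmall _ (by linarith)).1
    obtain ⟨-, g2, -, -⟩ := h (q ^ 2 * r) (by positivity) (hsmall _ le_rfl).1
    have hq2 : q * (r / q ^ 2) = r / q := by field_simp
    have hq3 : q * (q * r) = q ^ 2 * r := by ring
    rw [hq2] at hfz
    rw [hq3] at hgz
    set p := μ.real (Metric.eball c (ENNReal.ofReal r)) with hp
    have hp1 : μ.real (chartBall c A (r / q)) ≤ p := measureReal_mono b4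
    have hp2 : p ≤ μ.real (chartBall c A (q * r)) := measureReal_mono c3
    have hp0 : 0 ≤ p := measureReal_nonneg
    have hif : μ.real (chartBall c A (r / q ^ 2)) ≤ ∫ x, f x ∂μ := by
      rw [← integral_indicator_one (isOpen_chartBall c A _).measurableSet]
      refine integral_mono ((integrable_const 1).indicator
        (isOpen_chartBall c A _).measurableSet) (hint f hf hf0 hf1) fun x => ?_
      by_cases hx : x ∈ chartBall c A (r / q ^ 2)
      · simp [hx, hfe]
      · simp [hx, hf0]
    have hig : ∫ x, g x ∂μ ≤ μ.real (chartBall c A (q ^ 2 * r)) := by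
      rw [← integral_indicator_one (isOpen_chartBall c A _).measurableSet]
      refine integral_mono (hint g hg hg0 hg1) ((integrable_const 1).indicator
        (isOpen_chartBall c A _).measurableSet) fun x => ?_
      by_cases hx : x ∈ chartBall c A (q ^ 2 * r)
      · simp [hx, hg1]
      · simp [hx, hgz]
    refine ⟨f, g, hf, hg, hnorm _ le_rfl f hfn, hnorm _ (e1.trans e3) g hgn, hf0, fun x => ?_,
      fun x => ?_, hg1, ?_, ?_⟩
    · by_cases hx : x ∈ Metric.eball c (ENNReal.ofReal r)
      · simp only [indicator_of_mem hx, Pi.one_apply]; exact hf1 x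
      · rw [indicator_of_notMem hx, hfz x fun h => hx (b4 h)]
    · by_cases hx : x ∈ Metric.eball c (ENNReal.ofReal r)
      · simp only [indicator_of_mem hx, Pi.one_apply]; exact (hge x (c3 hx)).ge
      · rw [indicator_of_notMem hx]; exact hg0 x
    · have h5 : p ≤ q ^ (5 * d + 2) * ∫ x, f x ∂μ := by
        calc p ≤ q ^ (d + 1) * (κ * (q * r) ^ d) := hp2.trans d2
          _ = q ^ (4 * d + 1) * (κ * (r / q ^ 2) ^ d) := by
            rw [div_pow, mul_pow, ← pow_mul]
            field_simp
            ring
          _ ≤ q ^ (4 * d + 1) * (q ^ (d + 1) * ∫ x, f x ∂μ) := by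
            exact mul_le_mul_of_nonneg_left (a1.trans (by gcongr)) (by positivity)
          _ = _ := by ring
      have h6 : 0 ≤ ∫ x, f x ∂μ := integral_nonneg hf0
      -- For ε ≥ 1 the left side is nonpositive; otherwise (1 - ε) (1 + ε) ≤ 1 is used.
      rcases le_total ε 1 with h7 | h7
      · calc (1 - ε) * p ≤ (1 - ε) * (q ^ (5 * d + 2) * ∫ x, f x ∂μ) := by
              gcongr
          _ ≤ (1 - ε) * ((1 + ε) * ∫ x, f x ∂μ) := by gcongr
          _ ≤ _ := by nlinarith [sq_nonneg ε]
      · exact (mul_nonpos_of_nonpos_of_nonneg (by linarith) hp0).trans h6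
    · calc ∫ x, g x ∂μ ≤ q ^ (d + 1) * (κ * (q ^ 2 * r) ^ d) := hig.trans g2
        _ = q ^ (4 * d + 1) * (κ * (r / q) ^ d) := by
          rw [div_pow, mul_pow, ← pow_mul]
          field_simp
          ring
        _ ≤ q ^ (4 * d + 1) * (q ^ (d + 1) * p) := by
          exact mul_le_mul_of_nonneg_left (b1.trans (by gcongr)) (by positivity)
        _ = q ^ (5 * d + 2) * p := by ring
        _ ≤ _ := by gcongr

end Approximation

/-! ### Asymptotic independence at logarithmic gaps -/

section Mixing

open Set

/-- One η pays for both errors: the relative error of each of `n` approximations and the additive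
error of mixing. -/
theorem exists_pos_one_add_pow_le (n : ℕ) {ε : ℝ} (hε : 0 < ε) :
    ∃ η : ℝ, 0 < η ∧ η ≤ 1 ∧ (1 + η) ^ n + η ≤ 1 + ε ∧ 1 - ε ≤ (1 - η) ^ n - η := by
  have h1 : Tendsto (fun η : ℝ => (1 + η) ^ n + η) (𝓝[>] 0) (𝓝 ((1 + 0) ^ n + 0)) :=
    (Continuous.tendsto (by fun_prop) 0).mono_left nhdsWithin_le_nhds
  have h2 : Tendsto (fun η : ℝ => (1 - η) ^ n - η) (𝓝[>] 0) (𝓝 ((1 - 0) ^ n - 0)) :=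
    (Continuous.tendsto (by fun_prop) 0).mono_left nhdsWithin_le_nhds
  simp only [add_zero, sub_zero, one_pow] at h1 h2
  obtain ⟨η, ⟨⟨h3, h4⟩, h5⟩, h6⟩ := (((h1.eventually_le_const (show (1 : ℝ) < 1 + ε by linarith)).and
    (h2.eventually_const_le (show 1 - ε < (1 : ℝ) by linarith))).and
    (Ioo_mem_nhdsGT (zero_lt_one' ℝ))).and self_mem_nhdsWithin |>.exists
  exact ⟨η, h6, h5.2.le, h3, h4⟩

variable {d : ℕ} {k : ℕ∞} {X : Type*} [EMetricSpace X]
    [MeasurableSpace X] [BorelSpace X]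
    [ChartedSpace (EuclideanSpace ℝ (Fin d)) X]

/-- The balls `B r` are almost independent along times with gaps of a large multiple
of `|log r|`. -/
def LogMixing {X : Type*} [MeasurableSpace X] (μ : Measure X) (T : X → X) (B : ℝ → Set X) : Prop :=
  ∀ n : ℕ, ∃ K : ℝ, 0 < K ∧ ∀ ε > 0, ∀ᶠ r : ℝ in 𝓝[>] 0, ∀ t : Fin n → ℕ,
    (∀ i j, i < j → (t i : ℝ) + K * |Real.log r| ≤ t j) →
    |μ.real {x | ∀ i, T^[t i] x ∈ B r} - μ.real (B r) ^ n| ≤ ε * μ.real (B r) ^ n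

/-- Mixing applies to the upper and lower approximations of the indicator, whose products bound the
indicator of the joint visit. The polynomial norms and the polynomial lower bound for the measure
are both outweighed once the gap is a large multiple of |log r|. -/
theorem logMixing_of_approximations (𝒜 : ChartCover d k X)
    (μ : Measure X) [IsProbabilityMeasure μ] (T : X → X) (hT : MeasurePreserving T μ μ)
    (B : ℝ → Set X) (hB : ∀ r, MeasurableSet (B r)) {σ C γ : ℝ} (hC : 1 < C) (hγ : 0 < γ)
    (hmix : ∀ n : ℕ, 1 ≤ n → ∀ f : Fin n → X → ℝ, (∀ j, 𝒜.IsCr σ (f j)) →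
      ∀ (t : Fin n → ℕ) (p : ℕ), (∀ i j, i < j → t i + p ≤ t j) →
        |(∫ x, ∏ j, f j (T^[t j] x) ∂μ) - ∏ j, ∫ x, f j x ∂μ| ≤
          C * Real.exp (-γ * p) * ∏ j, (𝒜.crNorm σ (f j)).toReal)
    {Q D : ℕ} (hD : ∀ᶠ r : ℝ in 𝓝[>] 0, r ^ D ≤ μ.real (B r))
    (happ : ∀ ε > 0, ∀ᶠ r : ℝ in 𝓝[>] 0, ∃ f g : X → ℝ, 𝒜.IsCr σ f ∧ 𝒜.IsCr σ g ∧
        (𝒜.crNorm σ f).toReal ≤ r⁻¹ ^ Q ∧ (𝒜.crNorm σ g).toReal ≤ r⁻¹ ^ Q ∧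
        (∀ x, 0 ≤ f x) ∧ (∀ x, f x ≤ (B r).indicator 1 x) ∧
        (∀ x, (B r).indicator 1 x ≤ g x) ∧ (∀ x, g x ≤ 1) ∧
        (1 - ε) * μ.real (B r) ≤ ∫ x, f x ∂μ ∧ ∫ x, g x ∂μ ≤ (1 + ε) * μ.real (B r)) :
    LogMixing μ T B := by
  intro n
  rcases Nat.eq_zero_or_pos n with rfl | hn
  · refine ⟨1, one_pos, fun ε hε => Eventually.of_forall fun r t ht => ?_⟩
    simp [hε.le]
  -- Of these powers of `r`, Q n cancel the norms, D n are compared with the measure of the ball to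
  -- the power `n`, and the last absorbs C / η. The gap N / γ times |log r| yields all of them.
  set N := Q * n + D * n + 1 with hN
  refine ⟨N / γ, by positivity, fun ε hε => ?_⟩
  obtain ⟨η, hη0, hη1, hη2, hη3⟩ := exists_pos_one_add_pow_le n hε
  filter_upwards [self_mem_nhdsWithin, Ioo_mem_nhdsGT (zero_lt_one' ℝ), hD, happ η hη0,
    eventually_const_mul_le_inv (C / η)] with r (hr0 : 0 < r) hr1 hrD hrf hrC t ht
  obtain ⟨f, g, hf, hg, hfn, hgn, hf0, hfB, hgB, hg1, hfi, hgi⟩ := hrf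
  set p := μ.real (B r) with hp
  have hp0 : 0 ≤ p := measureReal_nonneg
  set S := {x | ∀ i, T^[t i] x ∈ B r} with hS
  have hlog : |Real.log r| = -Real.log r := abs_of_neg (Real.log_neg hr0 hr1.2)
  have herr : ∀ F : X → ℝ, 𝒜.IsCr σ F → (𝒜.crNorm σ F).toReal ≤ r⁻¹ ^ Q →
      |(∫ x, ∏ j : Fin n, F (T^[t j] x) ∂μ) - (∫ x, F x ∂μ) ^ n| ≤ η * p ^ n := by
    intro F hF hFn
    have h1 := hmix n hn (fun _ => F) (fun _ => hF) t ⌈N / γ * |Real.log r|⌉₊ (fun i j hij => by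
      have h2 := ht i j hij
      have h3 : t i ≤ t j := by
        have : (0 : ℝ) ≤ N / γ * |Real.log r| := by positivity
        exact_mod_cast (by linarith : (t i : ℝ) ≤ t j)
      have h4 : ⌈N / γ * |Real.log r|⌉₊ ≤ t j - t i := by
        rw [Nat.ceil_le, Nat.cast_sub h3]; linarith
      omega)
    simp only [Finset.prod_const, Finset.card_univ, Fintype.card_fin] at h1
    refine h1.trans ?_
    have h5 : Real.exp (-γ * (⌈N / γ * |Real.log r|⌉₊ : ℕ)) ≤ r ^ N := by
      have h6 : Real.exp (N * Real.log r) = r ^ N := by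
        rw [mul_comm, Real.exp_mul, Real.exp_log hr0, Real.rpow_natCast]
      rw [← h6, Real.exp_le_exp]
      have h7 := Nat.le_ceil (N / γ * |Real.log r|)
      calc -γ * (⌈N / γ * |Real.log r|⌉₊ : ℕ) ≤ -γ * (N / γ * |Real.log r|) := by
            rw [neg_mul, neg_mul]; exact neg_le_neg (mul_le_mul_of_nonneg_left h7 hγ.le)
        _ = N * Real.log r := by rw [hlog]; field_simp
    calc C * Real.exp (-γ * (⌈N / γ * |Real.log r|⌉₊ : ℕ)) * (𝒜.crNorm σ F).toReal ^ n
        ≤ C * r ^ N * (r⁻¹ ^ Q) ^ n := by gcongr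
      _ = C * r * (r ^ D) ^ n := by
        have h8 : r ^ (Q * n) * (r⁻¹ ^ Q) ^ n = 1 := by
          rw [← pow_mul, ← mul_pow, mul_inv_cancel₀ hr0.ne', one_pow]
        calc C * r ^ N * (r⁻¹ ^ Q) ^ n
            = C * r * (r ^ (D * n)) * (r ^ (Q * n) * (r⁻¹ ^ Q) ^ n) := by rw [hN]; ring
          _ = _ := by rw [h8, mul_one, pow_mul]
      _ ≤ η * p ^ n := by
        have h9 : C * r ≤ η := by
          rw [div_mul_eq_mul_div, div_le_one hη0] at hrC; exact hrC
        gcongr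
  have hTm : ∀ m, Measurable T^[m] := fun m => hT.measurable.iterate m
  have hSm : MeasurableSet S := by
    have : S = ⋂ i, T^[t i] ⁻¹' B r := by ext; simp [hS]
    rw [this]
    exact MeasurableSet.iInter fun i => hTm _ (hB r)
  have hind : ∀ x, S.indicator (1 : X → ℝ) x = ∏ j : Fin n, (B r).indicator 1 (T^[t j] x) := by
    intro x
    by_cases hx : x ∈ S
    · rw [indicator_of_mem hx, Finset.prod_eq_one fun j _ => indicator_of_mem (hx j) _]
      rfl
    · rw [indicator_of_notMem hx]
      simp only [hS, mem_ofPred_eq, not_forall] at hx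
      obtain ⟨j, hj⟩ := hx
      exact (Finset.prod_eq_zero (Finset.mem_univ j) (indicator_of_notMem hj _)).symm
  have hint : ∀ F : X → ℝ, 𝒜.IsCr σ F → (∀ x, 0 ≤ F x) → (∀ x, F x ≤ 1) →
      Integrable (fun x => ∏ j : Fin n, F (T^[t j] x)) μ := fun F hF h0 h1 =>
    Integrable.of_bound (Finset.measurable_prod _ fun j _ =>
        hF.1.continuous.measurable.comp (hTm _)).aestronglyMeasurable 1
      (ae_of_all _ fun x => by
        rw [Real.norm_of_nonneg (Finset.prod_nonneg fun j _ => h0 _)]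
        exact Finset.prod_le_one (fun j _ => h0 _) fun j _ => h1 _)
  have hB0 : ∀ x, (0 : ℝ) ≤ (B r).indicator 1 x := fun x =>
    indicator_nonneg (fun _ _ => zero_le_one) x
  have hB1 : ∀ x, (B r).indicator (1 : X → ℝ) x ≤ 1 := fun x =>
    indicator_le' (fun _ _ => le_rfl) (fun _ _ => zero_le_one) x
  have hSi : Integrable (S.indicator (1 : X → ℝ)) μ := (integrable_const 1).indicator hSm
  have hSr : μ.real S = ∫ x, S.indicator (1 : X → ℝ) x ∂μ := (integral_indicator_one hSm).symm
  have hup : μ.real S ≤ (1 + ε) * p ^ n := by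
    calc μ.real S ≤ ∫ x, ∏ j : Fin n, g (T^[t j] x) ∂μ := by
          rw [hSr]
          refine integral_mono hSi (hint g hg (fun x => (hB0 x).trans (hgB x)) hg1) fun x => ?_
          rw [hind]
          exact Finset.prod_le_prod (fun j _ => hB0 _) fun j _ => hgB _
      _ ≤ (∫ x, g x ∂μ) ^ n + η * p ^ n := by
          have := (abs_le.1 (herr g hg hgn)).2; linarith
      _ ≤ ((1 + η) * p) ^ n + η * p ^ n := by
          gcongr
          exact integral_nonneg fun x => (hB0 x).trans (hgB x)
      _ = ((1 + η) ^ n + η) * p ^ n := by rw [mul_pow]; ring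
      _ ≤ _ := by gcongr
  have hlow : (1 - ε) * p ^ n ≤ μ.real S := by
    calc (1 - ε) * p ^ n ≤ ((1 - η) ^ n - η) * p ^ n := by gcongr
      _ = ((1 - η) * p) ^ n - η * p ^ n := by rw [mul_pow]; ring
      _ ≤ (∫ x, f x ∂μ) ^ n - η * p ^ n := by
          have : 0 ≤ (1 - η) * p := mul_nonneg (by linarith) hp0
          gcongr
      _ ≤ ∫ x, ∏ j : Fin n, f (T^[t j] x) ∂μ := by
          have := (abs_le.1 (herr f hf hfn)).1; linarith
      _ ≤ μ.real S := by
          rw [hSr]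
          refine integral_mono (hint f hf hf0 fun x => (hfB x).trans (hB1 x)) hSi fun x => ?_
          rw [hind]
          exact Finset.prod_le_prod (fun j _ => hf0 _) fun j _ => hfB _
  rw [abs_le]
  constructor <;> linarith

end Mixing

/-! ### Bonferroni inequalities and counting of pairs -/

section Bonferroni

open Finset

/-- The Bonferroni inequalities for `(1 - p) ^ q`. -/
theorem bonferroni {p : ℝ} (hp0 : 0 ≤ p) (hp1 : p ≤ 1) (q m : ℕ) :
    0 ≤ (-1) ^ m * ((1 - p) ^ q - ∑ i ∈ range m, (-1) ^ i * (q.choose i * p ^ i)) ∧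
      (-1) ^ m * ((1 - p) ^ q - ∑ i ∈ range m, (-1) ^ i * (q.choose i * p ^ i)) ≤
        q.choose m * p ^ m := by
  induction q generalizing m with
  | zero =>
    cases m with
    | zero => simp
    | succ m => rw [Finset.sum_range_succ']; simp
  | succ q ih =>
    cases m with
    | zero =>
      simp only [pow_zero, range_zero, sum_empty, sub_zero, one_mul, Nat.choose_zero_right,
        Nat.cast_one, mul_one]
      exact ⟨pow_nonneg (by linarith) _, pow_le_one₀ (by linarith) (by linarith)⟩
    | succ m =>
      -- Pascal's rule: the new truncation error is a difference of two earlier ones whose signs,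
      -- after normalization, agree, so both bounds propagate.
      have key : (1 - p) ^ (q + 1) - ∑ i ∈ range (m + 1), (-1) ^ i * ((q + 1).choose i * p ^ i) =
          ((1 - p) ^ q - ∑ i ∈ range (m + 1), (-1) ^ i * (q.choose i * p ^ i)) -
            p * ((1 - p) ^ q - ∑ i ∈ range m, (-1) ^ i * (q.choose i * p ^ i)) := by
        rw [Finset.sum_range_succ', Finset.sum_range_succ' (fun i => (-1 : ℝ) ^ i * (q.choose i * p ^ i)),
          mul_sub, Finset.mul_sum]
        have : ∑ i ∈ range m, (-1 : ℝ) ^ (i + 1) * ((q + 1).choose (i + 1) * p ^ (i + 1)) =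
            ∑ i ∈ range m, (-1 : ℝ) ^ (i + 1) * (q.choose (i + 1) * p ^ (i + 1)) -
              ∑ i ∈ range m, p * ((-1) ^ i * (q.choose i * p ^ i)) := by
          rw [← Finset.sum_sub_distrib]
          refine Finset.sum_congr rfl fun i _ => ?_
          rw [Nat.choose_succ_succ]
          push_cast
          ring
        rw [this]
        simp only [pow_zero, Nat.choose_zero_right, Nat.cast_one, mul_one]
        ring
      obtain ⟨h1, h2⟩ := ih (m + 1)
      obtain ⟨h3, h4⟩ := ih m
      rw [key, mul_sub]
      have h5 : (-1 : ℝ) ^ (m + 1) *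
          (p * ((1 - p) ^ q - ∑ i ∈ range m, (-1) ^ i * (q.choose i * p ^ i))) =
          -(p * ((-1) ^ m * ((1 - p) ^ q - ∑ i ∈ range m, (-1) ^ i * (q.choose i * p ^ i)))) := by
        ring
      rw [h5]
      have h6 := mul_nonneg hp0 h3
      have h7 := mul_le_mul_of_nonneg_left h4 hp0
      have h8 : (((q + 1).choose (m + 1) : ℕ) : ℝ) * p ^ (m + 1) =
          q.choose (m + 1) * p ^ (m + 1) + p * (q.choose m * p ^ m) := by
        rw [Nat.choose_succ_succ]; push_cast; ring
      constructor <;> linarith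

/-- Used with the probability of a visit and also with p = 1, where it is truncated
inclusion–exclusion for the emptiness of a set of size `q`. -/
theorem abs_one_sub_pow_sub_sum_le {p : ℝ} (hp0 : 0 ≤ p) (hp1 : p ≤ 1) (q m : ℕ) :
    |(1 - p) ^ q - ∑ i ∈ range m, (-1) ^ i * (q.choose i * p ^ i)| ≤ q.choose m * p ^ m := by
  obtain ⟨h1, h2⟩ := bonferroni hp0 hp1 q m
  have h3 := abs_of_nonneg h1
  rw [abs_mul, abs_pow, abs_neg, abs_one, one_pow, one_mul] at h3
  rw [h3]
  exact h2

/-- Sending (I, K) to (I ∪ K, I) is injective since K is disjoint from I, and a set of n + i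
elements has (n + i).choose n subsets of size n. -/
theorem sum_powersetCard_union_le {ι : Type*} [DecidableEq ι] (S : Finset ι)
    (B : Finset ι → Finset ι) (hB : ∀ I, I ⊆ S → B I ⊆ S) (n i : ℕ) (h : Finset ι → ℝ)
    (h0 : ∀ L, 0 ≤ h L) :
    ∑ I ∈ S.powersetCard n, ∑ K ∈ (B I \ I).powersetCard i, h (I ∪ K) ≤
      (n + i).choose n * ∑ L ∈ S.powersetCard (n + i), h L := by
  have h1 : ((n + i).choose n : ℝ) * ∑ L ∈ S.powersetCard (n + i), h L =
      ∑ x ∈ (S.powersetCard (n + i)).sigma fun L => L.powersetCard n, h x.1 := by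
    rw [Finset.sum_sigma, Finset.mul_sum]
    refine Finset.sum_congr rfl fun L hL => ?_
    simp only [Finset.sum_const, card_powersetCard, (mem_powersetCard.1 hL).2, nsmul_eq_mul]
  rw [h1, ← Finset.sum_sigma (S.powersetCard n) (fun I => (B I \ I).powersetCard i)
    fun x => h (x.1 ∪ x.2)]
  let e : (_ : Finset ι) × Finset ι → (_ : Finset ι) × Finset ι := fun x => ⟨x.1 ∪ x.2, x.1⟩
  have hinj : Set.InjOn e ((S.powersetCard n).sigma fun I => (B I \ I).powersetCard i) := by
    rintro ⟨I, K⟩ hx ⟨I', K'⟩ hx' hxx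
    simp only [coe_sigma, Set.mem_sigma_iff, mem_coe, mem_powersetCard] at hx hx'
    simp only [e, Sigma.mk.injEq, heq_eq_eq] at hxx
    obtain ⟨h2, rfl⟩ := hxx
    have d1 : Disjoint I K := disjoint_of_subset_right hx.2.1 disjoint_sdiff
    have d2 : Disjoint I K' := disjoint_of_subset_right hx'.2.1 disjoint_sdiff
    have : K = K' := by
      have h3 : (I ∪ K) \ I = (I ∪ K') \ I := by rw [h2]
      rwa [union_sdiff_cancel_left d1, union_sdiff_cancel_left d2] at h3
    rw [this]
  have h2 : ∑ x ∈ (S.powersetCard n).sigma (fun I => (B I \ I).powersetCard i), h (x.1 ∪ x.2) =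
      ∑ x ∈ ((S.powersetCard n).sigma fun I => (B I \ I).powersetCard i).image e, h x.1 := by
    rw [Finset.sum_image hinj]
  rw [h2]
  refine Finset.sum_le_sum_of_subset_of_nonneg ?_ fun x _ _ => h0 _
  intro y hy
  obtain ⟨⟨I, K⟩, hx, rfl⟩ := Finset.mem_image.1 hy
  simp only [mem_sigma, mem_powersetCard] at hx
  have d1 : Disjoint I K := disjoint_of_subset_right hx.2.1 disjoint_sdiff
  simp only [e, mem_sigma, mem_powersetCard]
  refine ⟨⟨union_subset hx.1.1 (hx.2.1.trans (sdiff_subset.trans (hB I hx.1.1))), ?_⟩,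
    subset_union_left, hx.1.2⟩
  rw [card_union_of_disjoint d1, hx.1.2, hx.2.2]

end Bonferroni

/-! ### Exact visit patterns from joint visits -/

section Patterns

open Finset

variable {X : Type*}

/-- If some index of I is not hit, everything vanishes. Otherwise the pattern occurs exactly when no
other index of B is hit, and the inner sums count subsets of the set of extra hits. -/
theorem abs_indicator_pattern_sub_le {E : ℕ → Set X} {B I : Finset ℕ} (hIB : I ⊆ B) (m : ℕ) (x : X) :
    |{x | ∀ j ∈ B, x ∈ E j ↔ j ∈ I}.indicator (1 : X → ℝ) x -
      ∑ i ∈ range m, (-1) ^ i * ∑ K ∈ (B \ I).powersetCard i,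
        (⋂ j ∈ I ∪ K, E j).indicator (1 : X → ℝ) x| ≤
      ∑ K ∈ (B \ I).powersetCard m, (⋂ j ∈ I ∪ K, E j).indicator (1 : X → ℝ) x := by
  classical
  by_cases hI : ∀ j ∈ I, x ∈ E j
  · set V := (B \ I).filter fun j => x ∈ E j with hV
    have h1 : ∀ i, ∑ K ∈ (B \ I).powersetCard i,
        (⋂ j ∈ I ∪ K, E j).indicator (1 : X → ℝ) x = (#V).choose i := by
      intro i
      have h2 : ∀ K ∈ (B \ I).powersetCard i, (⋂ j ∈ I ∪ K, E j).indicator (1 : X → ℝ) x =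
          if K ⊆ V then 1 else 0 := by
        intro K hK
        rw [Set.indicator_apply]
        refine if_congr ?_ rfl rfl
        simp only [Set.mem_iInter, mem_union]
        constructor
        · intro h j hj
          exact mem_filter.2 ⟨(mem_powersetCard.1 hK).1 hj, h j (Or.inr hj)⟩
        · rintro h j (hj | hj)
          · exact hI j hj
          · exact (mem_filter.1 (h hj)).2
      rw [Finset.sum_congr rfl h2, ← Finset.sum_filter, Finset.sum_const, nsmul_eq_mul, mul_one,
        ← card_powersetCard]
      congr 2
      ext K
      simp only [mem_filter, mem_powersetCard]
      exact ⟨fun h => ⟨h.2, h.1.2⟩, fun h => ⟨⟨h.1.trans (filter_subset _ _), h.2⟩, h.1⟩⟩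
    -- With the convention 0 ^ 0 = 1, this power is the indicator that there are no extra hits.
    have h3 : {x | ∀ j ∈ B, x ∈ E j ↔ j ∈ I}.indicator (1 : X → ℝ) x = (1 - 1) ^ #V := by
      rw [sub_self, zero_pow_eq, Set.indicator_apply]
      refine if_congr ?_ rfl rfl
      rw [card_eq_zero, hV, filter_eq_empty_iff]
      exact ⟨fun h j hj hx => (Finset.mem_sdiff.1 hj).2 ((h j (Finset.mem_sdiff.1 hj).1).1 hx),
        fun h j hj => ⟨fun hx => by_contra fun hjI => h (Finset.mem_sdiff.2 ⟨hj, hjI⟩) hx,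
          fun hjI => hI j hjI⟩⟩
    have h4 := abs_one_sub_pow_sub_sum_le zero_le_one le_rfl #V m
    simp only [one_pow, mul_one] at h4
    simp only [h1, h3]
    exact h4
  · have h1 : ∀ K, (⋂ j ∈ I ∪ K, E j).indicator (1 : X → ℝ) x = 0 := by
      intro K
      refine Set.indicator_of_notMem (fun h => hI fun j hj => ?_) _
      simp only [Set.mem_iInter] at h
      exact h j (mem_union_left _ hj)
    have h2 : {x | ∀ j ∈ B, x ∈ E j ↔ j ∈ I}.indicator (1 : X → ℝ) x = 0 :=
      Set.indicator_of_notMem (fun h => hI fun j hj => (h j (hIB hj)).2 hj) _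
    simp only [h1, h2]
    simp

variable [MeasurableSpace X] (ν : Measure X) (E : ℕ → Set X)

/-- The mass of the points that lie in all the sets `E j`, `j ∈ L`. -/
noncomputable def hitMass (L : Finset ℕ) : ℝ := ν.real (⋂ j ∈ L, E j)

/-- The mass of the points that lie, for `j ∈ B`, in `E j` exactly if `j ∈ I`. -/
noncomputable def patternMass (B I : Finset ℕ) : ℝ := ν.real {x | ∀ j ∈ B, x ∈ E j ↔ j ∈ I}

variable {ν E}

theorem measurableSet_pattern (hE : ∀ j, MeasurableSet (E j)) (B I : Finset ℕ) :
    MeasurableSet {x | ∀ j ∈ B, x ∈ E j ↔ j ∈ I} := by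
  have : {x | ∀ j ∈ B, x ∈ E j ↔ j ∈ I} = ⋂ j ∈ B, {x | x ∈ E j ↔ j ∈ I} := by
    ext; simp
  rw [this]
  refine Finset.measurableSet_biInter _ fun j _ => ?_
  by_cases hj : j ∈ I
  · have : {x | x ∈ E j ↔ j ∈ I} = E j := by ext; simp [hj]
    rw [this]
    exact hE j
  · have : {x | x ∈ E j ↔ j ∈ I} = (E j)ᶜ := by ext; simp [hj]
    rw [this]
    exact (hE j).compl

theorem measurableSet_hit (hE : ∀ j, MeasurableSet (E j)) (L : Finset ℕ) :
    MeasurableSet (⋂ j ∈ L, E j) := Finset.measurableSet_biInter _ fun j _ => hE j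

theorem abs_patternMass_sub_le [IsFiniteMeasure ν] (hE : ∀ j, MeasurableSet (E j))
    {B I : Finset ℕ} (hIB : I ⊆ B) (m : ℕ) :
    |patternMass ν E B I -
      ∑ i ∈ range m, (-1) ^ i * ∑ K ∈ (B \ I).powersetCard i, hitMass ν E (I ∪ K)| ≤
      ∑ K ∈ (B \ I).powersetCard m, hitMass ν E (I ∪ K) := by
  have hi : ∀ L, Integrable ((⋂ j ∈ L, E j).indicator (1 : X → ℝ)) ν := fun L =>
    (integrable_const 1).indicator (measurableSet_hit hE L)
  have hp : Integrable ({x | ∀ j ∈ B, x ∈ E j ↔ j ∈ I}.indicator (1 : X → ℝ)) ν :=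
    (integrable_const 1).indicator (measurableSet_pattern hE B I)
  have e1 : ∀ L, hitMass ν E L = ∫ x, (⋂ j ∈ L, E j).indicator (1 : X → ℝ) x ∂ν := fun L =>
    (integral_indicator_one (measurableSet_hit hE L)).symm
  have e2 : patternMass ν E B I =
      ∫ x, {x | ∀ j ∈ B, x ∈ E j ↔ j ∈ I}.indicator (1 : X → ℝ) x ∂ν :=
    (integral_indicator_one (measurableSet_pattern hE B I)).symm
  have hs : ∀ i, Integrable (fun x => ∑ K ∈ (B \ I).powersetCard i,
      (⋂ j ∈ I ∪ K, E j).indicator (1 : X → ℝ) x) ν := fun i =>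
    integrable_finsetSum _ fun K _ => hi (I ∪ K)
  have hs' : Integrable (fun x => ∑ i ∈ range m, (-1 : ℝ) ^ i * ∑ K ∈ (B \ I).powersetCard i,
      (⋂ j ∈ I ∪ K, E j).indicator (1 : X → ℝ) x) ν :=
    integrable_finsetSum _ fun i _ => (hs i).const_mul _
  simp only [e1, e2]
  have e3 : ∀ i, ∑ K ∈ (B \ I).powersetCard i,
      ∫ x, (⋂ j ∈ I ∪ K, E j).indicator (1 : X → ℝ) x ∂ν =
      ∫ x, ∑ K ∈ (B \ I).powersetCard i, (⋂ j ∈ I ∪ K, E j).indicator (1 : X → ℝ) x ∂ν :=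
    fun i => (integral_finsetSum _ fun K _ => hi (I ∪ K)).symm
  simp only [e3, ← integral_const_mul]
  rw [← integral_finsetSum _ fun i _ => (hs i).const_mul _, ← integral_sub hp hs']
  refine (abs_integral_le_integral_abs).trans ?_
  exact integral_mono (hp.sub hs').abs (hs m) fun x => abs_indicator_pattern_sub_le hIB m x

/-- If the masses of the multiple hits are close to those of independent events of probability `p`,
the masses of the patterns are close to those of Bernoulli trials. -/
theorem sum_abs_patternMass_sub_le [IsFiniteMeasure ν] (hE : ∀ j, MeasurableSet (E j)) {p : ℝ}
    (hp0 : 0 ≤ p) (hp1 : p ≤ 1) (M n m : ℕ) :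
    ∑ I ∈ (Ioc 0 M).powersetCard n,
      |patternMass ν E (Ioc 0 (I.sup id)) I - p ^ n * (1 - p) ^ (I.sup id - n)| ≤
    ∑ i ∈ range m, (n + i).choose n *
      ∑ L ∈ (Ioc 0 M).powersetCard (n + i), |hitMass ν E L - p ^ (n + i)| +
    (n + m).choose n * (∑ L ∈ (Ioc 0 M).powersetCard (n + m), |hitMass ν E L - p ^ (n + m)| +
      2 * (M.choose (n + m) * p ^ (n + m))) := by
  -- A pattern is observed only up to its last visit, so I alone determines it; the number of misses
  -- is the last index minus n.
  set B : Finset ℕ → Finset ℕ := fun I => Ioc 0 (I.sup id) with hBdef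
  have hB : ∀ I, I ⊆ Ioc 0 M → B I ⊆ Ioc 0 M := fun I hI =>
    Ioc_subset_Ioc_right (Finset.sup_le fun j hj => (mem_Ioc.1 (hI hj)).2)
  have hIB : ∀ I, I ⊆ Ioc 0 M → I ⊆ B I := fun I hI j hj =>
    mem_Ioc.2 ⟨(mem_Ioc.1 (hI hj)).1, Finset.le_sup (f := id) hj⟩
  have hstep : ∀ I ∈ (Ioc 0 M).powersetCard n,
      |patternMass ν E (B I) I - p ^ n * (1 - p) ^ (I.sup id - n)| ≤
      ∑ i ∈ range m, ∑ K ∈ (B I \ I).powersetCard i, |hitMass ν E (I ∪ K) - p ^ (n + i)| +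
      ∑ K ∈ (B I \ I).powersetCard m, (|hitMass ν E (I ∪ K) - p ^ (n + m)| +
        2 * p ^ (n + m)) := by
    intro I hI
    obtain ⟨hIM, hIn⟩ := mem_powersetCard.1 hI
    have hcard : #(B I \ I) = I.sup id - n := by
      rw [card_sdiff_of_subset (hIB I hIM), hIn]; simp [B]
    have h1 := abs_patternMass_sub_le (ν := ν) hE (hIB I hIM) m
    have h2 := abs_one_sub_pow_sub_sum_le hp0 hp1 #(B I \ I) m
    have h3 : ∀ i, p ^ n * ((#(B I \ I)).choose i * p ^ i) =
        ∑ K ∈ (B I \ I).powersetCard i, p ^ (n + i) := fun i => by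
      rw [Finset.sum_const, card_powersetCard, nsmul_eq_mul, pow_add]; ring
    have h4 : |p ^ n * (1 - p) ^ #(B I \ I) -
        ∑ i ∈ range m, (-1) ^ i * ∑ K ∈ (B I \ I).powersetCard i, p ^ (n + i)| ≤
        ∑ K ∈ (B I \ I).powersetCard m, p ^ (n + m) := by
      simp only [← h3]
      have h5 := mul_le_mul_of_nonneg_left h2 (pow_nonneg hp0 n)
      rw [← abs_of_nonneg (pow_nonneg hp0 n), ← abs_mul, abs_of_nonneg (pow_nonneg hp0 n)] at h5
      refine le_trans (le_of_eq ?_) h5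
      rw [mul_sub, Finset.mul_sum]
      congr 2
      exact Finset.sum_congr rfl fun i _ => by ring
    have h6 : |∑ i ∈ range m, (-1 : ℝ) ^ i * ∑ K ∈ (B I \ I).powersetCard i, hitMass ν E (I ∪ K) -
        ∑ i ∈ range m, (-1 : ℝ) ^ i * ∑ K ∈ (B I \ I).powersetCard i, p ^ (n + i)| ≤
        ∑ i ∈ range m, ∑ K ∈ (B I \ I).powersetCard i, |hitMass ν E (I ∪ K) - p ^ (n + i)| := by
      rw [← Finset.sum_sub_distrib]
      refine (abs_sum_le_sum_abs _ _).trans (Finset.sum_le_sum fun i _ => ?_)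
      rw [← mul_sub, abs_mul, abs_pow, abs_neg, abs_one, one_pow, one_mul,
        ← Finset.sum_sub_distrib]
      exact abs_sum_le_sum_abs _ _
    -- Both remainders, of the measure and of the Bernoulli weights, are expressed through p ^ (n +
    -- m): hence the factor 2.
    have h7 : ∑ K ∈ (B I \ I).powersetCard m, hitMass ν E (I ∪ K) +
        ∑ K ∈ (B I \ I).powersetCard m, p ^ (n + m) ≤
        ∑ K ∈ (B I \ I).powersetCard m, (|hitMass ν E (I ∪ K) - p ^ (n + m)| +
        2 * p ^ (n + m)) := by
      rw [← Finset.sum_add_distrib]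
      refine Finset.sum_le_sum fun K _ => ?_
      linarith [le_abs_self (hitMass ν E (I ∪ K) - p ^ (n + m))]
    rw [hcard] at h4
    rw [abs_le] at *
    constructor <;> linarith [h1.1, h1.2, h4.1, h4.2, h6.1, h6.2]
  refine (Finset.sum_le_sum hstep).trans ?_
  rw [Finset.sum_add_distrib]
  refine add_le_add ?_ ?_
  · rw [Finset.sum_comm]
    refine Finset.sum_le_sum fun i _ => ?_
    exact sum_powersetCard_union_le _ B hB n i (fun L => |hitMass ν E L - p ^ (n + i)|)
      fun L => abs_nonneg _
  · refine (sum_powersetCard_union_le _ B hB n m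
      (fun L => |hitMass ν E L - p ^ (n + m)| + 2 * p ^ (n + m))
      fun L => add_nonneg (abs_nonneg _) (by positivity)).trans (le_of_eq ?_)
    rw [Finset.sum_add_distrib, Finset.sum_const, card_powersetCard, nsmul_eq_mul]
    simp only [Nat.card_Ioc, tsub_zero]
    ring

end Patterns

/-! ### Short returns and separation of visits -/

section ReturnTimes

variable {X : Type*} {T : X → X} {A : Set X} {x : X}

theorem returnTime_le {j : ℕ} (hj : 1 ≤ j) (hx : T^[j] x ∈ A) : returnTime T A x ≤ j :=
  iInf₂_le j ⟨hj, hx⟩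

theorem returnTime_iterate_le {i j : ℕ} (hij : i < j) (hx : T^[j] x ∈ A) :
    returnTime T A (T^[i] x) ≤ ((j - i : ℕ) : ℝ≥0∞) := by
  refine returnTime_le (by omega) ?_
  rwa [← Function.iterate_add_apply, Nat.sub_add_cancel hij.le]

theorem measurable_returnTime [MeasurableSpace X] (hT : Measurable T) (hA : MeasurableSet A) :
    Measurable (returnTime T A) := by
  classical
  refine Measurable.iInf fun j => ?_
  simp only [iInf_eq_if]
  refine Measurable.ite ?_ measurable_const measurable_const
  by_cases hj : 1 ≤ j
  · simp only [hj, true_and]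
    exact hT.iterate j hA
  · simp [hj]

variable (T A) in
/-- The points of `A` that return to `A` within time `q`. -/
def shortReturns (q : ℝ) : Set X := A ∩ {x | returnTime T A x ≤ ENNReal.ofReal q}

theorem measurableSet_shortReturns [MeasurableSpace X] (hT : Measurable T) (hA : MeasurableSet A)
    (q : ℝ) : MeasurableSet (shortReturns T A q) :=
  hA.inter (measurableSet_le (measurable_returnTime hT hA) measurable_const)

theorem add_lt_of_notMem_shortReturns {q : ℝ} {i j : ℕ} (hij : i < j) (hi : T^[i] x ∈ A)
    (hj : T^[j] x ∈ A) (hS : T^[i] x ∉ shortReturns T A q) : (i : ℝ) + q < j := by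
  by_contra! h
  refine hS ⟨hi, (returnTime_iterate_le hij hj).trans ?_⟩
  rw [← ENNReal.ofReal_natCast]
  refine ENNReal.ofReal_le_ofReal ?_
  rw [Nat.cast_sub hij.le]
  linarith

variable [MeasurableSpace X] {μ : Measure X}

/-- The preimages of the points of `A` with late returns are disjoint for a long time. -/
theorem mul_measureReal_sub_le_one [IsProbabilityMeasure μ] (hT : MeasurePreserving T μ μ) (hA : MeasurableSet A) {q : ℝ}
    (hq : 0 ≤ q) : q * (μ.real A - μ.real (shortReturns T A q)) ≤ 1 := by
  have hS := measurableSet_shortReturns hT.measurable hA q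
  -- The times 0, …, ⌊q⌋ give ⌊q⌋ + 1 ≥ q disjoint sets, all of the same measure by invariance.
  have hd : Set.PairwiseDisjoint (↑(Finset.range (⌊q⌋₊ + 1)))
      fun j => T^[j] ⁻¹' (A \ shortReturns T A q) := by
    have key : ∀ i j, i < j → j ≤ ⌊q⌋₊ → Disjoint (T^[i] ⁻¹' (A \ shortReturns T A q))
        (T^[j] ⁻¹' (A \ shortReturns T A q)) := by
      intro i j hij hj
      rw [Set.disjoint_left]
      intro x hx hx'
      have h1 := add_lt_of_notMem_shortReturns hij hx.1 hx'.1 hx.2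
      have h2 : (j : ℝ) ≤ q := (Nat.cast_le.2 hj).trans (Nat.floor_le hq)
      have h3 : (0 : ℝ) ≤ i := Nat.cast_nonneg i
      linarith
    intro i hi j hj hij
    have hi' : i ≤ ⌊q⌋₊ := Nat.lt_succ_iff.1 (Finset.mem_range.1 hi)
    have hj' : j ≤ ⌊q⌋₊ := Nat.lt_succ_iff.1 (Finset.mem_range.1 hj)
    rcases lt_or_gt_of_ne hij with h | h
    · exact key i j h hj'
    · exact (key j i h hi').symm
  have h1 := measureReal_biUnion_finset (μ := μ) hd
    fun j _ => (hT.measurable.iterate j) (hA.diff hS)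
  have h2 : ∀ j, μ.real (T^[j] ⁻¹' (A \ shortReturns T A q)) =
      μ.real A - μ.real (shortReturns T A q) := fun j => by
    rw [measureReal_def, (hT.iterate j).measure_preimage (hA.diff hS).nullMeasurableSet,
      ← measureReal_def, measureReal_sdiff (show shortReturns T A q ⊆ A from Set.inter_subset_left) hS]
  simp only [h2, Finset.sum_const, Finset.card_range, nsmul_eq_mul] at h1
  have h3 : 0 ≤ μ.real A - μ.real (shortReturns T A q) :=
    sub_nonneg.2 (measureReal_mono Set.inter_subset_left)
  have h4 : q ≤ ((⌊q⌋₊ + 1 : ℕ) : ℝ) := by push_cast; exact (Nat.lt_floor_add_one q).le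
  refine (mul_le_mul_of_nonneg_right h4 h3).trans ?_
  rw [← h1]
  exact measureReal_le_one

/-- Invariance of the measure carries the almost sure lower bound on return times to all of the
countably many points of almost every orbit. -/
theorem ae_separated (hT : MeasurePreserving T μ μ) {b : ℝ}
    (h : ∀ᵐ x ∂μ, x ∈ A → ENNReal.ofReal b ≤ returnTime T A x) :
    ∀ᵐ x ∂μ, ∀ i j : ℕ, i < j → T^[i] x ∈ A → T^[j] x ∈ A → (i : ℝ) + b ≤ j := by
  have h1 : ∀ i, ∀ᵐ x ∂μ, T^[i] x ∈ A → ENNReal.ofReal b ≤ returnTime T A (T^[i] x) := fun i =>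
    (hT.iterate i).quasiMeasurePreserving.ae h
  filter_upwards [ae_all_iff.2 h1] with x hx i j hij hi hj
  have h2 := (hx i hi).trans (returnTime_iterate_le hij hj)
  rw [← ENNReal.ofReal_natCast, ENNReal.ofReal_le_ofReal_iff (Nat.cast_nonneg _),
    Nat.cast_sub hij.le] at h2
  linarith

end ReturnTimes

/-! ### Separated sets of times -/

section Separated

open Finset

/-- The times `t i`, `i ∈ L`, have gaps at least `g`. -/
def TimeSeparated (t : ℕ → ℕ) (g : ℝ) (L : Finset ℕ) : Prop :=
  ∀ i ∈ L, ∀ j ∈ L, i < j → (t i : ℝ) + g ≤ t j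

/-- Cut time into cells of length b; each contains at most one time. Cells with equal residue modulo
C + 1 are at least C + 1 apart in number, so their times differ by more than C b. The most populated
residue class is kept. -/
theorem exists_timeSeparated_subset {t : ℕ → ℕ} {b g : ℝ} (hb : 0 < b) {C : ℕ} (hC : g ≤ C * b)
    {V : Finset ℕ} (hV : TimeSeparated t b V) :
    ∃ V' ⊆ V, TimeSeparated t g V' ∧ #V ≤ (C + 1) * #V' := by
  let f : ℕ → ℕ := fun j => ⌊(t j : ℝ) / b⌋₊ % (C + 1)
  have hf : ∀ j ∈ V, f j ∈ range (C + 1) := fun j _ => mem_range.2 (Nat.mod_lt _ (by omega))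
  have h1 := Finset.card_eq_sum_card_fiberwise hf
  obtain ⟨c, -, hc⟩ : ∃ c ∈ range (C + 1), #V ≤ (C + 1) * #{j ∈ V | f j = c} := by
    by_contra! h
    have h2 : ∑ c ∈ range (C + 1), (C + 1) * #{j ∈ V | f j = c} < ∑ c ∈ range (C + 1), #V :=
      sum_lt_sum_of_nonempty ⟨0, by simp⟩ h
    rw [← mul_sum, ← h1, sum_const, card_range, smul_eq_mul] at h2
    exact lt_irrefl _ h2
  refine ⟨_, filter_subset _ _, fun i hi j hj hij => ?_, hc⟩
  obtain ⟨hiV, hic⟩ := mem_filter.1 hi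
  obtain ⟨hjV, hjc⟩ := mem_filter.1 hj
  have h2 := hV i hiV j hjV hij
  have h3 : (t i : ℝ) / b + 1 ≤ t j / b := by
    rw [← sub_nonneg] at h2 ⊢
    have : (t j : ℝ) / b - (t i / b + 1) = (t j - (t i + b)) / b := by field_simp
    rw [this]; positivity
  have h0 : (0 : ℝ) ≤ t i / b := by positivity
  have h4 : ⌊(t i : ℝ) / b⌋₊ + 1 ≤ ⌊(t j : ℝ) / b⌋₊ := by
    rw [← Nat.floor_add_one h0]; exact Nat.floor_le_floor h3
  have h5 : ⌊(t i : ℝ) / b⌋₊ + (C + 1) ≤ ⌊(t j : ℝ) / b⌋₊ := by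
    have h6 : ⌊(t i : ℝ) / b⌋₊ ≡ ⌊(t j : ℝ) / b⌋₊ [MOD C + 1] := hic.trans hjc.symm
    have h7 := (Nat.modEq_iff_dvd' (by omega)).1 h6
    have h8 := Nat.le_of_dvd (by omega) h7
    omega
  have h6 : (⌊(t i : ℝ) / b⌋₊ : ℝ) + (C + 1) ≤ t j / b :=
    le_trans (by exact_mod_cast h5) (Nat.floor_le (by positivity))
  have h7 := Nat.lt_floor_add_one ((t i : ℝ) / b)
  have h8 : (t i : ℝ) / b + C ≤ t j / b := by linarith
  have h9 : (t j : ℝ) / b - (t i / b + C) = (t j - (t i + C * b)) / b := by field_simp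
  rw [← sub_nonneg, h9] at h8
  have h10 : 0 ≤ (t j : ℝ) - (t i + C * b) := by
    by_contra! h
    exact absurd h8 (not_le.2 (div_neg_of_neg_of_pos h hb))
  linarith

open Classical in
-- Since time gaps dominate index gaps, such a set contains two indices at distance at most ⌈g⌉. It
-- is determined by the smaller one, the distance and the other n - 2 elements.
theorem card_not_timeSeparated_le {t : ℕ → ℕ} (ht : StrictMono t) {g : ℝ} {M n : ℕ} :
    #{L ∈ (Ioc 0 M).powersetCard n | ¬TimeSeparated t g L} ≤
      n * M ^ (n - 1) * ⌈g⌉₊ := by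
  have hgap : ∀ i j, i ≤ j → t i + (j - i) ≤ t j := by
    intro i j hij
    obtain ⟨e, rfl⟩ := Nat.exists_eq_add_of_le hij
    have := ht.add_le_nat e i
    rw [Nat.add_comm e i] at this
    omega
  have hex : ∀ L, ¬TimeSeparated t g L → ∃ i ∈ L, ∃ j ∈ L, i < j ∧ j - i ∈ Ioc 0 ⌈g⌉₊ := by
    intro L hL
    simp only [TimeSeparated, not_forall, not_le] at hL
    obtain ⟨i, hi, j, hj, hij, h⟩ := hL
    refine ⟨i, hi, j, hj, hij, mem_Ioc.2 ⟨by omega, ?_⟩⟩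
    have h1 : ((t i + (j - i) : ℕ) : ℝ) ≤ t j := by exact_mod_cast hgap i j hij.le
    have h2 : ((j - i : ℕ) : ℝ) ≤ ⌈g⌉₊ := by
      push_cast at h1
      have := Nat.le_ceil g
      rw [Nat.cast_sub hij.le] at h1 ⊢
      linarith
    exact_mod_cast h2
  by_cases hn : n < 2
  · rw [filter_eq_empty_iff.2]
    · simp
    · intro L hL hsep
      obtain ⟨i, hi, j, hj, hij, -⟩ := hex L hsep
      have := Finset.one_lt_card.2 ⟨i, hi, j, hj, hij.ne⟩
      have := (mem_powersetCard.1 hL).2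
      omega
  obtain ⟨n, rfl⟩ : ∃ m, n = m + 2 := ⟨n - 2, by omega⟩
  have hsub : {L ∈ (Ioc 0 M).powersetCard (n + 2) | ¬TimeSeparated t g L} ⊆
      (Ioc 0 M ×ˢ Ioc 0 ⌈g⌉₊).biUnion fun q => ((Ioc 0 M).powersetCard n).image
        fun L => insert q.1 (insert (q.1 + q.2) L) := by
    intro L hL
    obtain ⟨hL, hsep⟩ := mem_filter.1 hL
    obtain ⟨hLM, hLn⟩ := mem_powersetCard.1 hL
    obtain ⟨i, hi, j, hj, hij, h⟩ := hex L hsep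
    refine mem_biUnion.2 ⟨(i, j - i), mem_product.2 ⟨hLM hi, h⟩, mem_image.2
      ⟨(L.erase i).erase j, mem_powersetCard.2 ⟨?_, ?_⟩, ?_⟩⟩
    · exact (erase_subset _ _).trans ((erase_subset _ _).trans hLM)
    · rw [card_erase_of_mem (mem_erase.2 ⟨hij.ne', hj⟩), card_erase_of_mem hi]; omega
    · have : i + (j - i) = j := by omega
      simp only [this]
      rw [insert_erase (mem_erase.2 ⟨hij.ne', hj⟩), insert_erase hi]
  refine (card_le_card hsub).trans (card_biUnion_le.trans ?_)
  refine (Finset.sum_le_sum fun q _ => card_image_le.trans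
    ((card_powersetCard n (Ioc 0 M)).le.trans (Nat.choose_le_pow _ _))).trans ?_
  simp only [Finset.sum_const, card_product, Nat.card_Ioc, tsub_zero, smul_eq_mul]
  rw [show n + 2 - 1 = n + 1 by omega]
  calc M * ⌈g⌉₊ * M ^ n = 1 * M ^ (n + 1) * ⌈g⌉₊ := by ring
    _ ≤ (n + 2) * M ^ (n + 1) * ⌈g⌉₊ := by gcongr; omega

/-- Lets moments be bounded by counts of k-subsets, which mixing evaluates. The summand 1 covers n <
k, where the binomial coefficient vanishes. -/
theorem pow_le_mul_one_add_choose (n k : ℕ) :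
    n ^ k ≤ k ^ k * k.factorial * (1 + n.choose k) := by
  have hk : 1 ≤ k.factorial := Nat.factorial_pos k
  rcases Nat.lt_or_ge n k with h | h
  · calc n ^ k ≤ k ^ k * 1 * 1 := by simpa using Nat.pow_le_pow_left h.le k
      _ ≤ _ := by gcongr; omega
  rcases Nat.eq_zero_or_pos k with rfl | hk0
  · simp
  · have h1 := Nat.pow_sub_le_descFactorial n k
    rw [Nat.descFactorial_eq_factorial_mul_choose] at h1
    have h2 : n ≤ k * (n + 1 - k) := by
      obtain ⟨e, rfl⟩ := Nat.exists_eq_add_of_le h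
      rw [show k + e + 1 - k = e + 1 by omega]
      nlinarith [Nat.mul_le_mul_right e hk0]
    calc n ^ k ≤ (k * (n + 1 - k)) ^ k := Nat.pow_le_pow_left h2 k
      _ = k ^ k * (n + 1 - k) ^ k := mul_pow _ _ _
      _ ≤ k ^ k * (k.factorial * n.choose k) := by gcongr
      _ ≤ k ^ k * k.factorial * (1 + n.choose k) := by
        rw [mul_assoc]; gcongr; omega

end Separated

/-! ### Moments of the number of visits -/

section Moments

open Finset

variable {X : Type*}

theorem indicator_hit_eq (E : ℕ → Set X) {S L : Finset ℕ} (hL : L ⊆ S) (x : X)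
    [DecidablePred fun j => x ∈ E j] :
    (⋂ j ∈ L, E j).indicator (1 : X → ℝ) x = if L ⊆ S.filter (fun j => x ∈ E j) then 1 else 0 := by
  classical
  rw [Set.indicator_apply]
  refine if_congr ?_ rfl rfl
  simp only [Set.mem_iInter]
  exact ⟨fun h j hj => mem_filter.2 ⟨hL hj, h j hj⟩, fun h j hj => (mem_filter.1 (h hj)).2⟩

theorem sum_indicator_hit (E : ℕ → Set X) (S : Finset ℕ) (k : ℕ) (x : X)
    [DecidablePred fun j => x ∈ E j] :
    ∑ L ∈ S.powersetCard k, (⋂ j ∈ L, E j).indicator (1 : X → ℝ) x =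
      (#(S.filter fun j => x ∈ E j)).choose k := by
  rw [Finset.sum_congr rfl fun L hL => indicator_hit_eq E (mem_powersetCard.1 hL).1 x,
    ← Finset.sum_filter, Finset.sum_const, nsmul_eq_mul, mul_one, ← card_powersetCard]
  congr 2
  ext K
  simp only [mem_filter, mem_powersetCard]
  exact ⟨fun h => ⟨h.2, h.1.2⟩, fun h => ⟨⟨h.1.trans (filter_subset _ _), h.2⟩, h.1⟩⟩

open Classical in
-- Visits that are b apart can be thinned to g-separated ones at the cost of a factor C + 1, and the
-- k-subsets of what is left are all separated.
theorem pow_card_hits_le {E : ℕ → Set X} {t : ℕ → ℕ} {b g : ℝ} (hb : 0 < b) {C : ℕ}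
    (hC : g ≤ C * b) (S : Finset ℕ) (k : ℕ) {x : X}
    (hx : ∀ i j, i < j → x ∈ E i → x ∈ E j → (t i : ℝ) + b ≤ t j) :
    (#{j ∈ S | x ∈ E j} : ℝ) ^ k ≤ ((C + 1) ^ k * (k ^ k * k.factorial) : ℕ) *
      (1 + ∑ L ∈ S.powersetCard k with TimeSeparated t g L,
        (⋂ j ∈ L, E j).indicator (1 : X → ℝ) x) := by
  have hV : TimeSeparated t b {j ∈ S | x ∈ E j} := fun i hi j hj hij =>
    hx i j hij (mem_filter.1 hi).2 (mem_filter.1 hj).2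
  obtain ⟨V', hV'V, hV's, hV'c⟩ := exists_timeSeparated_subset hb hC hV
  have h1 : ((#V').choose k : ℝ) ≤ ∑ L ∈ S.powersetCard k with TimeSeparated t g L,
      (⋂ j ∈ L, E j).indicator (1 : X → ℝ) x := by
    rw [← card_powersetCard, Finset.card_eq_sum_ones, Nat.cast_sum]
    have h2 : ∀ L ∈ V'.powersetCard k, ((1 : ℕ) : ℝ) = (⋂ j ∈ L, E j).indicator (1 : X → ℝ) x := by
      intro L hL
      have h3 : L ⊆ S := ((mem_powersetCard.1 hL).1.trans hV'V).trans (filter_subset _ _)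
      rw [indicator_hit_eq E h3, if_pos ((mem_powersetCard.1 hL).1.trans hV'V), Nat.cast_one]
    rw [Finset.sum_congr rfl h2]
    refine Finset.sum_le_sum_of_subset_of_nonneg (fun L hL => ?_)
      fun L _ _ => Set.indicator_nonneg (fun _ _ => zero_le_one) x
    obtain ⟨hL1, hL2⟩ := mem_powersetCard.1 hL
    exact mem_filter.2 ⟨mem_powersetCard.2 ⟨(hL1.trans hV'V).trans (filter_subset _ _), hL2⟩,
      fun i hi j hj => hV's i (hL1 hi) j (hL1 hj)⟩
  calc (#{j ∈ S | x ∈ E j} : ℝ) ^ k ≤ ((((C + 1) * #V') ^ k : ℕ) : ℝ) := by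
        exact_mod_cast Nat.pow_le_pow_left hV'c k
    _ ≤ (((C + 1) ^ k * (k ^ k * k.factorial * (1 + (#V').choose k)) : ℕ) : ℝ) := by
        rw [mul_pow]
        exact Nat.cast_le.2 (Nat.mul_le_mul_left _ (pow_le_mul_one_add_choose _ _))
    _ = ((C + 1) ^ k * (k ^ k * k.factorial) : ℕ) * (1 + ((#V').choose k : ℝ)) := by
        push_cast; ring
    _ ≤ _ := mul_le_mul_of_nonneg_left (by linarith) (Nat.cast_nonneg _)

variable [MeasurableSpace X] {μ : Measure X} [IsProbabilityMeasure μ]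

open Classical in
-- The left side integrates the number of n-subsets of the visits over the exceptional set. This
-- number is at most the n-th power of the number of visits, which is split into its square, a
-- moment weighted by δ, and a constant on the exceptional set.
theorem sum_measureReal_compl_inter_le {E : ℕ → Set X} (hE : ∀ j, MeasurableSet (E j))
    {t : ℕ → ℕ} {b g : ℝ} (hb : 0 < b) {C : ℕ} (hC : g ≤ C * b)
    (hsep : ∀ᵐ x ∂μ, ∀ i j, i < j → x ∈ E i → x ∈ E j → (t i : ℝ) + b ≤ t j)
    (S : Finset ℕ) (n : ℕ) {W : Set X} (hW : MeasurableSet W) {δ : ℝ} (hδ : 0 < δ) :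
    ∑ L ∈ S.powersetCard n, μ.real (Wᶜ ∩ ⋂ j ∈ L, E j) ≤
      δ * (((C + 1) ^ (2 * n) * ((2 * n) ^ (2 * n) * (2 * n).factorial) : ℕ) *
        (1 + ∑ L ∈ S.powersetCard (2 * n) with TimeSeparated t g L, hitMass μ E L)) +
      μ.real Wᶜ / δ := by
  set D : ℝ := (((C + 1) ^ (2 * n) * ((2 * n) ^ (2 * n) * (2 * n).factorial) : ℕ) : ℝ) with hD
  have hi : ∀ L, Integrable ((⋂ j ∈ L, E j).indicator (1 : X → ℝ)) μ := fun L =>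
    (integrable_const 1).indicator (measurableSet_hit hE L)
  have hi2 : ∀ L, Integrable ((Wᶜ ∩ ⋂ j ∈ L, E j).indicator (1 : X → ℝ)) μ := fun L =>
    (integrable_const 1).indicator (hW.compl.inter (measurableSet_hit hE L))
  have hiW : Integrable (Wᶜ.indicator (1 : X → ℝ)) μ := (integrable_const 1).indicator hW.compl
  have e1 : ∀ L, hitMass μ E L = ∫ x, (⋂ j ∈ L, E j).indicator (1 : X → ℝ) x ∂μ := fun L =>
    (integral_indicator_one (measurableSet_hit hE L)).symm
  have e2 : ∀ L, μ.real (Wᶜ ∩ ⋂ j ∈ L, E j) =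
      ∫ x, (Wᶜ ∩ ⋂ j ∈ L, E j).indicator (1 : X → ℝ) x ∂μ := fun L =>
    (integral_indicator_one (hW.compl.inter (measurableSet_hit hE L))).symm
  have e3 : μ.real Wᶜ = ∫ x, Wᶜ.indicator (1 : X → ℝ) x ∂μ :=
    (integral_indicator_one hW.compl).symm
  have hs0 : Integrable (fun x => ∑ L ∈ S.powersetCard (2 * n) with TimeSeparated t g L,
      (⋂ j ∈ L, E j).indicator (1 : X → ℝ) x) μ := integrable_finsetSum _ fun L _ => hi L
  have hs : Integrable (fun x => 1 + ∑ L ∈ S.powersetCard (2 * n) with TimeSeparated t g L,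
      (⋂ j ∈ L, E j).indicator (1 : X → ℝ) x) μ := (integrable_const 1).add hs0
  have e4 : δ * (D * (1 + ∑ L ∈ S.powersetCard (2 * n) with TimeSeparated t g L, hitMass μ E L)) +
      μ.real Wᶜ / δ = ∫ x, (δ * (D * (1 + ∑ L ∈ S.powersetCard (2 * n) with TimeSeparated t g L,
        (⋂ j ∈ L, E j).indicator (1 : X → ℝ) x)) + δ⁻¹ * Wᶜ.indicator (1 : X → ℝ) x) ∂μ := by
    rw [integral_add ((hs.const_mul _).const_mul _)
      (hiW.const_mul _), integral_const_mul, integral_const_mul,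
      integral_add (integrable_const 1) hs0, integral_const_mul, integral_finsetSum _ fun L _ => hi L]
    simp only [← e1, ← e3, integral_const, probReal_univ, smul_eq_mul, one_mul]
    rw [div_eq_inv_mul]
  rw [e4, Finset.sum_congr rfl fun L _ => e2 L, ← integral_finsetSum _ fun L _ => hi2 L]
  refine integral_mono_ae (integrable_finsetSum _ fun L _ => hi2 L)
    (((hs.const_mul _).const_mul _).add (hiW.const_mul _)) ?_
  filter_upwards [hsep] with x hx
  have h1 := pow_card_hits_le (E := E) hb hC S (2 * n) hx
  have h0 : 0 ≤ (#{j ∈ S | x ∈ E j} : ℝ) ^ (2 * n) := by positivity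
  by_cases hxW : x ∈ Wᶜ
  · have h2 : ∑ L ∈ S.powersetCard n, (Wᶜ ∩ ⋂ j ∈ L, E j).indicator (1 : X → ℝ) x =
        (#{j ∈ S | x ∈ E j}).choose n := by
      rw [← sum_indicator_hit]
      refine Finset.sum_congr rfl fun L _ => ?_
      simp [Set.indicator_apply, hxW]
    simp only [h2, Set.indicator_of_mem hxW, Pi.one_apply, mul_one]
    have h3 : ((#{j ∈ S | x ∈ E j}).choose n : ℝ) ≤ (#{j ∈ S | x ∈ E j} : ℝ) ^ n := by
      exact_mod_cast Nat.choose_le_pow _ _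
    -- A form of Young's inequality; δ stays free, to be fixed before the exceptional set shrinks.
    have h4 : ∀ y : ℝ, y ≤ δ * y ^ 2 + δ⁻¹ := by
      intro y
      have h5 : δ * y ^ 2 + δ⁻¹ - y = δ⁻¹ * ((δ * y - 1 / 2) ^ 2 + 3 / 4) := by
        field_simp; ring
      have : 0 ≤ δ⁻¹ * ((δ * y - 1 / 2) ^ 2 + 3 / 4) := by positivity
      linarith
    have h5 := h4 ((#{j ∈ S | x ∈ E j} : ℝ) ^ n)
    rw [← pow_mul, mul_comm n 2] at h5
    have h6 := mul_le_mul_of_nonneg_left h1 hδ.le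
    linarith
  · have h2 : ∑ L ∈ S.powersetCard n, (Wᶜ ∩ ⋂ j ∈ L, E j).indicator (1 : X → ℝ) x = 0 :=
      Finset.sum_eq_zero fun L _ => Set.indicator_of_notMem (fun h => hxW h.1) _
    simp only [h2, Set.indicator_of_notMem hxW, mul_zero, add_zero]
    exact mul_nonneg hδ.le (h0.trans h1)

end Moments

/-! ### Factorization of joint visits after removing short returns -/

section KeyEstimate

open Finset

variable {X : Type*}

/-- The points whose visits to `A` along the times `t i`, `0 < i ≤ M`, are all followed by an
excursion longer than `q`. -/
def lateReturns (T : X → X) (A : Set X) (t : ℕ → ℕ) (q : ℝ) (M : ℕ) : Set X :=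
  {x | ∀ i ∈ Ioc 0 M, T^[t i] x ∉ shortReturns T A q}

variable {T : X → X} {A : Set X} {t : ℕ → ℕ}

theorem compl_lateReturns (q : ℝ) (M : ℕ) :
    (lateReturns T A t q M)ᶜ = ⋃ i ∈ Ioc 0 M, T^[t i] ⁻¹' shortReturns T A q := by
  ext x; simp [lateReturns, and_assoc]

variable [MeasurableSpace X] {μ : Measure X}

theorem measurableSet_lateReturns (hT : Measurable T) (hA : MeasurableSet A) (q : ℝ) (M : ℕ) :
    MeasurableSet (lateReturns T A t q M) := by
  rw [← MeasurableSet.compl_iff, compl_lateReturns]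
  exact Finset.measurableSet_biUnion _ fun i _ => hT.iterate _ (measurableSet_shortReturns hT hA q)

theorem measureReal_compl_lateReturns_le [IsFiniteMeasure μ] (hT : MeasurePreserving T μ μ) (hA : MeasurableSet A)
    (q : ℝ) (M : ℕ) :
    μ.real (lateReturns T A t q M)ᶜ ≤ M * μ.real (shortReturns T A q) := by
  rw [compl_lateReturns]
  refine (measureReal_biUnion_finset_le _ _).trans (le_of_eq ?_)
  have : ∀ i, μ.real (T^[t i] ⁻¹' shortReturns T A q) = μ.real (shortReturns T A q) := fun i => by
    rw [measureReal_def, (hT.iterate _).measure_preimage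
      (measurableSet_shortReturns hT.measurable hA q).nullMeasurableSet, ← measureReal_def]
  simp [this]

open Classical in
/-- The visits behave like independent trials, up to an error that is small if the mixing error
`ε`, the mixing gap `g` and the proportion of short returns are small. -/
theorem sum_abs_hitMass_sub_le [IsProbabilityMeasure μ] (hT : MeasurePreserving T μ μ) (hA : MeasurableSet A)
    (ht : StrictMono t) {b g q ε δ : ℝ} (hb : 0 < b) {C M n : ℕ} (hC : g ≤ C * b) (hgq : g ≤ q)
    (hε : 0 ≤ ε) (hδ : 0 < δ)
    (hret : ∀ᵐ x ∂μ, x ∈ A → ENNReal.ofReal b ≤ returnTime T A x)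
    (hmix : ∀ L, #L = n → TimeSeparated t g L →
      |hitMass μ (fun j => T^[t j] ⁻¹' A) L - μ.real A ^ n| ≤ ε * μ.real A ^ n)
    (hmix2 : ∀ L, #L = 2 * n → TimeSeparated t g L →
      |hitMass μ (fun j => T^[t j] ⁻¹' A) L - μ.real A ^ (2 * n)| ≤ 1 * μ.real A ^ (2 * n)) :
    ∑ L ∈ (Ioc 0 M).powersetCard n,
      |hitMass (μ.restrict (lateReturns T A t q M)) (fun j => T^[t j] ⁻¹' A) L - μ.real A ^ n| ≤
    ε * (M * μ.real A) ^ n + n * M ^ (n - 1) * ⌈g⌉₊ * μ.real A ^ n +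
      (δ * (((C + 1) ^ (2 * n) * ((2 * n) ^ (2 * n) * (2 * n).factorial) : ℕ) *
        (1 + 2 * (M * μ.real A) ^ (2 * n))) +
      M * μ.real (shortReturns T A q) / δ) := by
  set p := μ.real A with hp
  have hp0 : 0 ≤ p := measureReal_nonneg
  set W := lateReturns T A t q M with hWdef
  have hW : MeasurableSet W := measurableSet_lateReturns hT.measurable hA q M
  set E : ℕ → Set X := fun j => T^[t j] ⁻¹' A with hEdef
  have hE : ∀ j, MeasurableSet (E j) := fun j => hT.measurable.iterate _ hA
  have hsep : ∀ᵐ x ∂μ, ∀ i j, i < j → x ∈ E i → x ∈ E j → (t i : ℝ) + b ≤ t j := by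
    filter_upwards [ae_separated hT hret] with x hx i j hij hi hj
    exact hx _ _ (ht hij) hi hj
  have h1 := sum_measureReal_compl_inter_le hE hb hC hsep (Ioc 0 M) n hW hδ
  have hchoose : ∀ k, ((#((Ioc 0 M).powersetCard k) : ℕ) : ℝ) ≤ (M : ℝ) ^ k := fun k => by
    rw [card_powersetCard]
    simpa using (Nat.cast_le (α := ℝ)).2 (Nat.choose_le_pow M k)
  -- For the moment bound, mixing with relative error 1 is enough.
  have h2 : ∑ L ∈ (Ioc 0 M).powersetCard (2 * n) with TimeSeparated t g L, hitMass μ E L ≤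
      2 * (M * p) ^ (2 * n) := by
    calc ∑ L ∈ (Ioc 0 M).powersetCard (2 * n) with TimeSeparated t g L, hitMass μ E L
        ≤ ∑ L ∈ (Ioc 0 M).powersetCard (2 * n) with TimeSeparated t g L, 2 * p ^ (2 * n) := by
          refine Finset.sum_le_sum fun L hL => ?_
          obtain ⟨hL1, hL2⟩ := mem_filter.1 hL
          linarith [(abs_le.1 (hmix2 L (mem_powersetCard.1 hL1).2 hL2)).2]
      _ ≤ ∑ L ∈ (Ioc 0 M).powersetCard (2 * n), 2 * p ^ (2 * n) :=
          Finset.sum_le_sum_of_subset_of_nonneg (filter_subset _ _) fun _ _ _ => by positivity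
      _ = #((Ioc 0 M).powersetCard (2 * n)) * (2 * p ^ (2 * n)) := by
          rw [Finset.sum_const, nsmul_eq_mul]
      _ ≤ M ^ (2 * n) * (2 * p ^ (2 * n)) :=
          mul_le_mul_of_nonneg_right (hchoose _) (by positivity)
      _ = _ := by rw [mul_pow]; ring
  have h3 : ∀ L, hitMass (μ.restrict W) E L = hitMass μ E L - μ.real (Wᶜ ∩ ⋂ j ∈ L, E j) := by
    intro L
    rw [hitMass, hitMass, measureReal_restrict_apply (measurableSet_hit hE L),
      ← measureReal_inter_add_sdiff (s := ⋂ j ∈ L, E j) hW, Set.sdiff_eq, Set.inter_comm Wᶜ]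
    ring
  have hsum : ∑ L ∈ (Ioc 0 M).powersetCard n with TimeSeparated t g L, ε * p ^ n ≤
      ε * (M * p) ^ n := by
    rw [Finset.sum_const, nsmul_eq_mul, mul_pow]
    calc _ ≤ (M : ℝ) ^ n * (ε * p ^ n) := mul_le_mul_of_nonneg_right
          ((Nat.cast_le.2 (card_filter_le _ _)).trans (hchoose n)) (by positivity)
      _ = _ := by ring
  have h5 : ∀ L ∈ (Ioc 0 M).powersetCard n, |hitMass (μ.restrict W) E L - p ^ n| ≤
      (if TimeSeparated t g L then ε * p ^ n else p ^ n) + μ.real (Wᶜ ∩ ⋂ j ∈ L, E j) := by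
    intro L hL
    obtain ⟨hLM, hLn⟩ := mem_powersetCard.1 hL
    split_ifs with h
    · rw [h3, abs_le]
      have h6 := abs_le.1 (hmix L hLn h)
      have h7 : 0 ≤ μ.real (Wᶜ ∩ ⋂ j ∈ L, E j) := measureReal_nonneg
      constructor <;> linarith [h6.1, h6.2]
    -- On W two visits are more than q ≥ g apart, so a set with a close pair carries no mass and its
    -- whole error is p ^ n.
    · have h6 : hitMass (μ.restrict W) E L = 0 := by
        rw [hitMass, measureReal_restrict_apply (measurableSet_hit hE L)]
        convert measureReal_empty (μ := μ)
        rw [Set.eq_empty_iff_forall_notMem]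
        rintro x ⟨hx, hxW⟩
        simp only [Set.mem_iInter] at hx
        refine h fun i hi j hj hij => ?_
        have := add_lt_of_notMem_shortReturns (ht hij) (hx i hi) (hx j hj) (hxW i (hLM hi))
        linarith
      rw [h6, zero_sub, abs_neg, abs_of_nonneg (by positivity)]
      linarith [measureReal_nonneg (μ := μ) (s := Wᶜ ∩ ⋂ j ∈ L, E j)]
  refine (Finset.sum_le_sum h5).trans ?_
  rw [Finset.sum_add_distrib, Finset.sum_ite]
  refine add_le_add (add_le_add hsum ?_) (h1.trans (add_le_add ?_ ?_))
  · rw [Finset.sum_const, nsmul_eq_mul]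
    refine mul_le_mul_of_nonneg_right ?_ (by positivity)
    exact_mod_cast card_not_timeSeparated_le ht
  · refine mul_le_mul_of_nonneg_left (mul_le_mul_of_nonneg_left ?_ (Nat.cast_nonneg _)) hδ.le
    linarith
  · exact div_le_div_of_nonneg_right (measureReal_compl_lateReturns_le hT hA q M) hδ.le

end KeyEstimate

/-! ### Passage to small radii -/

section Limits

open Finset

variable {X : Type*} [MeasurableSpace X] {μ : Measure X} {T : X → X}
  {B : ℝ → Set X} {ξ : ℝ → ℝ}

theorem tendsto_abs_log_nhdsGT_zero : Tendsto (fun r : ℝ => |Real.log r|) (𝓝[>] 0) atTop :=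
  tendsto_abs_atBot_atTop.comp Real.tendsto_log_nhdsGT_zero

theorem tendsto_shortReturns_div (hB : ∀ r, MeasurableSet (B r))
    (hcond : Tendsto (fun r : ℝ => (ProbabilityTheory.cond μ (B r))
      {x | returnTime T (B r) x ≤ ENNReal.ofReal (ξ r)}) (𝓝[>] 0) (𝓝 0)) :
    Tendsto (fun r => μ.real (shortReturns T (B r) (ξ r)) / μ.real (B r)) (𝓝[>] 0) (𝓝 0) := by
  have h := (ENNReal.tendsto_toReal ENNReal.zero_ne_top).comp hcond
  refine h.congr fun r => ?_
  simp only [Function.comp_apply, cond_apply (hB r), ENNReal.toReal_mul, ENNReal.toReal_inv]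
  rw [div_eq_inv_mul]
  rfl

/-- Eventually at least half of the ball does not return before ξ(r), and the preimages of that part
are disjoint for about ξ(r) steps. Hence the measure of the ball times ξ(r) is at most 2, while |log
r| is negligible against ξ(r). -/
theorem tendsto_measureReal_mul_abs_log [IsProbabilityMeasure μ] (hT : MeasurePreserving T μ μ)
    (hB : ∀ r, MeasurableSet (B r)) (hp : ∀ᶠ r in 𝓝[>] 0, 0 < μ.real (B r))
    (hξ0 : ∀ r, 0 < r → 0 < ξ r) (hξ : (fun r : ℝ => |Real.log r|) =o[𝓝[>] 0] ξ)
    (hshort : Tendsto (fun r => μ.real (shortReturns T (B r) (ξ r)) / μ.real (B r))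
      (𝓝[>] 0) (𝓝 0)) :
    Tendsto (fun r => μ.real (B r) * |Real.log r|) (𝓝[>] 0) (𝓝 0) := by
  rw [Metric.tendsto_nhds]
  intro ε hε
  filter_upwards [hp, hshort.eventually_le_const (show (0 : ℝ) < 1 / 2 by norm_num),
    hξ.def (show 0 < ε / 4 by positivity), self_mem_nhdsWithin] with r hr0 hr1 hr2 hr3
  have hξr := hξ0 r hr3
  rw [div_le_iff₀ hr0] at hr1
  rw [Real.norm_of_nonneg (abs_nonneg _), Real.norm_of_nonneg hξr.le] at hr2
  have h1 := mul_measureReal_sub_le_one hT (hB r) hξr.le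
  have h2 : ξ r * μ.real (B r) ≤ 2 := by nlinarith
  rw [Real.dist_eq, sub_zero, abs_of_nonneg (by positivity)]
  calc μ.real (B r) * |Real.log r| ≤ μ.real (B r) * (ε / 4 * ξ r) := by gcongr
    _ = ε / 4 * (ξ r * μ.real (B r)) := by ring
    _ ≤ ε / 4 * 2 := by gcongr
    _ < ε := by linarith

theorem tendsto_measureReal_of_mul_abs_log
    (h : Tendsto (fun r => μ.real (B r) * |Real.log r|) (𝓝[>] 0) (𝓝 0)) :
    Tendsto (fun r => μ.real (B r)) (𝓝[>] 0) (𝓝 0) := by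
  refine squeeze_zero' (Eventually.of_forall fun r => measureReal_nonneg) ?_ h
  filter_upwards [tendsto_abs_log_nhdsGT_zero.eventually_ge_atTop 1] with r hr
  exact le_mul_of_one_le_right measureReal_nonneg hr

theorem hitMass_eq_of_card {A : Set X} {t : ℕ → ℕ} {L : Finset ℕ} {n : ℕ} (hL : #L = n) :
    hitMass μ (fun j => T^[t j] ⁻¹' A) L =
      μ.real {x | ∀ i, T^[t (L.orderEmbOfFin hL i)] x ∈ A} := by
  rw [hitMass]
  congr 1
  ext x
  simp only [Set.mem_iInter, Set.mem_preimage, Set.mem_ofPred_eq]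
  constructor
  · exact fun h i => h _ (orderEmbOfFin_mem L hL i)
  · intro h j hj
    have : j ∈ Set.range (L.orderEmbOfFin hL) := by rw [range_orderEmbOfFin]; exact hj
    obtain ⟨i, rfl⟩ := this
    exact h i

/-- The freedom to enlarge the constant lets a single gap serve the orders n and 2 n simultaneously.
-/
theorem LogMixing.hitMass (h : LogMixing μ T B) (n : ℕ) :
    ∃ K : ℝ, 0 < K ∧ ∀ K' ≥ K, ∀ ε > 0, ∀ᶠ r : ℝ in 𝓝[>] 0, ∀ (t : ℕ → ℕ) (L : Finset ℕ),
      #L = n → TimeSeparated t (K' * |Real.log r|) L →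
      |hitMass μ (fun j => T^[t j] ⁻¹' B r) L - μ.real (B r) ^ n| ≤ ε * μ.real (B r) ^ n := by
  obtain ⟨K, hK, h⟩ := h n
  refine ⟨K, hK, fun K' hK' ε hε => (h ε hε).mono fun r hr t L hL hsep => ?_⟩
  rw [hitMass_eq_of_card hL]
  refine hr _ fun i j hij => le_trans ?_ (hsep _ (orderEmbOfFin_mem L hL i) _
    (orderEmbOfFin_mem L hL j) ((L.orderEmbOfFin hL).strictMono hij))
  gcongr

/-- The error in the factorization of the multiple hits tends to zero. -/
theorem tendsto_sum_abs_hitMass_sub [IsProbabilityMeasure μ]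
    (hT : MeasurePreserving T μ μ) (hB : ∀ r, MeasurableSet (B r))
    (hp : ∀ᶠ r in 𝓝[>] 0, 0 < μ.real (B r)) (hmix : LogMixing μ T B)
    {a : ℝ} (ha : 0 < a) (hLR : ∀ᶠ r : ℝ in 𝓝[>] 0, ∀ᵐ x ∂μ, x ∈ B r →
      ENNReal.ofReal (a * |Real.log r|) ≤ returnTime T (B r) x)
    (hξ0 : ∀ r, 0 < r → 0 < ξ r) (hξ : (fun r : ℝ => |Real.log r|) =o[𝓝[>] 0] ξ)
    (hshort : Tendsto (fun r => μ.real (shortReturns T (B r) (ξ r)) / μ.real (B r))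
      (𝓝[>] 0) (𝓝 0))
    {t : ℕ → ℕ} (ht : StrictMono t) {τ : ℝ} (hτ : 0 ≤ τ) (n : ℕ) :
    Tendsto (fun r => ∑ L ∈ (Ioc 0 ⌊τ / μ.real (B r)⌋₊).powersetCard n,
      |DelayedPoisson.hitMass (μ.restrict (lateReturns T (B r) t (ξ r) ⌊τ / μ.real (B r)⌋₊))
        (fun j => T^[t j] ⁻¹' B r) L - μ.real (B r) ^ n|) (𝓝[>] 0) (𝓝 0) := by
  obtain ⟨K₁, hK₁, h1⟩ := hmix.hitMass n
  obtain ⟨K₂, -, h2⟩ := hmix.hitMass (2 * n)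
  set K := max K₁ K₂ with hK
  have hK0 : 0 < K := lt_max_of_lt_left hK₁
  -- C recurrence gaps a |log r| cover one mixing gap K |log r|.
  set C := ⌈K / a⌉₊ with hC
  set D : ℝ := (((C + 1) ^ (2 * n) * ((2 * n) ^ (2 * n) * (2 * n).factorial) : ℕ) : ℝ) with hD
  have hplog := tendsto_measureReal_mul_abs_log hT hB hp hξ0 hξ hshort
  have hp0 := tendsto_measureReal_of_mul_abs_log hplog
  rw [Metric.tendsto_nhds]
  intro ε₀ hε₀
  -- ε and δ are fixed before r, using only that M p ≤ τ. The terms from close pairs and from short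
  -- returns then tend to zero by `hlim`.
  obtain ⟨ε, hε, hε'⟩ : ∃ ε > 0, ε * τ ^ n ≤ ε₀ / 3 :=
    ⟨ε₀ / 3 / (τ ^ n + 1), by positivity, by
      rw [div_mul_eq_mul_div, div_le_iff₀ (by positivity)]
      exact mul_le_mul_of_nonneg_left (by linarith) (by positivity)⟩
  obtain ⟨δ, hδ, hδ'⟩ : ∃ δ > 0, δ * (D * (1 + 2 * τ ^ (2 * n))) ≤ ε₀ / 3 :=
    ⟨ε₀ / 3 / (D * (1 + 2 * τ ^ (2 * n)) + 1), by positivity, by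
      rw [div_mul_eq_mul_div, div_le_iff₀ (by positivity)]
      exact mul_le_mul_of_nonneg_left (by linarith) (by positivity)⟩
  have hlim : Tendsto (fun r => n * τ ^ (n - 1) * (K * (μ.real (B r) * |Real.log r|) + μ.real (B r))
      + τ / δ * (μ.real (shortReturns T (B r) (ξ r)) / μ.real (B r))) (𝓝[>] 0) (𝓝 0) := by
    have := (((hplog.const_mul K).add hp0).const_mul (n * τ ^ (n - 1))).add
      (hshort.const_mul (τ / δ))
    simpa using this
  filter_upwards [hp, hLR, h1 K (le_max_left _ _) ε hε, h2 K (le_max_right _ _) 1 one_pos,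
    hlim.eventually_lt_const (show 0 < ε₀ / 3 by positivity), hξ.def (inv_pos.2 hK0),
    self_mem_nhdsWithin, tendsto_abs_log_nhdsGT_zero.eventually_gt_atTop 0]
    with r hr0 hr1 hr2 hr3 hr4 hr5 hr6 hr7
  set p := μ.real (B r) with hpdef
  set M := ⌊τ / p⌋₊ with hM
  have hMp : M * p ≤ τ := by
    have := Nat.floor_le (div_nonneg hτ hr0.le)
    rwa [le_div_iff₀ hr0] at this
  have hCK : K * |Real.log r| ≤ C * (a * |Real.log r|) := by
    rw [← mul_assoc]
    refine mul_le_mul_of_nonneg_right ?_ (abs_nonneg _)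
    rw [← div_le_iff₀ ha]
    exact Nat.le_ceil _
  have hKξ : K * |Real.log r| ≤ ξ r := by
    rw [Real.norm_of_nonneg (abs_nonneg _), Real.norm_of_nonneg (hξ0 r hr6).le,
      inv_mul_eq_div, le_div_iff₀ hK0] at hr5
    linarith
  have key := sum_abs_hitMass_sub_le hT (hB r) ht (mul_pos ha hr7) (M := M) (n := n) hCK hKξ hε.le
    hδ hr1 (hr2 t) (hr3 t)
  rw [← hpdef, ← hD] at key
  have hMp0 : 0 ≤ M * p := by positivity
  have b1 : ε * (M * p) ^ n ≤ ε₀ / 3 := le_trans (by gcongr) hε'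
  have b2 : δ * (D * (1 + 2 * (M * p) ^ (2 * n))) ≤ ε₀ / 3 := le_trans (by gcongr) hδ'
  have b3 : n * (M : ℝ) ^ (n - 1) * ⌈K * |Real.log r|⌉₊ * p ^ n ≤
      n * τ ^ (n - 1) * (K * (p * |Real.log r|) + p) := by
    rcases Nat.eq_zero_or_pos n with rfl | hn
    · simp
    have h3 : p ^ n = p ^ (n - 1) * p := by rw [← pow_succ]; congr 1; omega
    have h4 := (Nat.ceil_lt_add_one (show 0 ≤ K * |Real.log r| by positivity)).le
    calc n * (M : ℝ) ^ (n - 1) * ⌈K * |Real.log r|⌉₊ * p ^ n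
        = n * (M * p) ^ (n - 1) * (⌈K * |Real.log r|⌉₊ * p) := by rw [h3, mul_pow]; ring
      _ ≤ n * τ ^ (n - 1) * ((K * |Real.log r| + 1) * p) := by gcongr
      _ = _ := by ring
  have b4 : M * μ.real (shortReturns T (B r) (ξ r)) / δ ≤
      τ / δ * (μ.real (shortReturns T (B r) (ξ r)) / p) := by
    rw [div_mul_div_comm, mul_comm δ p, ← div_div]
    refine div_le_div_of_nonneg_right ?_ hδ.le
    rw [le_div_iff₀ hr0]
    nlinarith [measureReal_nonneg (μ := μ) (s := shortReturns T (B r) (ξ r))]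
  rw [Real.dist_eq, sub_zero, abs_of_nonneg (sum_nonneg fun _ _ => abs_nonneg _)]
  linarith

/-- The visits form, in the limit, Bernoulli trials. -/
theorem tendsto_sum_abs_patternMass_sub [IsProbabilityMeasure μ]
    (hT : MeasurePreserving T μ μ)
    (hB : ∀ r, MeasurableSet (B r))
    (hp : ∀ᶠ r in 𝓝[>] 0, 0 < μ.real (B r)) (hmix : LogMixing μ T B)
    {a : ℝ} (ha : 0 < a) (hLR : ∀ᶠ r : ℝ in 𝓝[>] 0, ∀ᵐ x ∂μ, x ∈ B r →
      ENNReal.ofReal (a * |Real.log r|) ≤ returnTime T (B r) x)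
    (hξ0 : ∀ r, 0 < r → 0 < ξ r) (hξ : (fun r : ℝ => |Real.log r|) =o[𝓝[>] 0] ξ)
    (hshort : Tendsto (fun r => μ.real (shortReturns T (B r) (ξ r)) / μ.real (B r))
      (𝓝[>] 0) (𝓝 0))
    {t : ℕ → ℕ} (ht : StrictMono t) {τ : ℝ} (hτ : 0 ≤ τ) (n : ℕ) :
    Tendsto (fun r => ∑ I ∈ (Ioc 0 ⌊τ / μ.real (B r)⌋₊).powersetCard n,
      |patternMass (μ.restrict (lateReturns T (B r) t (ξ r) ⌊τ / μ.real (B r)⌋₊))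
        (fun j => T^[t j] ⁻¹' B r) (Ioc 0 (I.sup id)) I -
        μ.real (B r) ^ n * (1 - μ.real (B r)) ^ (I.sup id - n)|) (𝓝[>] 0) (𝓝 0) := by
  have hΔ := tendsto_sum_abs_hitMass_sub hT hB hp hmix ha hLR hξ0 hξ hshort ht hτ
  rw [Metric.tendsto_nhds]
  intro ε hε
  -- The truncation order is chosen first: uniformly in r the Bernoulli remainder is at most 2 τ ^
  -- (n + m) / (n! m!). Only finitely many orders are then left in the limit.
  obtain ⟨m, hm⟩ : ∃ m : ℕ, 2 * τ ^ n / n.factorial * (τ ^ m / m.factorial) < ε / 2 := by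
    have := (FloorSemiring.tendsto_pow_div_factorial_atTop τ).const_mul (2 * τ ^ n / n.factorial)
    rw [mul_zero] at this
    exact (this.eventually_lt_const (by positivity)).exists
  have hlim := (tendsto_finsetSum (range m) fun i _ =>
    (hΔ (n + i)).const_mul ((n + i).choose n : ℝ)).add ((hΔ (n + m)).const_mul ((n + m).choose n : ℝ))
  simp only [mul_zero, sum_const_zero, add_zero] at hlim
  filter_upwards [hp, hlim.eventually_lt_const (show 0 < ε / 2 by positivity)] with r hr0 hr1
  set p := μ.real (B r) with hpdef
  set M := ⌊τ / p⌋₊ with hM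
  have hMp : M * p ≤ τ := by
    have := Nat.floor_le (div_nonneg hτ hr0.le)
    rwa [le_div_iff₀ hr0] at this
  have key := sum_abs_patternMass_sub_le (ν := μ.restrict (lateReturns T (B r) t (ξ r) M))
    (E := fun j => T^[t j] ⁻¹' B r) (fun j => hT.measurable.iterate _ (hB r)) hr0.le
    (measureReal_le_one (μ := μ)) M n m
  have h1 : ((n + m).choose n : ℝ) * (2 * (M.choose (n + m) * p ^ (n + m))) ≤
      2 * τ ^ n / n.factorial * (τ ^ m / m.factorial) := by
    have h2 : (M.choose (n + m) : ℝ) ≤ M ^ (n + m) / (n + m).factorial :=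
      Nat.choose_le_pow_div (n + m) M
    have h3 : ((n + m).choose n : ℝ) * n.factorial * m.factorial = (n + m).factorial := by
      have := Nat.choose_mul_factorial_mul_factorial (Nat.le_add_right n m)
      rw [Nat.add_sub_cancel_left] at this
      exact_mod_cast this
    have h4 : ((n + m).choose n : ℝ) = (n + m).factorial / (n.factorial * m.factorial) := by
      rw [eq_div_iff (by positivity), ← mul_assoc, h3]
    calc ((n + m).choose n : ℝ) * (2 * (M.choose (n + m) * p ^ (n + m)))
        ≤ ((n + m).choose n : ℝ) * (2 * (M ^ (n + m) / (n + m).factorial * p ^ (n + m))) := by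
          gcongr
      _ = 2 * (M * p) ^ (n + m) / (n.factorial * m.factorial) := by
          rw [h4, mul_pow]; field_simp
      _ ≤ 2 * τ ^ (n + m) / (n.factorial * m.factorial) := by gcongr
      _ = _ := by rw [pow_add]; field_simp
  rw [Real.dist_eq, sub_zero, abs_of_nonneg (sum_nonneg fun _ _ => abs_nonneg _)]
  rw [mul_add] at key
  linarith

end Limits

/-! ### Delayed returns as visit patterns -/

section DelayedHits

open Finset

theorem iInf_natCast_eq_find (P : ℕ → Prop) [DecidablePred P] (h : ∃ j, P j) :
    (⨅ (j : ℕ) (_ : P j), (j : ℝ≥0∞)) = (Nat.find h : ℕ) :=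
  le_antisymm (iInf₂_le _ (Nat.find_spec h))
    (le_iInf₂ fun _ hj => Nat.cast_le.2 (Nat.find_min' h hj))

theorem iInf_natCast_eq_top (P : ℕ → Prop) (h : ¬∃ j, P j) :
    (⨅ (j : ℕ) (_ : P j), (j : ℝ≥0∞)) = ⊤ := by
  simp only [not_exists] at h
  simp [h]

theorem iInf_natCast_eq_iff (P : ℕ → Prop) (m : ℕ) :
    (⨅ (j : ℕ) (_ : P j), (j : ℝ≥0∞)) = m ↔ P m ∧ ∀ j < m, ¬P j := by
  classical
  by_cases h : ∃ j, P j
  · rw [iInf_natCast_eq_find P h, Nat.cast_inj, Nat.find_eq_iff]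
  · rw [iInf_natCast_eq_top P h]
    exact ⟨fun h' => absurd h'.symm (ENNReal.natCast_ne_top m), fun h' => (h ⟨m, h'.1⟩).elim⟩

variable {X : Type*} {T : X → X} {α : ℕ → ℕ} {A : Set X} {x : X}

theorem delayedHit_eq_natCast {n : ℕ} (h : delayedHit T α A x n ≠ ⊤) :
    ∃ m : ℕ, delayedHit T α A x n = m := by
  classical
  cases n with
  | zero => exact ⟨0, by simp [delayedHit]⟩
  | succ n =>
    rw [delayedHit] at h ⊢
    by_cases h' : ∃ j : ℕ, delayedHit T α A x n < j ∧ T^[delayedTime α j] x ∈ A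
    · exact ⟨_, iInf_natCast_eq_find _ h'⟩
    · exact absurd (iInf_natCast_eq_top _ h') h

theorem delayedHit_le_succ (n : ℕ) : delayedHit T α A x n ≤ delayedHit T α A x (n + 1) := by
  rw [delayedHit]
  exact le_iInf₂ fun j hj => hj.1.le

theorem delayedHit_succ_eq_iff {n m : ℕ} (h : delayedHit T α A x n = m) (m' : ℕ) :
    delayedHit T α A x (n + 1) = m' ↔ m < m' ∧ T^[delayedTime α m'] x ∈ A ∧
      ∀ j, m < j → j < m' → T^[delayedTime α j] x ∉ A := by
  rw [delayedHit, iInf_natCast_eq_iff, h]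
  simp only [Nat.cast_lt, and_assoc, not_and]
  exact and_congr_right fun _ => and_congr_right fun _ =>
    ⟨fun h j h1 h2 => h j h2 h1, fun h j h1 h2 => h j h2 h1⟩

theorem delayedReturn_eq_iff {n m : ℕ} (h : delayedHit T α A x n = m) (g : ℕ) :
    delayedReturn T α A x n = g ↔ delayedHit T α A x (n + 1) = ((m + g : ℕ) : ℝ≥0∞) := by
  rw [delayedReturn]
  split_ifs with h'
  · rw [h']
    exact ⟨fun h => absurd h.symm (ENNReal.natCast_ne_top _),
      fun h => absurd h.symm (ENNReal.natCast_ne_top _)⟩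
  · rw [h]
    have h1 := delayedHit_le_succ (T := T) (α := α) (A := A) (x := x) n
    rw [h] at h1
    obtain ⟨m', hm'⟩ := delayedHit_eq_natCast h'
    rw [hm'] at h1 ⊢
    rw [← ENNReal.natCast_sub, Nat.cast_inj, Nat.cast_inj]
    have := Nat.cast_le.1 h1
    omega

theorem delayedReturn_eq_natCast {n : ℕ} (h : delayedReturn T α A x n ≠ ⊤) :
    ∃ g : ℕ, delayedReturn T α A x n = g := by
  rw [delayedReturn] at h ⊢
  split_ifs at h ⊢ with h'
  · exact absurd rfl h
  obtain ⟨m', hm'⟩ := delayedHit_eq_natCast h'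
  have h1 := delayedHit_le_succ (T := T) (α := α) (A := A) (x := x) n
  rw [hm'] at h1
  obtain ⟨m, hm⟩ := delayedHit_eq_natCast (ne_top_of_le_ne_top (ENNReal.natCast_ne_top m') h1)
  exact ⟨m' - m, by rw [hm, hm', ENNReal.natCast_sub]⟩

theorem delayedHit_of_delayedReturn {g : ℕ → ℕ} {n : ℕ}
    (h : ∀ i < n, delayedReturn T α A x i = g i) :
    delayedHit T α A x n = ((∑ i ∈ range n, g i : ℕ) : ℝ≥0∞) := by
  induction n with
  | zero => simp [delayedHit]
  | succ n ih =>
    rw [Finset.sum_range_succ, ← delayedReturn_eq_iff (ih fun i hi => h i (by omega))]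
    exact h n (by omega)

/-- The indices of the first `n` visits, if the returns are `g 0, g 1, …`. -/
def visitIndices (g : ℕ → ℕ) (n : ℕ) : Finset ℕ :=
  (range n).image fun i => ∑ k ∈ range (i + 1), g k

theorem sum_range_mono (g : ℕ → ℕ) : Monotone fun n => ∑ i ∈ range n, g i := fun _ _ h =>
  Finset.sum_le_sum_of_subset (range_subset_range.2 h)

theorem le_of_mem_visitIndices {g : ℕ → ℕ} {n j : ℕ} (h : j ∈ visitIndices g n) :
    j ≤ ∑ i ∈ range n, g i := by
  obtain ⟨i, hi, rfl⟩ := mem_image.1 h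
  exact sum_range_mono g (by simpa using hi)

theorem mem_visitIndices_succ {g : ℕ → ℕ} {n j : ℕ} :
    j ∈ visitIndices g (n + 1) ↔ j ∈ visitIndices g n ∨ j = ∑ i ∈ range (n + 1), g i := by
  rw [visitIndices, range_add_one, image_insert, mem_insert, or_comm, ← range_add_one]
  rfl

theorem sup_visitIndices (g : ℕ → ℕ) (n : ℕ) :
    (visitIndices g n).sup id = ∑ i ∈ range n, g i := by
  refine le_antisymm (Finset.sup_le fun j hj => le_of_mem_visitIndices hj) ?_
  cases n with
  | zero => simp
  | succ n => exact Finset.le_sup (f := id) (mem_visitIndices_succ.2 (Or.inr rfl))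

theorem sum_range_lt {g : ℕ → ℕ} {n : ℕ} (hg : ∀ i < n, 1 ≤ g i) {i j : ℕ} (hij : i < j)
    (hj : j ≤ n) : ∑ k ∈ range i, g k < ∑ k ∈ range j, g k := by
  calc ∑ k ∈ range i, g k < ∑ k ∈ range (i + 1), g k := by
        rw [Finset.sum_range_succ]; have := hg i (by omega); omega
    _ ≤ _ := sum_range_mono g hij

theorem visitIndices_mem_powersetCard {g : ℕ → ℕ} {n M : ℕ} (hg : ∀ i < n, 1 ≤ g i)
    (hM : ∑ i ∈ range n, g i ≤ M) : visitIndices g n ∈ (Ioc 0 M).powersetCard n := by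
  refine mem_powersetCard.2 ⟨fun j hj => mem_Ioc.2 ⟨?_, (le_of_mem_visitIndices hj).trans hM⟩, ?_⟩
  · obtain ⟨i, hi, rfl⟩ := mem_image.1 hj
    simpa using sum_range_lt hg (Nat.succ_pos i) (Nat.succ_le_of_lt (mem_range.1 hi))
  · rw [visitIndices, card_image_of_injOn, card_range]
    intro i hi j hj hij
    have hi' : i < n := by simpa using hi
    have hj' : j < n := by simpa using hj
    by_contra hne
    rcases lt_or_gt_of_ne hne with h | h
    · exact (sum_range_lt hg (Nat.succ_lt_succ h) hj').ne hij
    · exact (sum_range_lt hg (Nat.succ_lt_succ h) hi').ne' hij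

/-- The partial sums are the increasing enumeration of the set of visits, so the set determines them
and hence the returns. -/
theorem eq_of_visitIndices_eq {g g' : ℕ → ℕ} {n : ℕ} (hg : ∀ i < n, 1 ≤ g i)
    (hg' : ∀ i < n, 1 ≤ g' i) (h : visitIndices g n = visitIndices g' n) :
    ∀ i < n, g i = g' i := by
  have key : ∀ f : ℕ → ℕ, (∀ i < n, 1 ≤ f i) → ∀ hc : #(visitIndices f n) = n,
      (fun i : Fin n => ∑ k ∈ range (i + 1), f k) = (visitIndices f n).orderEmbOfFin hc :=
    fun f hf hc => orderEmbOfFin_unique hc (fun i => mem_image.2 ⟨i, by simp, rfl⟩)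
      fun i j hij => sum_range_lt hf (Nat.succ_lt_succ hij) j.2
  have hc := (mem_powersetCard.1 (visitIndices_mem_powersetCard hg le_rfl)).2
  have hc' := (mem_powersetCard.1 (visitIndices_mem_powersetCard hg' le_rfl)).2
  have h1 : ∀ i : Fin n, ∑ k ∈ range (i + 1), g k = ∑ k ∈ range (i + 1), g' k := by
    intro i
    have h2 := congrFun (key g hg hc) i
    have h3 := congrFun (key g' hg' hc') i
    simp only [← h] at h3
    exact h2.trans h3.symm
  have h2 : ∀ i ≤ n, ∑ k ∈ range i, g k = ∑ k ∈ range i, g' k := by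
    intro i hi
    cases i with
    | zero => simp
    | succ i => exact h1 ⟨i, hi⟩
  intro i hi
  have h3 := h2 (i + 1) hi
  rw [Finset.sum_range_succ, Finset.sum_range_succ, h2 i hi.le] at h3
  omega

/-- Prescribing one more return means prescribing a visit at the next partial sum and none strictly
between it and the previous one. -/
theorem delayedReturn_eq_iff_pattern {g : ℕ → ℕ} {n : ℕ} (hg : ∀ i < n, 1 ≤ g i) :
    (∀ i < n, delayedReturn T α A x i = g i) ↔ ∀ j ∈ Ioc 0 (∑ i ∈ range n, g i),
      (x ∈ T^[delayedTime α j] ⁻¹' A ↔ j ∈ visitIndices g n) := by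
  simp only [Set.mem_preimage, mem_Ioc]
  induction n with
  | zero =>
    simp only [range_zero, Finset.sum_empty]
    exact ⟨fun _ j hj => by omega, fun _ i hi => by omega⟩
  | succ n ih =>
    have ih := ih fun i hi => hg i (by omega)
    have hlt : ∑ i ∈ range n, g i < ∑ i ∈ range (n + 1), g i := sum_range_lt hg (Nat.lt_succ_self n) le_rfl
    have h1 : (∀ i < n + 1, delayedReturn T α A x i = g i) ↔
        (∀ i < n, delayedReturn T α A x i = g i) ∧
          T^[delayedTime α (∑ i ∈ range (n + 1), g i)] x ∈ A ∧
          ∀ j, ∑ i ∈ range n, g i < j → j < ∑ i ∈ range (n + 1), g i →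
            T^[delayedTime α j] x ∉ A := by
      have h2 : (∀ i < n + 1, delayedReturn T α A x i = g i) ↔
          (∀ i < n, delayedReturn T α A x i = g i) ∧ delayedReturn T α A x n = g n :=
        Nat.forall_lt_succ_right
      rw [h2]
      refine and_congr_right fun h => ?_
      rw [delayedReturn_eq_iff (delayedHit_of_delayedReturn h),
        delayedHit_succ_eq_iff (delayedHit_of_delayedReturn h), ← Finset.sum_range_succ]
      exact ⟨fun h => h.2, fun h => ⟨hlt, h⟩⟩
    rw [h1, ih]
    constructor
    · rintro ⟨h2, h3, h4⟩ j ⟨hj0, hj⟩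
      rw [mem_visitIndices_succ]
      rcases Nat.lt_or_ge (∑ i ∈ range n, g i) j with h | h
      · rcases hj.lt_or_eq with h5 | h5
        · refine ⟨fun h6 => (h4 j h h5 h6).elim, fun h6 => ?_⟩
          rcases h6 with h6 | h6
          · exact absurd (le_of_mem_visitIndices h6) (by omega)
          · omega
        · rw [h5]
          exact ⟨fun _ => Or.inr rfl, fun _ => h3⟩
      · rw [h2 j ⟨hj0, h⟩]
        exact ⟨Or.inl, fun h6 => h6.resolve_right (by omega)⟩
    · intro h
      refine ⟨fun j hj => ?_, ?_, fun j hj1 hj2 hj => ?_⟩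
      · rw [h j ⟨hj.1, hj.2.trans hlt.le⟩, mem_visitIndices_succ]
        exact ⟨fun h6 => h6.resolve_right (by omega), Or.inl⟩
      · exact (h _ ⟨by omega, le_rfl⟩).2 (mem_visitIndices_succ.2 (Or.inr rfl))
      · rcases mem_visitIndices_succ.1 ((h j ⟨by omega, hj2.le⟩).1 hj) with h6 | h6
        · exact absurd (le_of_mem_visitIndices h6) (by omega)
        · omega

variable [MeasurableSpace X]

theorem measurable_delayedHit (hT : Measurable T) (hA : MeasurableSet A) (n : ℕ) :
    Measurable fun x => delayedHit T α A x n := by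
  classical
  induction n with
  | zero => exact measurable_const
  | succ n ih =>
    simp only [delayedHit]
    refine Measurable.iInf fun j => ?_
    simp only [iInf_eq_if]
    exact Measurable.ite ((measurableSet_lt ih measurable_const).inter (hT.iterate _ hA))
      measurable_const measurable_const

theorem measurable_delayedReturn (hT : Measurable T) (hA : MeasurableSet A) (n : ℕ) :
    Measurable fun x => delayedReturn T α A x n := by
  simp only [delayedReturn]
  exact Measurable.ite (measurable_delayedHit hT hA _ (measurableSet_singleton _))
    measurable_const ((measurable_delayedHit hT hA _).sub (measurable_delayedHit hT hA _))

/-- The geometric waiting time of Bernoulli trials, summed over an interval by telescoping. -/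
theorem sum_Ioc_mul_one_sub_pow (p : ℝ) {u v : ℕ} (h : u ≤ v) :
    ∑ g ∈ Ioc u v, p * (1 - p) ^ (g - 1) = (1 - p) ^ u - (1 - p) ^ v := by
  induction v, h using Nat.le_induction with
  | base => simp
  | succ v hv ih =>
    rw [Finset.sum_Ioc_succ_top hv, ih, Nat.add_sub_cancel]
    ring

/-- The extension of a finite sequence by zero. -/
def extendZero {n : ℕ} (g : Fin n → ℕ) (i : ℕ) : ℕ := if h : i < n then g ⟨i, h⟩ else 0

theorem extendZero_apply {n : ℕ} (g : Fin n → ℕ) (i : Fin n) : extendZero g i = g i := by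
  simp [extendZero]

theorem sum_range_extendZero {n : ℕ} (g : Fin n → ℕ) :
    ∑ i ∈ range n, extendZero g i = ∑ i, g i := by
  rw [← Fin.sum_univ_eq_sum_range]
  exact Finset.sum_congr rfl fun i _ => extendZero_apply g i

/-- The event is the disjoint union of patterns over integer vectors of returns, and the product of
geometric probabilities expands over the same vectors. Distinct vectors give distinct sets of
visits, so the error is part of the sum over all sets. -/
theorem abs_measureReal_delayedReturn_sub_le {ν : Measure X} [IsFiniteMeasure ν]
    (hT : Measurable T) (hA : MeasurableSet A) (p : ℝ) {n M : ℕ} {u v : ℕ → ℕ}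
    (huv : ∀ i, u i ≤ v i) (hM : ∑ i ∈ range n, v i ≤ M) :
    |ν.real {x | ∀ i < n, ∃ g ∈ Ioc (u i) (v i), delayedReturn T α A x i = g} -
      ∏ i ∈ range n, ((1 - p) ^ u i - (1 - p) ^ v i)| ≤
    ∑ I ∈ (Ioc 0 M).powersetCard n,
      |patternMass ν (fun j => T^[delayedTime α j] ⁻¹' A) (Ioc 0 (I.sup id)) I -
        p ^ n * (1 - p) ^ (I.sup id - n)| := by
  classical
  set G : Finset (Fin n → ℕ) := Fintype.piFinset fun i => Ioc (u i) (v i) with hG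
  have hGpos : ∀ g ∈ G, ∀ i < n, 1 ≤ extendZero g i := by
    intro g hg i hi
    have h1 := mem_Ioc.1 (Fintype.mem_piFinset.1 hg ⟨i, hi⟩)
    rw [extendZero, dif_pos hi]
    omega
  have hGsum : ∀ g ∈ G, ∑ i ∈ range n, extendZero g i ≤ M := by
    intro g hg
    refine le_trans ?_ hM
    rw [sum_range_extendZero, ← Fin.sum_univ_eq_sum_range]
    exact Finset.sum_le_sum fun i _ => (mem_Ioc.1 (Fintype.mem_piFinset.1 hg i)).2
  let ev : (Fin n → ℕ) → Set X := fun g =>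
    {x | ∀ i < n, delayedReturn T α A x i = (extendZero g i : ℕ)}
  have hev : ∀ g ∈ G, ev g = {x | ∀ j ∈ Ioc 0 ((visitIndices (extendZero g) n).sup id),
      (x ∈ T^[delayedTime α j] ⁻¹' A ↔ j ∈ visitIndices (extendZero g) n)} := by
    intro g hg
    ext x
    rw [sup_visitIndices]
    exact delayedReturn_eq_iff_pattern (hGpos g hg)
  have hE : ∀ j, MeasurableSet (T^[delayedTime α j] ⁻¹' A) := fun j => hT.iterate _ hA
  have h1 : {x | ∀ i < n, ∃ g ∈ Ioc (u i) (v i), delayedReturn T α A x i = g} =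
      ⋃ g ∈ G, ev g := by
    ext x
    simp only [Set.mem_ofPred_eq, Set.mem_iUnion, exists_prop, ev]
    constructor
    · intro h
      choose g hg hgx using fun i : Fin n => h i i.2
      refine ⟨g, Fintype.mem_piFinset.2 hg, fun i hi => ?_⟩
      rw [extendZero, dif_pos hi]
      exact hgx ⟨i, hi⟩
    · rintro ⟨g, hg, h⟩ i hi
      exact ⟨g ⟨i, hi⟩, Fintype.mem_piFinset.1 hg ⟨i, hi⟩, by
        rw [h i hi, extendZero, dif_pos hi]⟩
  have hdisj : Set.PairwiseDisjoint (↑G) ev := by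
    intro g hg g' hg' hne
    rw [Function.onFun, Set.disjoint_left]
    intro x hx hx'
    refine hne (funext fun i => ?_)
    have := (hx i i.2).symm.trans (hx' i i.2)
    rwa [Nat.cast_inj, extendZero_apply, extendZero_apply] at this
  have hmeas : ∀ g ∈ G, MeasurableSet (ev g) := fun g hg => by
    rw [hev g hg]; exact measurableSet_pattern hE _ _
  rw [h1, measureReal_biUnion_finset hdisj hmeas]
  -- A return g contributes g - 1 misses, so the total number of misses is the last visit index
  -- minus n.
  have h2 : ∏ i ∈ range n, ((1 - p) ^ u i - (1 - p) ^ v i) =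
      ∑ g ∈ G, p ^ n * (1 - p) ^ ((visitIndices (extendZero g) n).sup id - n) := by
    rw [← Fin.prod_univ_eq_prod_range]
    simp only [← sum_Ioc_mul_one_sub_pow p (huv _)]
    rw [Finset.prod_univ_sum]
    refine Finset.sum_congr rfl fun g hg => ?_
    rw [Finset.prod_mul_distrib, Finset.prod_const, card_univ, Fintype.card_fin,
      Finset.prod_pow_eq_pow_sum, sup_visitIndices, sum_range_extendZero]
    congr 2
    have h3 : ∑ i, g i = ∑ i, (g i - 1) + n := by
      calc ∑ i, g i = ∑ i, ((g i - 1) + 1) := Finset.sum_congr rfl fun i _ => by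
            have := mem_Ioc.1 (Fintype.mem_piFinset.1 hg i)
            omega
        _ = _ := by simp [Finset.sum_add_distrib]
    omega
  rw [h2, ← Finset.sum_sub_distrib]
  refine (abs_sum_le_sum_abs _ _).trans ?_
  have hinj : Set.InjOn (fun g : Fin n → ℕ => visitIndices (extendZero g) n) G := by
    intro g hg g' hg' h
    refine funext fun i => ?_
    have := eq_of_visitIndices_eq (hGpos g hg) (hGpos g' hg') h i i.2
    rwa [extendZero_apply, extendZero_apply] at this
  have h3 : ∀ g ∈ G, |ν.real (ev g) -
      p ^ n * (1 - p) ^ ((visitIndices (extendZero g) n).sup id - n)| =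
      (fun I : Finset ℕ => |patternMass ν (fun j => T^[delayedTime α j] ⁻¹' A)
        (Ioc 0 (I.sup id)) I - p ^ n * (1 - p) ^ (I.sup id - n)|)
        (visitIndices (extendZero g) n) := fun g hg => by
    rw [hev g hg]; rfl
  rw [Finset.sum_congr rfl h3, ← Finset.sum_image (f := fun I : Finset ℕ =>
    |patternMass ν (fun j => T^[delayedTime α j] ⁻¹' A)
        (Ioc 0 (I.sup id)) I - p ^ n * (1 - p) ^ (I.sup id - n)|) hinj]
  refine Finset.sum_le_sum_of_subset_of_nonneg ?_ fun _ _ _ => abs_nonneg _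
  intro I hI
  obtain ⟨g, hg, rfl⟩ := mem_image.1 hI
  exact visitIndices_mem_powersetCard (hGpos g hg) (hGsum g hg)

end DelayedHits

/-! ### A criterion for weak convergence -/

section WeakConvergence

/-- Convergence on a π-system that contains small neighborhoods of almost all points implies weak
convergence. -/
theorem tendsto_probabilityMeasure_of_ae_nhds {Ω ι : Type*} [MeasurableSpace Ω]
    [TopologicalSpace Ω] [SecondCountableTopology Ω] [OpensMeasurableSpace Ω]
    {S : Set (Set Ω)} (hS : IsPiSystem S) {μ : ι → ProbabilityMeasure Ω} {ν : ProbabilityMeasure Ω}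
    {l : Filter ι} [l.IsCountablyGenerated] (hmeas : ∀ s ∈ S, MeasurableSet s)
    {Y : Set Ω} (hY : ∀ᵐ y ∂(ν : Measure Ω), y ∈ Y)
    (h : ∀ u : Set Ω, IsOpen u → ∀ x ∈ u, x ∈ Y → ∃ s ∈ S, s ∈ 𝓝 x ∧ s ⊆ u)
    (h' : ∀ s ∈ S, Tendsto (fun i => μ i s) l (𝓝 (ν s))) :
    Tendsto μ l (𝓝 ν) := by
  rcases l.eq_or_neBot with rfl | hl
  · simp
  apply tendsto_of_forall_isOpen_le_liminf
  intro G hG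
  refine (le_liminf_iff (isCoboundedUnder_ge_of_le (x := 1) l (by simp)) (by isBoundedDefault)).2
    fun r hr => ?_
  -- By second countability, countably many members of S inside G cover it up to a null set;
  -- continuity from below then leaves a finite union of mass above r.
  obtain ⟨R, hRS, hR, hRG⟩ :
      ∃ R : Finset (Set Ω), (∀ t ∈ R, t ∈ S) ∧ r < ν (⋃ t ∈ R, t) ∧ (⋃ t ∈ R, t) ⊆ G := by
    choose! s hsS hsn hsG using fun x : G => fun hx : (x : Ω) ∈ Y => h G hG x x.2 hx
    obtain ⟨R₀, hR₀, hR₀'⟩ := TopologicalSpace.isOpen_iUnion_countable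
      (fun x : {x : G // (x : Ω) ∈ Y} => interior (s x)) fun _ => isOpen_interior
    have hcov : G ∩ Y ⊆ ⋃ x ∈ R₀, s x := by
      rintro y ⟨hy, hyY⟩
      have h1 : y ∈ ⋃ x : {x : G // (x : Ω) ∈ Y}, interior (s x) := Set.mem_iUnion.2
        ⟨⟨⟨y, hy⟩, hyY⟩, mem_interior_iff_mem_nhds.2 (hsn ⟨y, hy⟩ hyY)⟩
      rw [← hR₀'] at h1
      exact Set.iUnion₂_mono (fun _ _ => interior_subset) h1
    have hsub : (⋃ x ∈ R₀, s x) ⊆ G := Set.iUnion₂_subset fun x _ => hsG x x.2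
    have hae : ν G = ν (⋃ x ∈ R₀, s x) := by
      refine le_antisymm ?_ (ProbabilityMeasure.apply_mono _ hsub)
      have h1 : (ν : Measure Ω) G ≤ (ν : Measure Ω) (⋃ x ∈ R₀, s x) :=
        measure_mono_ae (by filter_upwards [hY] with y hy using fun hyG => hcov ⟨hyG, hy⟩)
      exact ENNReal.toNNReal_mono (measure_ne_top _ _) h1
    have hne : R₀.Nonempty := by
      by_contra hne
      rw [Set.not_nonempty_iff_eq_empty.1 hne] at hae
      simp only [Set.mem_empty_iff_false, Set.iUnion_of_empty, Set.iUnion_empty] at hae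
      rw [hae] at hr
      simp at hr
    obtain ⟨f, hf⟩ := hR₀.exists_eq_range hne
    have hU : (⋃ x ∈ R₀, s x) = ⋃ n, s (f n) := by rw [hf]; simp
    rw [hae, hU] at hr
    have hlim : Tendsto (fun i => ν (Set.accumulate (fun n => s (f n)) i)) atTop
        (𝓝 (ν (⋃ n, s (f n)))) :=
      (ENNReal.tendsto_toNNReal_iff (by simp) (by simp)).2 tendsto_measure_iUnion_accumulate
    obtain ⟨n, hn⟩ := (hlim.eventually_const_lt hr).exists
    classical
    refine ⟨(Finset.range (n + 1)).image fun n => s (f n), ?_, ?_, ?_⟩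
    · intro t ht
      obtain ⟨i, -, rfl⟩ := Finset.mem_image.1 ht
      exact hsS _ (f i).2
    · convert hn using 2
      simp [Set.accumulate_def]
    · simp only [Finset.mem_image, Set.iUnion_exists, Set.biUnion_and', Set.iUnion_iUnion_eq_right]
      exact Set.iUnion₂_subset fun i _ => hsG _ (f i).2
  -- Over a π-system, inclusion–exclusion extends the convergence to finite unions.
  have hlim := hS.tendsto_probabilityMeasure_biUnion hRS hmeas h'
  filter_upwards [hlim.eventually_const_lt hR] with i hi
  exact hi.trans_le (ProbabilityMeasure.apply_mono _ hRG)

end WeakConvergence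

/-! ### Boxes in the sequence space -/

section Boxes

/-- A half-open box in the first `n` coordinates. -/
def box (n : ℕ) (b a : ℕ → ℝ) : Set (ℕ → ℝ≥0∞) :=
  {y | ∀ i < n, y i ∈ Set.Ioc (ENNReal.ofReal (b i)) (ENNReal.ofReal (a i))}

/-- The half-open boxes with nonempty sides in `[0, ∞)`. -/
def boxes : Set (Set (ℕ → ℝ≥0∞)) :=
  {s | ∃ (n : ℕ) (b a : ℕ → ℝ), (∀ i, 0 ≤ b i ∧ b i < a i) ∧ s = box n b a}

theorem box_eq_pi (n : ℕ) (b a : ℕ → ℝ) : box n b a = (Set.Iio n).pi fun i =>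
    Set.Ioc (ENNReal.ofReal (b i)) (ENNReal.ofReal (a i)) := rfl

theorem measurableSet_box (n : ℕ) (b a : ℕ → ℝ) : MeasurableSet (box n b a) := by
  rw [box_eq_pi]
  exact MeasurableSet.pi (Set.to_countable _) fun i _ => measurableSet_Ioc

/-- Sides are intersected coordinatewise, the shorter box being unconstrained in the later
coordinates. A common point keeps the new sides nonempty. -/
theorem isPiSystem_boxes : IsPiSystem boxes := by
  have key : ∀ n m : ℕ, n ≤ m → ∀ b a b' a' : ℕ → ℝ, (∀ i, 0 ≤ b i ∧ b i < a i) →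
      (∀ i, 0 ≤ b' i ∧ b' i < a' i) → (box n b a ∩ box m b' a').Nonempty →
      box n b a ∩ box m b' a' ∈ boxes := by
    rintro n m hnm b a b' a' h h' ⟨y, hy, hy'⟩
    refine ⟨m, fun i => if i < n then max (b i) (b' i) else b' i,
      fun i => if i < n then min (a i) (a' i) else a' i, fun i => ?_, ?_⟩
    · by_cases hi : i < n
      · simp only [hi, if_true]
        have h1 := hy i hi
        have h2 := hy' i (by omega)
        have h3 := ENNReal.ofReal_lt_ofReal_iff'.1 (h1.1.trans_le h2.2)
        have h4 := ENNReal.ofReal_lt_ofReal_iff'.1 (h2.1.trans_le h1.2)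
        exact ⟨le_max_of_le_left (h i).1, max_lt (lt_min (h i).2 h3.1) (lt_min h4.1 (h' i).2)⟩
      · simpa only [hi, if_false] using h' i
    · ext z
      simp only [box, Set.mem_inter_iff, Set.mem_ofPred_eq, Set.mem_Ioc]
      constructor
      · rintro ⟨h1, h2⟩ i hi
        by_cases hin : i < n
        · simp only [hin, if_true, ENNReal.ofReal_max, ENNReal.ofReal_min]
          exact ⟨max_lt (h1 i hin).1 (h2 i hi).1, le_min (h1 i hin).2 (h2 i hi).2⟩
        · simpa only [hin, if_false] using h2 i hi
      · intro h1
        refine ⟨fun i hi => ?_, fun i hi => ?_⟩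
        · have h2 := h1 i (by omega)
          simp only [hi, if_true, ENNReal.ofReal_max, ENNReal.ofReal_min, max_lt_iff,
            le_min_iff] at h2
          exact ⟨h2.1.1, h2.2.1⟩
        · have h2 := h1 i hi
          by_cases hin : i < n
          · simp only [hin, if_true, ENNReal.ofReal_max, ENNReal.ofReal_min, max_lt_iff,
              le_min_iff] at h2
            exact ⟨h2.1.2, h2.2.2⟩
          · simpa only [hin, if_false] using h2
  rintro _ ⟨n, b, a, h, rfl⟩ _ ⟨m, b', a', h', rfl⟩ hne
  rcases le_total n m with hnm | hnm
  · exact key n m hnm b a b' a' h h' hne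
  · rw [Set.inter_comm] at hne ⊢
    exact key m n hnm b' a' b a h' h hne

theorem exists_Ioc_ofReal_subset {z : ℝ≥0∞} (h0 : 0 < z) (h1 : z < ⊤) {O : Set ℝ≥0∞}
    (hO : O ∈ 𝓝 z) : ∃ b a : ℝ, 0 ≤ b ∧ b < a ∧ ENNReal.ofReal b < z ∧ z < ENNReal.ofReal a ∧
      Set.Ioc (ENNReal.ofReal b) (ENNReal.ofReal a) ⊆ O := by
  obtain ⟨l, u, ⟨hl, hu⟩, hlu⟩ := (mem_nhds_iff_exists_Ioo_subset' ⟨0, h0⟩ ⟨⊤, h1⟩).1 hO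
  obtain ⟨l', hl1, hl2⟩ := exists_between hl
  obtain ⟨u', hu1, hu2⟩ := exists_between hu
  have hl' : ENNReal.ofReal l'.toReal = l' := ENNReal.ofReal_toReal (hl2.trans h1).ne
  have hu' : ENNReal.ofReal u'.toReal = u' := ENNReal.ofReal_toReal (hu2.trans_le le_top).ne
  refine ⟨l'.toReal, u'.toReal, ENNReal.toReal_nonneg,
    ENNReal.toReal_strict_mono (hu2.trans_le le_top).ne (hl2.trans hu1), ?_⟩
  rw [hl', hu']
  exact ⟨hl2, hu1, fun w hw => hlu ⟨hl1.trans hw.1, hw.2.trans_lt hu2⟩⟩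

/-- Constrained coordinates of a box avoid 0 and ∞, so boxes form neighbourhood bases only at points
with coordinates in (0, ∞). The exponential law charges only those, which is all the criterion
needs. -/
theorem exists_box_mem_nhds {u : Set (ℕ → ℝ≥0∞)} (hu : IsOpen u) {y : ℕ → ℝ≥0∞} (hyu : y ∈ u)
    (hy : ∀ i, 0 < y i ∧ y i < ⊤) : ∃ s ∈ boxes, s ∈ 𝓝 y ∧ s ⊆ u := by
  classical
  obtain ⟨I, O, hO, hpi⟩ := isOpen_pi_iff.1 hu y hyu
  have h1 : ∀ i, (if i ∈ I then O i else Set.univ) ∈ 𝓝 (y i) := fun i => by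
    split_ifs with hi
    · exact (hO i hi).1.mem_nhds (hO i hi).2
    · exact univ_mem
  choose b a hb hba hby hya hsub using fun i => exists_Ioc_ofReal_subset (hy i).1 (hy i).2 (h1 i)
  refine ⟨box (I.sup id + 1) b a, ⟨_, b, a, fun i => ⟨hb i, hba i⟩, rfl⟩, ?_, fun z hz => ?_⟩
  · rw [box_eq_pi]
    exact set_pi_mem_nhds (Set.finite_Iio _) fun i _ => Ioc_mem_nhds (hby i) (hya i)
  · refine hpi fun i hi => ?_
    have h2 := hsub i (hz i (Nat.lt_succ_of_le (Finset.le_sup (f := id) hi)))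
    rwa [if_pos (by exact hi)] at h2

end Boxes

/-! ### The exponential limit law -/

section Exponential

theorem measureReal_expMeasure_Iic (x : ℝ) :
    (expMeasure 1).real (Set.Iic x) = if 0 ≤ x then 1 - Real.exp (-x) else 0 := by
  rw [← cdf_eq_real, cdf_expMeasure_eq one_pos]
  simp

theorem measureReal_expMeasure_Ioc {b a : ℝ} (hb : 0 ≤ b) (hba : b ≤ a) :
    (expMeasure 1).real (Set.Ioc b a) = Real.exp (-b) - Real.exp (-a) := by
  rw [← Set.Iic_sdiff_Iic, measureReal_sdiff (Set.Iic_subset_Iic.2 hba) measurableSet_Iic,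
    measureReal_expMeasure_Iic, measureReal_expMeasure_Iic, if_pos hb, if_pos (hb.trans hba)]
  ring

theorem measurable_ofReal_seq :
    Measurable fun (ω : ℕ → ℝ) (n : ℕ) => ENNReal.ofReal (ω n) := by fun_prop

theorem infinitePi_expMeasure_box {n : ℕ} {b a : ℕ → ℝ} (h : ∀ i, 0 ≤ b i ∧ b i < a i) :
    ((Measure.infinitePi fun _ : ℕ => expMeasure 1).map
      fun (ω : ℕ → ℝ) (n : ℕ) => ENNReal.ofReal (ω n)).real (box n b a) =
      ∏ i ∈ Finset.range n, (Real.exp (-b i) - Real.exp (-a i)) := by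
  rw [map_measureReal_apply measurable_ofReal_seq (measurableSet_box n b a)]
  have h1 : (fun (ω : ℕ → ℝ) (n : ℕ) => ENNReal.ofReal (ω n)) ⁻¹' box n b a =
      (↑(Finset.range n) : Set ℕ).pi fun i => Set.Ioc (b i) (a i) := by
    ext ω
    simp only [box, Set.mem_preimage, Set.mem_ofPred_eq, Set.mem_pi, Finset.coe_range, Set.mem_Iio]
    refine forall₂_congr fun i _ => ?_
    have h0 := h i
    rw [Set.mem_Ioc, Set.mem_Ioc, ENNReal.ofReal_lt_ofReal_iff_of_nonneg h0.1,
      ENNReal.ofReal_le_ofReal_iff (h0.1.trans h0.2.le)]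
  rw [h1, measureReal_def, Measure.infinitePi_pi _ fun i _ => measurableSet_Ioc,
    ENNReal.toReal_prod]
  exact Finset.prod_congr rfl fun i _ => measureReal_expMeasure_Ioc (h i).1 (h i).2.le

theorem ae_infinitePi_expMeasure_pos :
    ∀ᵐ ω ∂(Measure.infinitePi fun _ : ℕ => expMeasure 1), ∀ i, 0 < ω i := by
  refine ae_all_iff.2 fun i => ?_
  have h1 : ∀ᵐ w ∂expMeasure 1, 0 < w := by
    have h2 : (expMeasure 1).real (Set.Iic 0) = 0 := by rw [measureReal_expMeasure_Iic]; simp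
    rw [measureReal_eq_zero_iff] at h2
    rw [ae_iff]
    convert h2 using 2
    ext; simp
  exact (measurePreserving_eval_infinitePi (fun _ : ℕ => expMeasure 1)
    i).quasiMeasurePreserving.ae h1

/-- Take logarithms: ⌊b / p⌋ p tends to b, and log (1 - p) / p tends to -1, the derivative at zero.
-/
theorem tendsto_one_sub_pow_floor {ι : Type*} {l : Filter ι} {p : ι → ℝ} (hp0 : ∀ᶠ r in l, 0 < p r)
    (hp : Tendsto p l (𝓝 0)) {b : ℝ} (hb : 0 ≤ b) :
    Tendsto (fun r => (1 - p r) ^ ⌊b / p r⌋₊) l (𝓝 (Real.exp (-b))) := by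
  have hp' : Tendsto p l (𝓝[>] 0) := tendsto_nhdsWithin_iff.2 ⟨hp, hp0⟩
  have h1 : Tendsto (fun r => (⌊b / p r⌋₊ : ℝ) * p r) l (𝓝 b) := by
    have := (tendsto_nat_floor_mul_div_atTop hb).comp (tendsto_inv_nhdsGT_zero.comp hp')
    refine this.congr fun r => ?_
    simp [div_eq_mul_inv]
  have h2 : Tendsto (fun r => (p r)⁻¹ * Real.log (1 - p r)) l (𝓝 (-1)) := by
    have h3 : HasDerivAt (fun x : ℝ => Real.log (1 - x)) (-1) 0 := by
      have := ((hasDerivAt_id (0 : ℝ)).const_sub 1).log (by simp)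
      simpa using this
    have h4 := (hasDerivAt_iff_tendsto_slope_zero.1 h3).comp
      (hp'.mono_right (nhdsWithin_mono _ fun x (hx : 0 < x) => hx.ne'))
    refine h4.congr fun r => ?_
    simp
  have h3 := (Real.continuous_exp.tendsto _).comp (h1.mul h2)
  rw [mul_neg_one] at h3
  refine h3.congr' ?_
  filter_upwards [hp0, hp.eventually_lt_const one_pos] with r hr0 hr1
  have h4 : (⌊b / p r⌋₊ : ℝ) * p r * ((p r)⁻¹ * Real.log (1 - p r)) =
      Real.log (1 - p r) * ⌊b / p r⌋₊ := by
    field_simp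
  simp only [Function.comp_apply]
  rw [h4, Real.exp_mul, Real.exp_log (by linarith), Real.rpow_natCast]

end Exponential

/-! ### Convergence of the normalized returns -/

section Conclusion

theorem strictMono_delayedTime {α : ℕ → ℕ} (hα : ∀ i, 1 ≤ α i) : StrictMono (delayedTime α) :=
  strictMono_nat_of_lt_succ fun n => by
    rw [delayedTime, delayedTime, Finset.sum_range_succ]
    have := hα n
    omega

variable {X : Type*} {T : X → X} {α : ℕ → ℕ} {A : Set X}

/-- For half-open intervals the rescaling is exact: b < p g iff ⌊b / p⌋ < g, and p g ≤ a iff g ≤ ⌊a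
/ p⌋. -/
theorem mul_delayedReturn_mem_Ioc_iff {p b a : ℝ} (hp : 0 < p) (hb : 0 ≤ b) (hba : b < a) (x : X)
    (i : ℕ) :
    ENNReal.ofReal p * delayedReturn T α A x i ∈ Set.Ioc (ENNReal.ofReal b) (ENNReal.ofReal a) ↔
      ∃ g ∈ Finset.Ioc ⌊b / p⌋₊ ⌊a / p⌋₊, delayedReturn T α A x i = g := by
  have key : ∀ g : ℕ, ENNReal.ofReal p * g ∈ Set.Ioc (ENNReal.ofReal b) (ENNReal.ofReal a) ↔
      g ∈ Finset.Ioc ⌊b / p⌋₊ ⌊a / p⌋₊ := by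
    intro g
    rw [← ENNReal.ofReal_natCast, ← ENNReal.ofReal_mul hp.le, Set.mem_Ioc, Finset.mem_Ioc,
      ENNReal.ofReal_lt_ofReal_iff_of_nonneg hb, ENNReal.ofReal_le_ofReal_iff (hb.trans hba.le),
      Nat.floor_lt (div_nonneg hb hp.le), Nat.le_floor_iff (div_nonneg (hb.trans hba.le) hp.le),
      div_lt_iff₀' hp, le_div_iff₀' hp]
  constructor
  · intro h
    have h1 : delayedReturn T α A x i ≠ ⊤ := by
      intro h1
      rw [h1, ENNReal.mul_top (ENNReal.ofReal_pos.2 hp).ne'] at h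
      exact ENNReal.ofReal_ne_top (top_le_iff.1 h.2)
    obtain ⟨g, hg⟩ := delayedReturn_eq_natCast h1
    rw [hg] at h
    exact ⟨g, (key g).1 h, hg⟩
  · rintro ⟨g, hg, h⟩
    rw [h]
    exact (key g).2 hg

variable [MeasurableSpace X] {μ : Measure X} [IsProbabilityMeasure μ] {B : ℝ → Set X} {ξ : ℝ → ℝ}

/-- The joint distribution functions of the normalized delayed returns converge. -/
theorem tendsto_measureReal_delayedReturn_box (hT : MeasurePreserving T μ μ)
    (hB : ∀ r, MeasurableSet (B r))
    (hp : ∀ᶠ r in 𝓝[>] 0, 0 < μ.real (B r)) (hmix : LogMixing μ T B)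
    {c : ℝ} (hc : 0 < c) (hLR : ∀ᶠ r : ℝ in 𝓝[>] 0, ∀ᵐ x ∂μ, x ∈ B r →
      ENNReal.ofReal (c * |Real.log r|) ≤ returnTime T (B r) x)
    (hξ0 : ∀ r, 0 < r → 0 < ξ r) (hξ : (fun r : ℝ => |Real.log r|) =o[𝓝[>] 0] ξ)
    (hshort : Tendsto (fun r => μ.real (shortReturns T (B r) (ξ r)) / μ.real (B r))
      (𝓝[>] 0) (𝓝 0))
    (hα : ∀ i, 1 ≤ α i) {n : ℕ} {b a : ℕ → ℝ} (hba : ∀ i, 0 ≤ b i ∧ b i < a i) :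
    Tendsto (fun r => μ.real ((fun x i => μ (B r) * delayedReturn T α (B r) x i) ⁻¹' box n b a))
      (𝓝[>] 0) (𝓝 (∏ i ∈ Finset.range n, (Real.exp (-b i) - Real.exp (-a i)))) := by
  -- On the box the n-th visit has index at most τ / p, so the window of length ⌊τ / p⌋ sees all the
  -- visits concerned.
  set τ : ℝ := ∑ i ∈ Finset.range n, a i with hτ
  have ha0 : ∀ i, 0 ≤ a i := fun i => (hba i).1.trans (hba i).2.le
  have hτ0 : 0 ≤ τ := Finset.sum_nonneg fun i _ => ha0 i
  have hp0 := tendsto_measureReal_of_mul_abs_log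
    (tendsto_measureReal_mul_abs_log hT hB hp hξ0 hξ hshort)
  let W : ℝ → Set X := fun r =>
    lateReturns T (B r) (delayedTime α) (ξ r) ⌊τ / μ.real (B r)⌋₊
  have hW : ∀ r, MeasurableSet (W r) := fun r => measurableSet_lateReturns hT.measurable (hB r) _ _
  have h1 := tendsto_sum_abs_patternMass_sub hT hB hp hmix hc hLR hξ0 hξ hshort
    (strictMono_delayedTime hα) hτ0 n
  have h2 : Tendsto (fun r => ∏ i ∈ Finset.range n,
      ((1 - μ.real (B r)) ^ ⌊b i / μ.real (B r)⌋₊ - (1 - μ.real (B r)) ^ ⌊a i / μ.real (B r)⌋₊))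
      (𝓝[>] 0) (𝓝 (∏ i ∈ Finset.range n, (Real.exp (-b i) - Real.exp (-a i)))) :=
    tendsto_finsetProd _ fun i _ => (tendsto_one_sub_pow_floor hp hp0 (hba i).1).sub
      (tendsto_one_sub_pow_floor hp hp0 (ha0 i))
  have h3 := (h1.add (hshort.const_mul τ))
  simp only [mul_zero, add_zero] at h3
  rw [← tendsto_sub_nhds_zero_iff] at h2 ⊢
  rw [tendsto_zero_iff_abs_tendsto_zero] at h2 ⊢
  have h4 := h3.add h2
  rw [add_zero] at h4
  refine squeeze_zero' (Eventually.of_forall fun r => abs_nonneg _) ?_ h4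
  filter_upwards [hp] with r hr
  simp only [Function.comp_apply]
  set p := μ.real (B r) with hpdef
  have hμp : μ (B r) = ENNReal.ofReal p := (ofReal_measureReal (measure_ne_top _ _)).symm
  have hset : (fun x i => μ (B r) * delayedReturn T α (B r) x i) ⁻¹' box n b a =
      {x | ∀ i < n, ∃ g ∈ Finset.Ioc ⌊b i / p⌋₊ ⌊a i / p⌋₊,
        delayedReturn T α (B r) x i = g} := by
    ext x
    simp only [box, Set.mem_preimage, Set.mem_ofPred_eq, hμp]
    exact forall₂_congr fun i _ => mul_delayedReturn_mem_Ioc_iff hr (hba i).1 (hba i).2 x i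
  rw [hset]
  set E := {x | ∀ i < n, ∃ g ∈ Finset.Ioc ⌊b i / p⌋₊ ⌊a i / p⌋₊,
        delayedReturn T α (B r) x i = g} with hE
  have h5 := abs_measureReal_delayedReturn_sub_le (ν := μ.restrict (W r)) (α := α) hT.measurable
    (hB r) p (n := n) (M := ⌊τ / p⌋₊) (u := fun i => ⌊b i / p⌋₊) (v := fun i => ⌊a i / p⌋₊)
    (fun i => Nat.floor_le_floor (div_le_div_of_nonneg_right (hba i).2.le hr.le)) (by
      refine Nat.le_floor ?_
      rw [hτ, Finset.sum_div, Nat.cast_sum]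
      exact Finset.sum_le_sum fun i _ => Nat.floor_le (div_nonneg (ha0 i) hr.le))
  rw [← hE] at h5
  -- Restoring the discarded points costs at most their mass, which is τ times the conditional
  -- probability of a short return.
  have h6 : |μ.real E - (μ.restrict (W r)).real E| ≤
      τ * (μ.real (shortReturns T (B r) (ξ r)) / p) := by
    have h7 : (μ.restrict (W r)).real E = μ.real (E ∩ W r) := measureReal_restrict_apply' (hW r)
    have h8 := measureReal_inter_add_sdiff (μ := μ) (s := E) (hW r)
    have h9 : μ.real (E \ W r) ≤ μ.real (W r)ᶜ := measureReal_mono fun x hx => hx.2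
    have h10 : μ.real (W r)ᶜ ≤ _ := measureReal_compl_lateReturns_le hT (hB r) (ξ r) ⌊τ / p⌋₊
    have h11 : (⌊τ / p⌋₊ : ℝ) * μ.real (shortReturns T (B r) (ξ r)) ≤
        τ * (μ.real (shortReturns T (B r) (ξ r)) / p) := by
      calc _ ≤ τ / p * μ.real (shortReturns T (B r) (ξ r)) :=
            mul_le_mul_of_nonneg_right (Nat.floor_le (div_nonneg hτ0 hr.le)) measureReal_nonneg
        _ = _ := by ring
    have h12 : 0 ≤ μ.real (E \ W r) := measureReal_nonneg
    rw [h7, abs_of_nonneg (by linarith)]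
    linarith
  have h7 := abs_sub_le (μ.real E) ((μ.restrict (W r)).real E)
    (∏ i ∈ Finset.range n, (Real.exp (-b i) - Real.exp (-a i)))
  have h8 := abs_sub_le ((μ.restrict (W r)).real E)
    (∏ i ∈ Finset.range n, ((1 - p) ^ ⌊b i / p⌋₊ - (1 - p) ^ ⌊a i / p⌋₊))
    (∏ i ∈ Finset.range n, (Real.exp (-b i) - Real.exp (-a i)))
  linarith

theorem tendstoInDistribution_delayedReturn (hT : MeasurePreserving T μ μ)
    (hB : ∀ r, MeasurableSet (B r))
    (hp : ∀ᶠ r in 𝓝[>] 0, 0 < μ.real (B r)) (hmix : LogMixing μ T B)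
    {c : ℝ} (hc : 0 < c) (hLR : ∀ᶠ r : ℝ in 𝓝[>] 0, ∀ᵐ x ∂μ, x ∈ B r →
      ENNReal.ofReal (c * |Real.log r|) ≤ returnTime T (B r) x)
    (hξ0 : ∀ r, 0 < r → 0 < ξ r) (hξ : (fun r : ℝ => |Real.log r|) =o[𝓝[>] 0] ξ)
    (hcond : Tendsto (fun r : ℝ => (ProbabilityTheory.cond μ (B r))
      {x | returnTime T (B r) x ≤ ENNReal.ofReal (ξ r)}) (𝓝[>] 0) (𝓝 0))
    (hα : ∀ i, 1 ≤ α i) :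
    TendstoInDistribution
      (fun (r : ℝ) (x : X) (n : ℕ) => μ (B r) * delayedReturn T α (B r) x n) (𝓝[>] 0)
      (fun (ω : ℕ → ℝ) (n : ℕ) => ENNReal.ofReal (ω n)) (fun _ => μ)
      (Measure.infinitePi fun _ : ℕ => expMeasure 1) := by
  have hm : ∀ r, Measurable fun (x : X) (n : ℕ) => μ (B r) * delayedReturn T α (B r) x n :=
    fun r => measurable_pi_lambda _ fun n =>
      (measurable_delayedReturn hT.measurable (hB r) n).const_mul _
  refine ⟨fun r => (hm r).aemeasurable, measurable_ofReal_seq.aemeasurable, ?_⟩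
  refine tendsto_probabilityMeasure_of_ae_nhds (S := boxes) isPiSystem_boxes ?_
    (Y := {y | ∀ i, 0 < y i ∧ y i < ⊤}) ?_ (fun u hu y hyu hy => exists_box_mem_nhds hu hyu hy) ?_
  · rintro _ ⟨n, b, a, -, rfl⟩
    exact measurableSet_box n b a
  · refine (ae_map_iff measurable_ofReal_seq.aemeasurable ?_).2 ?_
    · have : {y : ℕ → ℝ≥0∞ | ∀ i, 0 < y i ∧ y i < ⊤} =
          Set.univ.pi fun _ => Set.Ioo (0 : ℝ≥0∞) ⊤ := by
        ext; simp
      rw [Set.ofPred_mem_eq, this]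
      exact MeasurableSet.univ_pi fun _ => measurableSet_Ioo
    · filter_upwards [ae_infinitePi_expMeasure_pos] with ω hω i
      exact ⟨ENNReal.ofReal_pos.2 (hω i), ENNReal.ofReal_lt_top⟩
  · rintro _ ⟨n, b, a, hba, rfl⟩
    have h1 := tendsto_measureReal_delayedReturn_box hT hB hp hmix hc hLR hξ0 hξ
      (tendsto_shortReturns_div hB hcond) hα (n := n) hba
    rw [← infinitePi_expMeasure_box hba] at h1
    rw [← NNReal.tendsto_coe]
    refine h1.congr fun r => ?_
    rw [← map_measureReal_apply (hm r) (measurableSet_box n b a)]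
    rfl

end Conclusion

end DelayedPoisson

theorem mainTheorem6 {d : ℕ} {k : ℕ∞} {X : Type*} [EMetricSpace X] [SecondCountableTopology X]
    [MeasurableSpace X] [BorelSpace X]
    [ChartedSpace (EuclideanSpace ℝ (Fin d)) X] [IsManifold (𝓡 d) 1 X] [IsManifold (𝓡 d) k X]
    [Bundle.RiemannianBundle (fun x : X => TangentSpace (𝓡 d) x)]
    [IsContinuousRiemannianBundle (EuclideanSpace ℝ (Fin d))
      (fun x : X => TangentSpace (𝓡 d) x)]
    [IsRiemannianManifold (𝓡 d) X]
    (𝒜 : DelayedPoisson.ChartCover d k X)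
    (μ : Measure X) [IsProbabilityMeasure μ]
    (ρ : X → ℝ≥0) (hρ : Continuous ρ)
    (hμ : μ = (Measure.euclideanHausdorffMeasure d : Measure X).withDensity
      (fun x => (ρ x : ℝ≥0∞)))
    (T : X → X) (hT : MeasurePreserving T μ μ)
    (c : X) (hc : 0 < ρ c)
    (hMEM : DelayedPoisson.ExpMixingAllOrders 𝒜 μ T)
    (hLR : DelayedPoisson.LogRecurrent μ T c)
    (hNSR : DelayedPoisson.NoShortReturns μ T c) :
    DelayedPoisson.DelayedPLT μ T c := by
  obtain ⟨s, hs, hsk, C, hC, γ, hγ, hmix⟩ := hMEM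
  obtain ⟨a, ha, hLR⟩ := hLR
  obtain ⟨ξ, hξ0, hξ, hcond⟩ := hNSR
  obtain ⟨Q, D, hD, happ⟩ := DelayedPoisson.exists_smooth_approximations 𝒜 μ ρ hρ hμ c hc hs hsk
  have hB : ∀ r, MeasurableSet (Metric.eball c (ENNReal.ofReal r)) := fun r =>
    Metric.isOpen_eball.measurableSet
  have hp : ∀ᶠ r in 𝓝[>] 0, 0 < μ.real (Metric.eball c (ENNReal.ofReal r)) := by
    filter_upwards [hD, self_mem_nhdsWithin] with r hr (hr0 : 0 < r)
    exact (pow_pos hr0 D).trans_le hr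
  intro α hα
  exact DelayedPoisson.tendstoInDistribution_delayedReturn hT hB hp
    (DelayedPoisson.logMixing_of_approximations 𝒜 μ T hT _ hB hC hγ hmix hD happ)
    ha hLR hξ0 hξ hcond hα
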